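/- **Theorem (Morawetz bulk estimate on Schwarzschild).** Let $M>0$ and consider the Schwarzschild exterior $\mathbb{R}_t\times(2M,\infty)_r\times S^2$ with metric $$g=(1-\tfrac{2M}{r})\,dt^2-(1-\tfrac{2M}{r})^{-1}dr^2-r^2(d\theta^2+\sin^2\theta\,d\phi^2),$$ Levi-Civita connection $\nabla$, Hodge dual $*$ (so ${*}F_{ab}=\tfrac12\epsilon_{abcd}F^{cd}$) and volume measure $d\mu$. Let $F_{ab}$ be a smooth real $2$-form on the exterior with $\nabla^aF_{ab}=0$ and $\nabla_{[a}F_{bc]}=0$. Put $Y_{ab}=-2r^3\sin\theta\,d\theta_{[a}d\phi_{b]}$, $U_a=-r^{-1}\nabla_a r$ and $$Z_{ab}=-\tfrac43\,{*}F_{[a}{}^{c}Y_{b]c},\qquad \beta_a=-\tfrac12U^bZ_{ab}-\tfrac12 i\,U^b{*}Z_{ab}-\tfrac12\nabla_bZ_a{}^b-\tfrac12 i\,\nabla_b{*}Z_a{}^b,$$ $$\mathbf H_{ab}=\beta_{(a}\bar\beta_{b)}-\tfrac12g_{ab}\beta^c\bar\beta_c,\qquad \mathbf W_{ab}=-\tfrac12Z_a{}^cZ_{bc}+\tfrac18g_{ab}Z_{cd}Z^{cd}.$$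 With $$A^a=\frac{(r-3M)(r-2M)}{2r^2}(\partial_r)^a,\qquad q=\frac{9M^2(r-2M)(2r-3M)}{4r^5},$$ let $\mathbf P_a$ be the (real) Morawetz current $$\mathbf P_a=\mathbf H_{ab}A^b+\tfrac14q\beta^bZ_{ab}+\tfrac14q\bar\beta^bZ_{ab}-\tfrac14iq\beta^b{*}Z_{ab}+\tfrac14iq\bar\beta^b{*}Z_{ab}+\tfrac1{16}Z_{bc}Z^{bc}\nabla_aq-\tfrac14Z_a{}^cZ_{bc}\nabla^bq .$$ Let $\widehat T=(1-\frac{2M}{r})^{-1/2}\partial_t$, $\widehat X=r^{-1}\partial_\theta$, $\widehat Y=r^{-1}\csc\theta\,\partial_\phi$, $\widehat Z=(1-\frac{2M}{r})^{1/2}\partial_r$, write $\beta_\nu=\beta_a\nu^a$, and set $$|\beta|^2_{1,\mathrm{deg}}=\frac{(r-3M)^2}{r^3}\bigl(|\beta_{\widehat X}|^2+|\beta_{\widehat Y}|^2\bigr)+\frac{M(r-2M)}{r^3}|\beta_{\widehat Z}|^2+\frac{M(r-3M)^2(r-2M)}{r^5}|\beta_{\widehat T}|^2,$$ $$|\Theta|^2_2=\frac{r-2M}{r}\,\mathbf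 W_{\widehat T\widehat T}.$$ Then for every spherically symmetric measurable region $\Omega$ of the exterior (a union of spheres of constant $t$ and $r$) on which $\nabla^a\mathbf P_a$ is integrable, the function $\tfrac18|\beta|^2_{1,\mathrm{deg}}+\tfrac{M}{100r^4}|\Theta|_2^2$ is integrable on $\Omega$ and $$\int_\Omega-\nabla^a\mathbf P_a\,d\mu\;\ge\;\int_\Omega\Bigl(\tfrac18|\beta|^2_{1,\mathrm{deg}}+\frac{M}{100\,r^4}|\Theta|^2_2\Bigr)d\mu .$$ Moreover, without any integrability assumption, in $[0,\infty]$, $$\int_\Omega\Bigl(\tfrac18|\beta|^2_{1,\mathrm{deg}}+\frac{M}{100\,r^4}|\Theta|^2_2\Bigr)d\mu+\int_\Omega(\nabla^a\mathbf P_a)_+\,d\mu\;\le\;\int_\Omega(-\nabla^a\mathbf P_a)_+\,d\mu ,$$ where $(x)_+=\max(x,0)$. -/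

import Mathlib

open MeasureTheory
open scoped ContDiff

noncomputable section

namespace Schwarzschild

/-! ### The exterior region

The exterior `ℝ × (2M, ∞) × S²` is covered by the single global chart
`(t, x¹, x², x³) = (t, r sin θ cos φ, r sin θ sin φ, r cos θ)`, which is smooth across the axis
`θ ∈ {0, π}`.  All tensor fields below are given by their components in this chart; index `0` is
`t` and the indices `1, 2, 3` are spatial. -/

/-- Coordinates `(t, x¹, x², x³)`. -/
abbrev Pt : Type := Fin 4 → ℝ

/-- The area radius `r`. -/
def rad (p : Pt) : ℝ := Real.sqrt (p 1 ^ 2 + p 2 ^ 2 + p 3 ^ 2)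

/-- The exterior region `r > 2M`. -/
def exterior (M : ℝ) : Set Pt := {p | 2 * M < rad p}

/-- The coordinate partial derivative `∂_a f`. -/
def pd (a : Fin 4) (f : Pt → ℝ) (p : Pt) : ℝ := fderiv ℝ f p (Pi.single a 1)

/-- The metric `g = (1-2M/r) dt² - (1-2M/r)⁻¹ dr² - r² (dθ² + sin² θ dφ²)`, where
`r² (dθ² + sin² θ dφ²) = (dx¹)² + (dx²)² + (dx³)² - dr²`. -/
def metric (M : ℝ) (p : Pt) : Matrix (Fin 4) (Fin 4) ℝ := Matrix.of fun a b =>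
  (1 - 2 * M / rad p) * (if a = 0 ∧ b = 0 then 1 else 0)
    - (1 - 2 * M / rad p)⁻¹ * (pd a rad p * pd b rad p)
    - ((if a = b ∧ a ≠ 0 then 1 else 0) - pd a rad p * pd b rad p)

/-- The inverse metric `g^{ab}`. -/
def invMetric (M : ℝ) (p : Pt) : Matrix (Fin 4) (Fin 4) ℝ := (metric M p)⁻¹

/-- The spacetime volume measure `dμ = √|det g| dt dx¹ dx² dx³`. -/
def vol (M : ℝ) : Measure Pt :=
  (volume : Measure Pt).withDensity fun p => ENNReal.ofReal (Real.sqrt |(metric M p).det|)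

/-- A set is spherically symmetric when it is a union of orbits of the rotation group, i.e. of
spheres on which `t` and `r` are constant. -/
def SphericallySymmetric (Ω : Set Pt) : Prop :=
  ∀ p q : Pt, p 0 = q 0 → rad p = rad q → p ∈ Ω → q ∈ Ω

/-! ### Tensor calculus of the Levi-Civita connection -/

/-- The Christoffel symbol `Γ^c_{ab}`. -/
def christoffel (M : ℝ) (p : Pt) (c a b : Fin 4) : ℝ :=
  (1 / 2) * ∑ d, invMetric M p c d *
    (pd a (fun x => metric M x b d) p + pd b (fun x => metric M x a d) p
      - pd d (fun x => metric M x a b) p)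

/-- `∇_b w_a` for a real `1`-form `w`. -/
def nabla1 (M : ℝ) (w : Pt → Fin 4 → ℝ) (p : Pt) (b a : Fin 4) : ℝ :=
  pd b (fun x => w x a) p - ∑ d, christoffel M p d b a * w p d

/-- `∇_c w_{ab}` for a real covariant `2`-tensor `w`. -/
def nabla2 (M : ℝ) (w : Pt → Fin 4 → Fin 4 → ℝ) (p : Pt) (c a b : Fin 4) : ℝ :=
  pd c (fun x => w x a b) p
    - ∑ d, (christoffel M p d c a * w p d b + christoffel M p d c b * w p a d)

/-- `∇^a w_a` for a real `1`-form `w`. -/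
def div1 (M : ℝ) (w : Pt → Fin 4 → ℝ) (p : Pt) : ℝ :=
  ∑ a, ∑ b, invMetric M p a b * nabla1 M w p a b

/-- `∇_b w_a{}^b` for a real covariant `2`-tensor `w`. -/
def div2 (M : ℝ) (w : Pt → Fin 4 → Fin 4 → ℝ) (p : Pt) (a : Fin 4) : ℝ :=
  ∑ b, ∑ c, invMetric M p b c * nabla2 M w p b a c

/-- The permutation symbol `[abcd]`, with `[0123] = 1`. -/
def permSymbol (a b c d : Fin 4) : ℤ :=
  (Matrix.of fun i j : Fin 4 => if ![a, b, c, d] i = j then (1 : ℤ) else 0).det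

/-- The volume form `ε_{abcd}`, for the orientation in which `(∂_t, ∂_1, ∂_2, ∂_3)` is positive. -/
def volForm (M : ℝ) (p : Pt) (a b c d : Fin 4) : ℝ :=
  Real.sqrt |(metric M p).det| * (permSymbol a b c d : ℝ)

/-- The Hodge dual `*w_{ab} = ½ ε_{abcd} w^{cd}`. -/
def hodge (M : ℝ) (w : Pt → Fin 4 → Fin 4 → ℝ) (p : Pt) (a b : Fin 4) : ℝ :=
  (1 / 2) * ∑ c, ∑ d, ∑ e, ∑ f,
    volForm M p a b c d * invMetric M p c e * invMetric M p d f * w p e f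

/-! ### Maxwell fields and the derived fields `Z_{ab}`, `β_a` -/

/-- A smooth real `2`-form `F_{ab}` on the exterior with `∇^a F_{ab} = 0` and
`∇_{[a} F_{bc]} = 0`. -/
structure IsMaxwellField (M : ℝ) (F : Pt → Fin 4 → Fin 4 → ℝ) : Prop where
  smooth : ∀ a b, ContDiffOn ℝ ∞ (fun p => F p a b) (exterior M)
  antisymm : ∀ p ∈ exterior M, ∀ a b, F p a b = - F p b a
  div_eq_zero : ∀ p ∈ exterior M, ∀ b,
    ∑ a, ∑ c, invMetric M p a c * nabla2 M F p c a b = 0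
  closed : ∀ p ∈ exterior M, ∀ a b c,
    nabla2 M F p a b c + nabla2 M F p b c a + nabla2 M F p c a b = 0

/-- The Killing-Yano tensor `Y_{ab} = - 2 r³ sin θ dθ_{[a} dφ_{b]} = - r (r² sin θ dθ ∧ dφ)_{ab}`.
In the chart, `r² sin θ dθ ∧ dφ = r⁻¹ (x¹ dx² ∧ dx³ + x² dx³ ∧ dx¹ + x³ dx¹ ∧ dx²)`. -/
def killingYano (p : Pt) (a b : Fin 4) : ℝ := - ∑ c, (permSymbol 0 a b c : ℝ) * p c

/-- `Z_{ab} = - (4/3) *F_{[a}{}^c Y_{b]c}`. -/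
def fieldZ (M : ℝ) (F : Pt → Fin 4 → Fin 4 → ℝ) (p : Pt) (a b : Fin 4) : ℝ :=
  - (4 / 3) * ((1 / 2) * ∑ c, ∑ d, invMetric M p c d *
    (hodge M F p a d * killingYano p b c - hodge M F p b d * killingYano p a c))

/-- `U_a = - r⁻¹ ∇_a r`. -/
def fieldU (p : Pt) (a : Fin 4) : ℝ := - (rad p)⁻¹ * pd a rad p

/-- `U^b w_{ab}`. -/
def contractU (M : ℝ) (w : Pt → Fin 4 → Fin 4 → ℝ) (p : Pt) (a : Fin 4) : ℝ :=
  ∑ b, ∑ c, invMetric M p b c * fieldU p c * w p a b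

/-- `β_a = - ½ U^b Z_{ab} - ½ i U^b *Z_{ab} - ½ ∇_b Z_a{}^b - ½ i ∇_b *Z_a{}^b`. -/
def fieldβ (M : ℝ) (F : Pt → Fin 4 → Fin 4 → ℝ) (p : Pt) (a : Fin 4) : ℂ :=
  - (1 / 2) * (contractU M (fieldZ M F) p a : ℂ)
    - (1 / 2) * Complex.I * (contractU M (hodge M (fieldZ M F)) p a : ℂ)
    - (1 / 2) * (div2 M (fieldZ M F) p a : ℂ)
    - (1 / 2) * Complex.I * (div2 M (hodge M (fieldZ M F)) p a : ℂ)

/-- `β^a`. -/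
def fieldβUp (M : ℝ) (F : Pt → Fin 4 → Fin 4 → ℝ) (p : Pt) (a : Fin 4) : ℂ :=
  ∑ b, (invMetric M p a b : ℂ) * fieldβ M F p b

/-- The superenergy tensor `H_{ab} = β_{(a} β̄_{b)} - ½ g_{ab} β^c β̄_c`. -/
def superH (M : ℝ) (F : Pt → Fin 4 → Fin 4 → ℝ) (p : Pt) (a b : Fin 4) : ℂ :=
  (1 / 2) * (fieldβ M F p a * star (fieldβ M F p b) + fieldβ M F p b * star (fieldβ M F p a))
    - (1 / 2) * (metric M p a b : ℂ) *
      ∑ c, ∑ d, (invMetric M p c d : ℂ) * fieldβ M F p c * star (fieldβ M F p d)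

/-- `Z_a{}^c Z_{bc}`. -/
def squareZ (M : ℝ) (F : Pt → Fin 4 → Fin 4 → ℝ) (p : Pt) (a b : Fin 4) : ℝ :=
  ∑ c, ∑ d, invMetric M p c d * fieldZ M F p a d * fieldZ M F p b c

/-- `Z_{cd} Z^{cd}`. -/
def normZ (M : ℝ) (F : Pt → Fin 4 → Fin 4 → ℝ) (p : Pt) : ℝ :=
  ∑ a, ∑ b, invMetric M p a b * squareZ M F p a b

/-- The superenergy tensor `W_{ab} = - ½ Z_a{}^c Z_{bc} + ⅛ g_{ab} Z_{cd} Z^{cd}`. -/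
def superW (M : ℝ) (F : Pt → Fin 4 → Fin 4 → ℝ) (p : Pt) (a b : Fin 4) : ℝ :=
  - (1 / 2) * squareZ M F p a b + (1 / 8) * metric M p a b * normZ M F p

/-! ### The Morawetz current -/

/-- The current
`P_a = H_{ab} A^b + ¼ q β^b Z_{ab} + ¼ q β̄^b Z_{ab} - ¼ i q β^b *Z_{ab} + ¼ i q β̄^b *Z_{ab}`
`      + (1/16) Z_{bc} Z^{bc} ∇_a q - ¼ Z_a{}^c Z_{bc} ∇^b q`
of a real vector field `A` and a real scalar field `q`, as a complex expression. -/
def currentℂ (M : ℝ) (F : Pt → Fin 4 → Fin 4 → ℝ) (A : Pt → Fin 4 → ℝ) (q : Pt → ℝ)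
    (p : Pt) (a : Fin 4) : ℂ :=
  (∑ b, superH M F p a b * (A p b : ℂ))
    + (1 / 4) * (q p : ℂ) * ∑ b, fieldβUp M F p b * (fieldZ M F p a b : ℂ)
    + (1 / 4) * (q p : ℂ) * ∑ b, star (fieldβUp M F p b) * (fieldZ M F p a b : ℂ)
    - (1 / 4) * Complex.I * (q p : ℂ) *
        ∑ b, fieldβUp M F p b * (hodge M (fieldZ M F) p a b : ℂ)
    + (1 / 4) * Complex.I * (q p : ℂ) *
        ∑ b, star (fieldβUp M F p b) * (hodge M (fieldZ M F) p a b : ℂ)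
    + (1 / 16) * (normZ M F p : ℂ) * (pd a q p : ℂ)
    - (1 / 4) * ((∑ b, ∑ d, squareZ M F p a b * (invMetric M p b d * pd d q p) : ℝ) : ℂ)

/-- The same current as a real `1`-form. -/
def current (M : ℝ) (F : Pt → Fin 4 → Fin 4 → ℝ) (A : Pt → Fin 4 → ℝ) (q : Pt → ℝ)
    (p : Pt) (a : Fin 4) : ℝ := (currentℂ M F A q p a).re

theorem invMetric_symm (M : ℝ) (p : Pt) (a b : Fin 4) :
    invMetric M p a b = invMetric M p b a := by
  have h : (metric M p).transpose = metric M p := by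
    ext i j
    simp only [Matrix.transpose_apply, metric, Matrix.of_apply]
    have h1 : (j = 0 ∧ i = 0) ↔ (i = 0 ∧ j = 0) := and_comm
    have h2 : (j = i ∧ j ≠ 0) ↔ (i = j ∧ i ≠ 0) := by
      constructor <;> (rintro ⟨rfl, h⟩; exact ⟨rfl, h⟩)
    simp only [h1, h2, mul_comm (pd j rad p)]
  have h' : (invMetric M p).transpose = invMetric M p := by
    unfold invMetric
    rw [Matrix.transpose_nonsing_inv, h]
  exact congrFun (congrFun h' b) a

theorem star_superH (M : ℝ) (F : Pt → Fin 4 → Fin 4 → ℝ) (p : Pt) (a b : Fin 4) :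
    star (superH M F p a b) = superH M F p a b := by
  have hs : star (∑ c, ∑ d, (invMetric M p c d : ℂ) * fieldβ M F p c * star (fieldβ M F p d))
      = ∑ c, ∑ d, (invMetric M p c d : ℂ) * fieldβ M F p c * star (fieldβ M F p d) := by
    rw [star_sum, Finset.sum_comm]
    simp only [star_sum]
    rw [Finset.sum_comm]
    conv_rhs => rw [Finset.sum_comm]
    refine Finset.sum_congr rfl fun c _ => Finset.sum_congr rfl fun d _ => ?_
    rw [invMetric_symm M p c d]
    simp
    ring
  unfold superH
  rw [star_sub, star_mul, star_mul, hs]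
  simp
  ring

/-- The current is real: its complex expression equals the real `1`-form `current`. -/
theorem ofReal_current (M : ℝ) (F : Pt → Fin 4 → Fin 4 → ℝ) (A : Pt → Fin 4 → ℝ) (q : Pt → ℝ)
    (p : Pt) (a : Fin 4) : (current M F A q p a : ℂ) = currentℂ M F A q p a := by
  have h : star (currentℂ M F A q p a) = currentℂ M F A q p a := by
    unfold currentℂ
    simp only [star_add, star_sub, star_mul, star_sum, star_superH, star_star]
    simp [mul_comm]
    ring
  exact Complex.conj_eq_iff_re.mp h

/-- `A = (r-3M)(r-2M)/(2r²) ∂_r`, where `∂_r = (x^i / r) ∂_i`. -/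
def morawetzA (M : ℝ) (p : Pt) (a : Fin 4) : ℝ :=
  (rad p - 3 * M) * (rad p - 2 * M) / (2 * rad p ^ 2) * (if a = 0 then 0 else p a / rad p)

/-- `q = 9M²(r-2M)(2r-3M)/(4r⁵)`. -/
def morawetzq (M : ℝ) (p : Pt) : ℝ :=
  9 * M ^ 2 * (rad p - 2 * M) * (2 * rad p - 3 * M) / (4 * rad p ^ 5)

/-- The Morawetz current `P_a` for the above choice of `A` and `q`. -/
def morawetzP (M : ℝ) (F : Pt → Fin 4 → Fin 4 → ℝ) : Pt → Fin 4 → ℝ :=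
  current M F (morawetzA M) (morawetzq M)

/-! ### The orthonormal frame and the degenerate norms -/

/-- The distance `r sin θ` to the axis. -/
def axisDist (p : Pt) : ℝ := Real.sqrt (p 1 ^ 2 + p 2 ^ 2)

/-- `T̂ = (1-2M/r)^{-1/2} ∂_t`. -/
def frameT (M : ℝ) (p : Pt) : Fin 4 → ℝ := ![(Real.sqrt (1 - 2 * M / rad p))⁻¹, 0, 0, 0]

/-- `X̂ = r⁻¹ ∂_θ = (0, cos θ cos φ, cos θ sin φ, - sin θ)`; on the axis, a null set where `∂_θ` is
not defined, the value is irrelevant. -/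
def frameX (p : Pt) : Fin 4 → ℝ :=
  ![0, p 3 / rad p * (p 1 / axisDist p), p 3 / rad p * (p 2 / axisDist p), - (axisDist p / rad p)]

/-- `Ŷ = r⁻¹ csc θ ∂_φ = (0, - sin φ, cos φ, 0)`; on the axis, a null set where `csc θ ∂_φ` is not
defined, the value is irrelevant. -/
def frameY (p : Pt) : Fin 4 → ℝ := ![0, - (p 2 / axisDist p), p 1 / axisDist p, 0]

/-- `Ẑ = (1-2M/r)^{1/2} ∂_r`. -/
def frameZ (M : ℝ) (p : Pt) : Fin 4 → ℝ :=
  fun a => Real.sqrt (1 - 2 * M / rad p) * (if a = 0 then 0 else p a / rad p)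

/-- The component `β_ν = β_a ν^a`. -/
def βAlong (M : ℝ) (F : Pt → Fin 4 → Fin 4 → ℝ) (p : Pt) (ν : Fin 4 → ℝ) : ℂ :=
  ∑ a, fieldβ M F p a * (ν a : ℂ)

/-- `|β|²_{1,deg} = (r-3M)²/r³ (|β_X̂|² + |β_Ŷ|²) + M(r-2M)/r³ |β_Ẑ|²`
`                 + M(r-3M)²(r-2M)/r⁵ |β_T̂|²`. -/
def normβDeg (M : ℝ) (F : Pt → Fin 4 → Fin 4 → ℝ) (p : Pt) : ℝ :=
  (rad p - 3 * M) ^ 2 / rad p ^ 3 *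
      (‖βAlong M F p (frameX p)‖ ^ 2 + ‖βAlong M F p (frameY p)‖ ^ 2)
    + M * (rad p - 2 * M) / rad p ^ 3 * ‖βAlong M F p (frameZ M p)‖ ^ 2
    + M * (rad p - 3 * M) ^ 2 * (rad p - 2 * M) / rad p ^ 5 *
      ‖βAlong M F p (frameT M p)‖ ^ 2

/-- `|Θ|²_2 = |Z|²_2 = (r-2M)/r W_{T̂T̂}`. -/
def normΘ (M : ℝ) (F : Pt → Fin 4 → Fin 4 → ℝ) (p : Pt) : ℝ :=
  (rad p - 2 * M) / rad p * ∑ a, ∑ b, superW M F p a b * frameT M p a * frameT M p b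

/-- The integrand `⅛ |β|²_{1,deg} + M/(100 r⁴) |Θ|²_2`. -/
def morawetzBulk (M : ℝ) (F : Pt → Fin 4 → Fin 4 → ℝ) (p : Pt) : ℝ :=
  (1 / 8) * normβDeg M F p + M / (100 * rad p ^ 4) * normΘ M F p

end Schwarzschild

end

open MeasureTheory
open scoped ContDiff

noncomputable section

namespace Schwarzschild

/-! ### Calculus in the chart -/

/-! Write f = 1 - 2M/r and let n be the radial unit vector. In the chart the metric is f on dt²,
-1/f along n, and -1 on the tangent planes of the spheres. Its determinant is -1, so dμ is Lebesgue
measure and the divergence of a 1-form is the coordinate divergence of the raised vector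
(`det_metric`, `div1_metric`). A 2-form w is encoded by the two spatial vectors w_{0i} and
(*w)_{0i}, which duality rotates into each other (`hodge_form`), and Maxwell's equations become
equations for such a pair E, C (`maxwellPair`).

Contraction with the Killing-Yano tensor is a cross product with x: Z is encoded by e = (2/3) x × C
and h = -(2/3) x × E, both tangent to the spheres (`fieldZ_form`). Moreover β = r⁻¹ dφ with φ =
(r/3) x·(E + iC) (`fieldβ_eq`). The real and imaginary parts of β therefore satisfy the same first
order system `WaveSystem`: r Re β is closed, Re β obeys a wave equation, its time component is half
of div e, and its radial component times f is half of n·curl h. For Im β the pair (e, h) is replaced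
by (h, -e).

The current is a sum of three fluxes: the superenergy flux of β along A, a mixed flux in β and Z
with weight q, and ½W·∇q. The derivatives of Z cancel in their divergence, leaving a diagonal
quadratic form in β plus a multiple of |e|² + |h|² (`BetaSystem.div_current`). The multiplier A
alone gives an angular coefficient that is negative at r = 3M; q takes weight from the time
coefficient and adds it to the angular and radial ones, so that the time and angular coefficients
both become multiples of (r-3M)². The price is a zeroth order term with the wrong sign for r > 5M
(`BetaSystem.div_morawetzP`).

That term is absorbed by a Hodge estimate on spheres: up to a total derivative, 2|e|²/r² ≤ (div e)²
+ (n·curl e)² for tangential e (`Tangential.hodge_le`). The right side is controlled by the time and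
radial components of β, of which only part is spent on the bulk term. The total derivative is a sum
of derivatives along rotations, whose integrals over spherically symmetric sets vanish since
rotations preserve the measure (`integral_rot_eq_zero`). This gives the estimate on compact
symmetric regions, and monotone convergence gives it on Ω (`BetaSystem.lintegral_le`). -/

theorem pd_add {a : Fin 4} {f g : Pt → ℝ} {p : Pt} (hf : DifferentiableAt ℝ f p)
    (hg : DifferentiableAt ℝ g p) : pd a (fun x => f x + g x) p = pd a f p + pd a g p := by
  simp only [pd]; rw [fderiv_fun_add hf hg]; rfl

theorem pd_sub {a : Fin 4} {f g : Pt → ℝ} {p : Pt} (hf : DifferentiableAt ℝ f p)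
    (hg : DifferentiableAt ℝ g p) : pd a (fun x => f x - g x) p = pd a f p - pd a g p := by
  simp only [pd]; rw [fderiv_fun_sub hf hg]; rfl

theorem pd_neg {a : Fin 4} {f : Pt → ℝ} {p : Pt} :
    pd a (fun x => - f x) p = - pd a f p := by
  simp only [pd]; rw [fderiv_fun_neg]; rfl

theorem pd_mul {a : Fin 4} {f g : Pt → ℝ} {p : Pt} (hf : DifferentiableAt ℝ f p)
    (hg : DifferentiableAt ℝ g p) :
    pd a (fun x => f x * g x) p = pd a f p * g p + f p * pd a g p := by
  simp only [pd]; rw [fderiv_fun_mul hf hg]; simp; ring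

theorem pd_const {a : Fin 4} {c : ℝ} {p : Pt} : pd a (fun _ => c) p = 0 := by
  simp [pd]

theorem pd_coord {a b : Fin 4} {p : Pt} : pd a (fun x => x b) p = if b = a then 1 else 0 := by
  simp only [pd]
  have : HasFDerivAt (fun x : Pt => x b) (ContinuousLinearMap.proj (R := ℝ) (φ := fun _ => ℝ) b) p :=
    (ContinuousLinearMap.proj (R := ℝ) (φ := fun _ : Fin 4 => ℝ) b).hasFDerivAt
  rw [this.fderiv]
  simp [Pi.single_apply]

theorem pd_comp {a : Fin 4} {φ : ℝ → ℝ} {φ' : ℝ} {f : Pt → ℝ} {p : Pt}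
    (hφ : HasDerivAt φ φ' (f p)) (hf : DifferentiableAt ℝ f p) :
    pd a (fun x => φ (f x)) p = φ' * pd a f p := by
  simp only [pd]
  have := (hφ.comp_hasFDerivAt p hf.hasFDerivAt).fderiv
  simp only [Function.comp_def] at this
  rw [this]; simp

theorem pd_inv {a : Fin 4} {f : Pt → ℝ} {p : Pt} (hf : DifferentiableAt ℝ f p) (h0 : f p ≠ 0) :
    pd a (fun x => (f x)⁻¹) p = - pd a f p / f p ^ 2 := by
  rw [pd_comp (hasDerivAt_inv h0) hf]; field_simp

theorem pd_congr {a : Fin 4} {f g : Pt → ℝ} {p : Pt} {s : Set Pt} (hs : IsOpen s) (hp : p ∈ s)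
    (h : ∀ x ∈ s, f x = g x) : pd a f p = pd a g p := by
  simp only [pd]
  rw [Filter.EventuallyEq.fderiv_eq]
  filter_upwards [hs.mem_nhds hp] with x hx using h x hx

theorem contDiffOn_pd {a : Fin 4} {f : Pt → ℝ} {s : Set Pt} (hs : IsOpen s)
    (hf : ContDiffOn ℝ ∞ f s) : ContDiffOn ℝ ∞ (pd a f) s := by
  have := hf.fderiv_of_isOpen (m := ∞) hs (by simp)
  exact this.clm_apply contDiffOn_const

theorem pd_comm {a b : Fin 4} {f : Pt → ℝ} {s : Set Pt} (hs : IsOpen s)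
    (hf : ContDiffOn ℝ ∞ f s) {p : Pt} (hp : p ∈ s) :
    pd a (pd b f) p = pd b (pd a f) p := by
  have hc : ContDiffAt ℝ ∞ f p := hf.contDiffAt (hs.mem_nhds hp)
  have hsymm : IsSymmSndFDerivAt ℝ f p := hc.isSymmSndFDerivAt (by simp; exact WithTop.coe_le_coe.mpr le_top)
  have hd : DifferentiableAt ℝ (fderiv ℝ f) p :=
    ((hc.fderiv_right (m := ∞) (by simp)).differentiableAt (by simp))
  have key : ∀ a b : Fin 4, pd a (pd b f) p
      = fderiv ℝ (fderiv ℝ f) p (Pi.single a 1) (Pi.single b 1) := by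
    intro a b
    have : pd b f = fun x => fderiv ℝ f x (Pi.single b 1) := rfl
    rw [pd, this, fderiv_clm_apply hd (differentiableAt_const _)]
    simp
  rw [key, key, hsymm.eq]

/-! ### The radius and the radial unit vector -/

theorem rad_sq (p : Pt) : rad p ^ 2 = p 1 ^ 2 + p 2 ^ 2 + p 3 ^ 2 :=
  Real.sq_sqrt (by positivity)

theorem rad_nonneg (p : Pt) : 0 ≤ rad p := Real.sqrt_nonneg _

theorem continuous_rad : Continuous rad := by unfold rad; fun_prop

theorem isOpen_exterior (M : ℝ) : IsOpen (exterior M) :=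
  isOpen_lt continuous_const continuous_rad

theorem rad_pos {M : ℝ} (hM : 0 < M) {p : Pt} (hp : p ∈ exterior M) : 0 < rad p := by
  have : 2 * M < rad p := hp
  linarith

theorem contDiffAt_rad {p : Pt} (h : rad p ≠ 0) : ContDiffAt ℝ ∞ rad p := by
  unfold rad
  apply ContDiffAt.sqrt
  · fun_prop
  · rw [← rad_sq]; positivity

theorem differentiableAt_rad {p : Pt} (h : rad p ≠ 0) : DifferentiableAt ℝ rad p :=
  (contDiffAt_rad h).differentiableAt (by simp)

theorem contDiffOn_rad {M : ℝ} (hM : 0 < M) : ContDiffOn ℝ ∞ rad (exterior M) :=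
  fun _ hp => (contDiffAt_rad (rad_pos hM hp).ne').contDiffWithinAt

/-- The radial unit vector `n`, with vanishing time component. -/
def nrm (p : Pt) (a : Fin 4) : ℝ := if a = 0 then 0 else p a / rad p

theorem nrm_zero (p : Pt) : nrm p 0 = 0 := rfl
theorem nrm_one (p : Pt) : nrm p 1 = p 1 / rad p := rfl
theorem nrm_two (p : Pt) : nrm p 2 = p 2 / rad p := rfl
theorem nrm_three (p : Pt) : nrm p 3 = p 3 / rad p := rfl

theorem nrm_sq {p : Pt} (h : rad p ≠ 0) : nrm p 1 ^ 2 + nrm p 2 ^ 2 + nrm p 3 ^ 2 = 1 := by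
  rw [nrm_one, nrm_two, nrm_three]; field_simp; exact (rad_sq p).symm

theorem coord_eq {p : Pt} (h : rad p ≠ 0) {a : Fin 4} (ha : a ≠ 0) : p a = rad p * nrm p a := by
  rw [nrm, if_neg ha]; field_simp

theorem pd_rad {p : Pt} (h : rad p ≠ 0) (a : Fin 4) : pd a rad p = nrm p a := by
  have hd := differentiableAt_rad h
  have h1 : pd a (fun x => rad x * rad x) p = 2 * rad p * pd a rad p := by
    rw [pd_mul hd hd]; ring
  have h2 : (fun x => rad x * rad x) = fun x => x 1 * x 1 + x 2 * x 2 + x 3 * x 3 := by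
    funext x; rw [← sq, rad_sq]; ring
  rw [h2, pd_add (by fun_prop) (by fun_prop), pd_add (by fun_prop) (by fun_prop),
    pd_mul (by fun_prop) (by fun_prop), pd_mul (by fun_prop) (by fun_prop),
    pd_mul (by fun_prop) (by fun_prop), pd_coord, pd_coord, pd_coord] at h1
  have h3 : pd a rad p = (2 * rad p * pd a rad p) / (2 * rad p) := by field_simp
  rw [h3, ← h1]
  fin_cases a <;> simp [nrm] <;> field_simp <;> ring

theorem pd_comp_rad {φ : ℝ → ℝ} {φ' : ℝ} {p : Pt} (h : rad p ≠ 0)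
    (hφ : HasDerivAt φ φ' (rad p)) (a : Fin 4) :
    pd a (fun x => φ (rad x)) p = φ' * nrm p a := by
  rw [pd_comp hφ (differentiableAt_rad h), pd_rad h]

theorem contDiffAt_nrm {p : Pt} (h : rad p ≠ 0) (a : Fin 4) :
    ContDiffAt ℝ ∞ (fun x => nrm x a) p := by
  unfold nrm
  split_ifs
  · exact contDiffAt_const
  · exact ContDiffAt.div (by fun_prop) (contDiffAt_rad h) h

theorem differentiableAt_nrm {p : Pt} (h : rad p ≠ 0) (a : Fin 4) :
    DifferentiableAt ℝ (fun x => nrm x a) p := (contDiffAt_nrm h a).differentiableAt (by simp)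

theorem contDiffOn_nrm {M : ℝ} (hM : 0 < M) (a : Fin 4) :
    ContDiffOn ℝ ∞ (fun x => nrm x a) (exterior M) :=
  fun _ hp => (contDiffAt_nrm (rad_pos hM hp).ne' a).contDiffWithinAt

theorem pd_nrm {p : Pt} (h : rad p ≠ 0) (a b : Fin 4) :
    pd a (fun x => nrm x b) p
      = ((if a = b ∧ a ≠ 0 then 1 else 0) - nrm p a * nrm p b) / rad p := by
  by_cases hb : b = 0
  · subst hb
    simp only [nrm_zero, pd_const]
    by_cases ha : a = 0 <;> simp [ha]
  · have : (fun x => nrm x b) = fun x => x b * (rad x)⁻¹ := by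
      funext x; rw [nrm, if_neg hb]; rfl
    have hi : DifferentiableAt ℝ (fun x => (rad x)⁻¹) p := (differentiableAt_rad h).inv h
    rw [this, pd_mul (by fun_prop) hi, pd_coord,
      pd_inv (differentiableAt_rad h) h, pd_rad h, coord_eq h hb]
    by_cases hab : a = b
    · subst hab; simp [hb]; field_simp; ring
    · simp [hab, Ne.symm hab]; field_simp

/-! ### The metric -/

/-- The function `f = 1 - 2M/r`. -/
def lapse (M : ℝ) (p : Pt) : ℝ := 1 - 2 * M / rad p

theorem lapse_pos {M : ℝ} (hM : 0 < M) {p : Pt} (hp : p ∈ exterior M) : 0 < lapse M p := by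
  have h : 2 * M < rad p := hp
  have := rad_pos hM hp
  unfold lapse; rw [sub_pos, div_lt_one this]; exact h

theorem contDiffOn_lapse {M : ℝ} (hM : 0 < M) : ContDiffOn ℝ ∞ (lapse M) (exterior M) :=
  contDiffOn_const.sub (contDiffOn_const.div (contDiffOn_rad hM) fun _ hp => (rad_pos hM hp).ne')

theorem differentiableAt_lapse {M : ℝ} {p : Pt} (h : rad p ≠ 0) :
    DifferentiableAt ℝ (lapse M) p := by
  have hi : DifferentiableAt ℝ (fun x => (rad x)⁻¹) p := (differentiableAt_rad h).inv h
  have : lapse M = fun x => 1 - 2 * M * (rad x)⁻¹ := rfl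
  rw [this]
  fun_prop

theorem pd_lapse {M : ℝ} {p : Pt} (h : rad p ≠ 0) (a : Fin 4) :
    pd a (lapse M) p = (1 - lapse M p) / rad p * nrm p a := by
  have : HasDerivAt (fun r : ℝ => 1 - 2 * M / r) (2 * M / rad p ^ 2) (rad p) := by
    exact (((hasDerivAt_inv h).const_mul (2 * M)).const_sub 1).congr_deriv (by ring)
  have h2 := pd_comp_rad h this a
  have h3 : (fun x => 1 - 2 * M / rad x) = lapse M := rfl
  rw [h3] at h2
  rw [h2, lapse]; field_simp; ring

theorem metric_apply {M : ℝ} {p : Pt} (h : rad p ≠ 0) (a b : Fin 4) :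
    metric M p a b = lapse M p * (if a = 0 ∧ b = 0 then 1 else 0)
      - (if a = b ∧ a ≠ 0 then 1 else 0) + (1 - (lapse M p)⁻¹) * (nrm p a * nrm p b) := by
  simp only [metric, Matrix.of_apply, pd_rad h, lapse]; ring

/-- The components of the inverse metric. -/
def invComp (M : ℝ) (p : Pt) : Matrix (Fin 4) (Fin 4) ℝ := Matrix.of fun a b =>
  (lapse M p)⁻¹ * (if a = 0 ∧ b = 0 then 1 else 0)
      - (if a = b ∧ a ≠ 0 then 1 else 0) + (1 - lapse M p) * (nrm p a * nrm p b)

/-- The metric is diagonal for the splitting into time, n and the tangent plane, with eigenvalues f,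
-1/f, -1; the claimed inverse has the reciprocal eigenvalues. -/
theorem invMetric_eq {M : ℝ} (hM : 0 < M) {p : Pt} (hp : p ∈ exterior M) :
    invMetric M p = invComp M p := by
  have h := (rad_pos hM hp).ne'
  have hf := (lapse_pos hM hp).ne'
  unfold invMetric
  apply Matrix.inv_eq_left_inv
  ext a b
  have hn := nrm_sq h
  have hff : lapse M p * (lapse M p)⁻¹ = 1 := mul_inv_cancel₀ hf
  simp only [Matrix.mul_apply, Fin.sum_univ_four, metric_apply h, invComp, Matrix.of_apply,
    Matrix.one_apply]
  generalize (lapse M p)⁻¹ = g at *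
  fin_cases a <;> fin_cases b <;> simp [nrm_zero] <;> grind

/-! ### Algebra of the metric and of `2`-forms -/

/-- The radial component `n · w` of the spatial part of `w`. -/
def radial (p : Pt) (w : Fin 4 → ℝ) : ℝ := nrm p 1 * w 1 + nrm p 2 * w 2 + nrm p 3 * w 3

/-- The map `w ↦ f⁻¹ (w - (n · w) n) + (n · w) n`. -/
def stretch (M : ℝ) (p : Pt) (w : Fin 4 → ℝ) (a : Fin 4) : ℝ :=
  (lapse M p)⁻¹ * w a + (1 - (lapse M p)⁻¹) * (nrm p a * radial p w)

/-- The `2`-form with `w_{0i} = e_i` and `(*w)_{0i} = c_i`. -/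
def form (M : ℝ) (p : Pt) (e c : Fin 4 → ℝ) : Fin 4 → Fin 4 → ℝ :=
  ![![0, e 1, e 2, e 3],
    ![-e 1, 0, stretch M p c 3, -stretch M p c 2],
    ![-e 2, -stretch M p c 3, 0, stretch M p c 1],
    ![-e 3, stretch M p c 2, -stretch M p c 1, 0]]

/-- The Vandermonde product of the indices is alternating and equals 1!·2!·3! = 12 at (0,1,2,3).
This polynomial form makes sums against the symbol computable. -/
theorem permSymbol_eq (a b c d : Fin 4) : 12 * permSymbol a b c d =
    ((b.val : ℤ) - a.val) * ((c.val : ℤ) - a.val) * ((d.val : ℤ) - a.val) * ((c.val : ℤ) - b.val)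
      * ((d.val : ℤ) - b.val) * ((d.val : ℤ) - c.val) := by
  revert a b c d
  decide +kernel

theorem permSymbol_cast (a b c d : Fin 4) : (permSymbol a b c d : ℝ) =
    ((b.val : ℝ) - a.val) * ((c.val : ℝ) - a.val) * ((d.val : ℝ) - a.val) * ((c.val : ℝ) - b.val)
      * ((d.val : ℝ) - b.val) * ((d.val : ℝ) - c.val) / 12 := by
  have := congrArg (fun z : ℤ => (z : ℝ)) (permSymbol_eq a b c d)
  push_cast at this
  linarith

/-- The product of the eigenvalues f, -1/f, -1, -1: the factors f cancel, so the chart is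
unimodular. -/
theorem det_metric {M : ℝ} (hM : 0 < M) {p : Pt} (hp : p ∈ exterior M) :
    (metric M p).det = -1 := by
  have h := (rad_pos hM hp).ne'
  have hf := (lapse_pos hM hp).ne'
  have hn := nrm_sq h
  have hff : lapse M p * (lapse M p)⁻¹ = 1 := mul_inv_cancel₀ hf
  have : metric M p = !![lapse M p, 0, 0, 0;
      0, -1 + (1 - (lapse M p)⁻¹) * (nrm p 1 * nrm p 1), (1 - (lapse M p)⁻¹) * (nrm p 1 * nrm p 2),
        (1 - (lapse M p)⁻¹) * (nrm p 1 * nrm p 3);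
      0, (1 - (lapse M p)⁻¹) * (nrm p 2 * nrm p 1), -1 + (1 - (lapse M p)⁻¹) * (nrm p 2 * nrm p 2),
        (1 - (lapse M p)⁻¹) * (nrm p 2 * nrm p 3);
      0, (1 - (lapse M p)⁻¹) * (nrm p 3 * nrm p 1), (1 - (lapse M p)⁻¹) * (nrm p 3 * nrm p 2),
        -1 + (1 - (lapse M p)⁻¹) * (nrm p 3 * nrm p 3)] := by
    ext a b
    rw [metric_apply h]
    fin_cases a <;> fin_cases b <;> simp [nrm_zero]
  rw [this, Matrix.det_succ_row_zero]
  simp only [Fin.sum_univ_four, Matrix.det_fin_three]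
  generalize (lapse M p)⁻¹ = g at *
  simp [Fin.succAbove]
  linear_combination (lapse M p * (1 - g)) * hn - hff

theorem sqrt_det_metric {M : ℝ} (hM : 0 < M) {p : Pt} (hp : p ∈ exterior M) :
    Real.sqrt |(metric M p).det| = 1 := by
  rw [det_metric hM hp]; simp

theorem sum_invMetric_mul {M : ℝ} (hM : 0 < M) {p : Pt} (hp : p ∈ exterior M) (w : Fin 4 → ℝ)
    (a : Fin 4) : ∑ b, invMetric M p a b * w b =
      if a = 0 then (lapse M p)⁻¹ * w 0 else - w a + (1 - lapse M p) * (nrm p a * radial p w) := by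
  simp only [invMetric_eq hM hp, invComp, Matrix.of_apply, Fin.sum_univ_four, radial]
  fin_cases a <;> simp [nrm_zero] <;> ring

theorem raise_form {M : ℝ} (hM : 0 < M) {p : Pt} (hp : p ∈ exterior M) (e c : Fin 4 → ℝ)
    (a b : Fin 4) :
    ∑ d, ∑ d', invMetric M p a d * invMetric M p b d' * form M p e c d d' =
      (![![0, -stretch M p e 1, -stretch M p e 2, -stretch M p e 3],
        ![stretch M p e 1, 0, c 3, -c 2],
        ![stretch M p e 2, -c 3, 0, c 1],
        ![stretch M p e 3, c 2, -c 1, 0]] : Fin 4 → Fin 4 → ℝ) a b := by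
  have h := (rad_pos hM hp).ne'
  have hf := (lapse_pos hM hp).ne'
  have hn := nrm_sq h
  have hff : lapse M p * (lapse M p)⁻¹ = 1 := mul_inv_cancel₀ hf
  have h1 : ∀ d, ∑ d', invMetric M p a d * invMetric M p b d' * form M p e c d d'
      = invMetric M p a d * ∑ d', invMetric M p b d' * form M p e c d d' := by
    intro d; rw [Finset.mul_sum]; exact Finset.sum_congr rfl fun _ _ => by ring
  simp only [h1, sum_invMetric_mul hM hp]
  simp only [radial, form, stretch]
  clear h1
  generalize (lapse M p)⁻¹ = g at *
  generalize lapse M p = f at *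
  fin_cases a <;> fin_cases b <;> simp <;> grind

theorem stretch_neg (M : ℝ) (p : Pt) (w : Fin 4 → ℝ) (a : Fin 4) :
    stretch M p (fun b => - w b) a = - stretch M p w a := by
  simp only [stretch, radial]; ring

/-- The magnetic part of `form` is stretched precisely so that duality becomes the rotation (e, c) ↦
(c, -e), with ** = -1 visible. -/
theorem hodge_form {M : ℝ} (hM : 0 < M) {p : Pt} (hp : p ∈ exterior M)
    {w : Pt → Fin 4 → Fin 4 → ℝ} {e c : Fin 4 → ℝ} (hw : w p = form M p e c) :
    hodge M w p = form M p c (fun a => - e a) := by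
  ext a b
  have h1 : hodge M w p a b = (1 / 2) * ∑ c', ∑ d, (permSymbol a b c' d : ℝ) *
      ∑ e', ∑ f, invMetric M p c' e' * invMetric M p d f * form M p e c e' f := by
    simp only [hodge, hw, volForm, sqrt_det_metric hM hp, one_mul, Finset.mul_sum, mul_assoc]
  rw [h1]
  simp only [raise_form hM hp]
  clear h1 hw w
  simp only [permSymbol_cast, Fin.sum_univ_four]
  fin_cases a <;> fin_cases b <;> simp [form, stretch_neg] <;> ring

/-! ### Connection coefficients -/

theorem sum_invMetric_nrm {M : ℝ} (hM : 0 < M) {p : Pt} (hp : p ∈ exterior M) (a : Fin 4) :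
    ∑ b, invMetric M p a b * nrm p b = - lapse M p * nrm p a := by
  have hn := nrm_sq (rad_pos hM hp).ne'
  rw [sum_invMetric_mul hM hp, radial]
  split_ifs with ha
  · subst ha; simp [nrm_zero]
  · linear_combination (1 - lapse M p) * nrm p a * hn

theorem sum_invMetric_time {M : ℝ} (hM : 0 < M) {p : Pt} (hp : p ∈ exterior M) (a : Fin 4) :
    ∑ b, invMetric M p a b * (if b = 0 then 1 else 0)
      = (lapse M p)⁻¹ * (if a = 0 then 1 else 0) := by
  rw [sum_invMetric_mul hM hp, radial]
  by_cases ha : a = 0 <;> simp [ha]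

/-- The projection `π_{ab}` to the tangent space of the spheres. -/
def sphProj (p : Pt) (a b : Fin 4) : ℝ :=
  (if a = b ∧ a ≠ 0 then 1 else 0) - nrm p a * nrm p b

theorem sphProj_comm (p : Pt) (a b : Fin 4) : sphProj p a b = sphProj p b a := by
  have : (a = b ∧ a ≠ 0) ↔ (b = a ∧ b ≠ 0) := by
    constructor <;> (rintro ⟨rfl, h⟩; exact ⟨rfl, h⟩)
  simp only [sphProj, this, mul_comm]

theorem sum_invMetric_sphProj {M : ℝ} (hM : 0 < M) {p : Pt} (hp : p ∈ exterior M) (a c : Fin 4) :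
    ∑ b, invMetric M p a b * sphProj p b c = - sphProj p a c := by
  have hn := nrm_sq (rad_pos hM hp).ne'
  rw [sum_invMetric_mul hM hp, radial]
  simp only [sphProj]
  fin_cases a <;> fin_cases c <;> simp [nrm_zero] <;> grind

/-- The derivative `f' = 2M/r²` of the lapse. -/
def lapse' (M : ℝ) (p : Pt) : ℝ := (1 - lapse M p) / rad p

theorem pd_lapse_inv {M : ℝ} (hM : 0 < M) {p : Pt} (hp : p ∈ exterior M) (a : Fin 4) :
    pd a (fun x => (lapse M x)⁻¹) p = - (lapse M p)⁻¹ ^ 2 * lapse' M p * nrm p a := by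
  have h := (rad_pos hM hp).ne'
  rw [pd_inv (differentiableAt_lapse h) (lapse_pos hM hp).ne', pd_lapse h, lapse']
  field_simp

theorem differentiableAt_lapse_inv {M : ℝ} (hM : 0 < M) {p : Pt} (hp : p ∈ exterior M) :
    DifferentiableAt ℝ (fun x => (lapse M x)⁻¹) p :=
  (differentiableAt_lapse (rad_pos hM hp).ne').inv (lapse_pos hM hp).ne'

theorem pd_metric {M : ℝ} (hM : 0 < M) {p : Pt} (hp : p ∈ exterior M) (c a b : Fin 4) :
    pd c (fun x => metric M x a b) p =
      lapse' M p * nrm p c * ((if a = 0 then 1 else 0) * (if b = 0 then 1 else 0))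
      + (lapse M p)⁻¹ ^ 2 * lapse' M p * nrm p c * (nrm p a * nrm p b)
      + (1 - (lapse M p)⁻¹) / rad p * (sphProj p c a * nrm p b + nrm p a * sphProj p c b) := by
  have h := (rad_pos hM hp).ne'
  have e1 := pd_congr (a := c) (isOpen_exterior M) hp
    (fun x hx => metric_apply (M := M) (rad_pos hM hx).ne' a b)
  have hg := differentiableAt_lapse_inv hM hp
  have hf := differentiableAt_lapse (M := M) h
  have hna := differentiableAt_nrm h a
  have hnb := differentiableAt_nrm h b
  rw [e1, pd_add (by fun_prop) (by fun_prop), pd_sub (by fun_prop) (by fun_prop),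
    pd_mul (by fun_prop) (by fun_prop), pd_mul (by fun_prop) (by fun_prop),
    pd_sub (by fun_prop) (by fun_prop), pd_mul (by fun_prop) (by fun_prop), pd_nrm h, pd_nrm h,
    pd_lapse h, pd_lapse_inv hM hp]
  simp only [pd_const, sphProj, lapse', ite_and]
  split_ifs <;> ring

/-- After the projections π_{de} and π_{db} cancel, the free index of the bracket is carried only by
dt and n. Both are eigenvectors of the inverse metric, so raising that index is immediate. -/
theorem christoffel_eq {M : ℝ} (hM : 0 < M) {p : Pt} (hp : p ∈ exterior M) (d a b : Fin 4) :
    christoffel M p d a b =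
      1 / 2 * lapse' M p * (lapse M p)⁻¹ * (if d = 0 then 1 else 0) *
        (nrm p a * (if b = 0 then 1 else 0) + nrm p b * (if a = 0 then 1 else 0))
      + nrm p d * (1 / 2 * lapse M p * lapse' M p *
          ((if a = 0 then 1 else 0) * (if b = 0 then 1 else 0))
        - 1 / 2 * lapse' M p * (lapse M p)⁻¹ * (nrm p a * nrm p b)
        + lapse' M p * sphProj p a b) := by
  have h := (rad_pos hM hp).ne'
  have hff : lapse M p * (lapse M p)⁻¹ = 1 := mul_inv_cancel₀ (lapse_pos hM hp).ne'
  have hk : lapse' M p = (1 - lapse M p) * (rad p)⁻¹ := rfl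
  have e1 : ∀ e, invMetric M p d e *
      (pd a (fun x => metric M x b e) p + pd b (fun x => metric M x a e) p
        - pd e (fun x => metric M x a b) p)
      = (lapse' M p * (nrm p a * (if b = 0 then 1 else 0) + nrm p b * (if a = 0 then 1 else 0)))
          * (invMetric M p d e * (if e = 0 then 1 else 0))
        + (- lapse' M p * ((if a = 0 then 1 else 0) * (if b = 0 then 1 else 0))
            + (lapse M p)⁻¹ ^ 2 * lapse' M p * (nrm p a * nrm p b)
            + 2 * (1 - (lapse M p)⁻¹) / rad p * sphProj p a b)
          * (invMetric M p d e * nrm p e) := by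
    intro e
    rw [pd_metric hM hp, pd_metric hM hp, pd_metric hM hp, sphProj_comm p b a,
      sphProj_comm p e a, sphProj_comm p e b]
    ring
  simp only [christoffel, e1, Finset.sum_add_distrib, ← Finset.mul_sum, sum_invMetric_nrm hM hp,
    sum_invMetric_time hM hp]
  generalize (lapse M p)⁻¹ = g at *
  generalize lapse' M p = k at *
  linear_combination (nrm p d * sphProj p a b * (rad p)⁻¹ - 1 / 2 * nrm p d * nrm p a * nrm p b * k * g) * hff
    - nrm p d * sphProj p a b * hk

theorem sum_invMetric_christoffel {M : ℝ} (hM : 0 < M) {p : Pt} (hp : p ∈ exterior M)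
    (c d a : Fin 4) : ∑ b, invMetric M p c b * christoffel M p d b a =
      1 / 2 * lapse' M p * (if d = 0 then 1 else 0) *
        (- nrm p c * (if a = 0 then 1 else 0)
          + (lapse M p)⁻¹ ^ 2 * nrm p a * (if c = 0 then 1 else 0))
      + nrm p d * (1 / 2 * lapse' M p * ((if a = 0 then 1 else 0) * (if c = 0 then 1 else 0))
        + 1 / 2 * lapse' M p * (nrm p c * nrm p a) - lapse' M p * sphProj p c a) := by
  have hff : lapse M p * (lapse M p)⁻¹ = 1 := mul_inv_cancel₀ (lapse_pos hM hp).ne'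
  have e1 : ∀ b, invMetric M p c b * christoffel M p d b a =
      (1 / 2 * lapse' M p * (lapse M p)⁻¹ * (if d = 0 then 1 else 0) * (if a = 0 then 1 else 0)
        - nrm p d * (1 / 2 * lapse' M p * (lapse M p)⁻¹ * nrm p a))
        * (invMetric M p c b * nrm p b)
      + (1 / 2 * lapse' M p * (lapse M p)⁻¹ * (if d = 0 then 1 else 0) * nrm p a
        + nrm p d * (1 / 2 * lapse M p * lapse' M p * (if a = 0 then 1 else 0)))
        * (invMetric M p c b * (if b = 0 then 1 else 0))
      + nrm p d * lapse' M p * (invMetric M p c b * sphProj p b a) := by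
    intro b; rw [christoffel_eq hM hp]; ring
  simp only [e1, Finset.sum_add_distrib, ← Finset.mul_sum, sum_invMetric_nrm hM hp,
    sum_invMetric_time hM hp, sum_invMetric_sphProj hM hp]
  generalize (lapse M p)⁻¹ = g at *
  generalize (if d = 0 then (1 : ℝ) else 0) = td at *
  generalize (if a = 0 then (1 : ℝ) else 0) = ta at *
  generalize (if c = 0 then (1 : ℝ) else 0) = tc at *
  generalize lapse' M p = k at *
  linear_combination (1 / 2 * k * (nrm p d * nrm p a * nrm p c - td * ta * nrm p c
    + nrm p d * ta * tc)) * hff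

theorem contracted_christoffel {M : ℝ} (hM : 0 < M) {p : Pt} (hp : p ∈ exterior M) (d : Fin 4) :
    ∑ a, ∑ b, invMetric M p a b * christoffel M p d a b = - lapse' M p * nrm p d := by
  have hn := nrm_sq (rad_pos hM hp).ne'
  rw [Finset.sum_comm]
  simp only [invMetric_symm M p _ _]
  simp only [sum_invMetric_christoffel hM hp, Fin.sum_univ_four, sphProj]
  simp [nrm_zero]
  linear_combination (3 / 2 * lapse' M p * nrm p d) * hn

/-! ### Divergences -/

theorem sum_metric_mul {M : ℝ} {p : Pt} (h : rad p ≠ 0) (w : Fin 4 → ℝ) (a : Fin 4) :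
    ∑ b, metric M p a b * w b =
      if a = 0 then lapse M p * w 0
      else - w a + (1 - (lapse M p)⁻¹) * (nrm p a * radial p w) := by
  simp only [metric_apply h, Fin.sum_univ_four, radial]
  fin_cases a <;> simp [nrm_zero] <;> ring

theorem sum_invMetric_metric {M : ℝ} (hM : 0 < M) {p : Pt} (hp : p ∈ exterior M) (w : Fin 4 → ℝ)
    (a : Fin 4) : ∑ b, invMetric M p a b * ∑ c, metric M p b c * w c = w a := by
  have h : invMetric M p * metric M p = 1 := by
    apply Matrix.nonsing_inv_mul
    rw [det_metric hM hp]; exact isUnit_one.neg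
  have h2 := congrArg (fun A => Matrix.mulVec A w a) h
  simp only [← Matrix.mulVec_mulVec, Matrix.one_mulVec] at h2
  exact h2

/-- This is the formula ∇_a J^a = |g|^{-1/2} ∂_a(|g|^{1/2} J^a) for a unimodular chart. -/
theorem div1_metric {M : ℝ} (hM : 0 < M) {p : Pt} (hp : p ∈ exterior M) {w J : Pt → Fin 4 → ℝ}
    (hw : ∀ x ∈ exterior M, ∀ a, w x a = ∑ b, metric M x a b * J x b)
    (hJ : ∀ a, DifferentiableAt ℝ (fun x => J x a) p) :
    div1 M w p = ∑ a, pd a (fun x => J x a) p := by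
  have h := (rad_pos hM hp).ne'
  have hn := nrm_sq h
  have hff : lapse M p * (lapse M p)⁻¹ = 1 := mul_inv_cancel₀ (lapse_pos hM hp).ne'
  have hg := differentiableAt_lapse_inv hM hp
  have hf := differentiableAt_lapse (M := M) h
  have hna := differentiableAt_nrm h
  have hmet : ∀ a b, DifferentiableAt ℝ (fun x => metric M x a b) p := by
    intro a b
    have : (fun x => metric M x a b) =ᶠ[nhds p] fun x =>
        lapse M x * (if a = 0 ∧ b = 0 then 1 else 0)
      - (if a = b ∧ a ≠ 0 then 1 else 0) + (1 - (lapse M x)⁻¹) * (nrm x a * nrm x b) := by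
      filter_upwards [(isOpen_exterior M).mem_nhds hp] with x hx
        using metric_apply (rad_pos hM hx).ne' a b
    rw [this.differentiableAt_iff]
    have h1 := hna a
    have h2 := hna b
    fun_prop
  have hpd : ∀ a b, pd a (fun x => w x b) p
      = ∑ c, metric M p b c * pd a (fun x => J x c) p
        + ∑ c, pd a (fun x => metric M x b c) p * J p c := by
    intro a b
    have h0 := hJ 0; have h1 := hJ 1; have h2 := hJ 2; have h3 := hJ 3
    have m0 := hmet b 0; have m1 := hmet b 1; have m2 := hmet b 2; have m3 := hmet b 3
    rw [pd_congr (isOpen_exterior M) hp fun x hx => hw x hx b]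
    simp only [Fin.sum_univ_four]
    rw [pd_add (by fun_prop) (by fun_prop), pd_add (by fun_prop) (by fun_prop),
      pd_add (by fun_prop) (by fun_prop), pd_mul m0 h0, pd_mul m1 h1, pd_mul m2 h2, pd_mul m3 h3]
    ring
  have hpart : ∑ a, ∑ b, invMetric M p a b * nabla1 M w p a b
      = ∑ a, ∑ b, invMetric M p a b * ∑ c, metric M p b c * pd a (fun x => J x c) p
        + ∑ c, (∑ a, ∑ b, invMetric M p a b * pd a (fun x => metric M x b c) p) * J p c
        - ∑ d, (∑ a, ∑ b, invMetric M p a b * christoffel M p d a b) * w p d := by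
    simp only [nabla1, hpd, Finset.sum_mul]
    rw [Finset.sum_comm (s := Finset.univ) (t := Finset.univ)
      (f := fun c a => ∑ b, invMetric M p a b * pd a (fun x => metric M x b c) p * J p c),
      Finset.sum_comm (s := Finset.univ) (t := Finset.univ)
      (f := fun d a => ∑ b, invMetric M p a b * christoffel M p d a b * w p d),
      ← Finset.sum_add_distrib, ← Finset.sum_sub_distrib]
    refine Finset.sum_congr rfl fun a _ => ?_
    rw [Finset.sum_comm (f := fun c b => invMetric M p a b * pd a (fun x => metric M x b c) p * J p c),
      Finset.sum_comm (f := fun d b => invMetric M p a b * christoffel M p d a b * w p d),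
      ← Finset.sum_add_distrib, ← Finset.sum_sub_distrib]
    refine Finset.sum_congr rfl fun b _ => ?_
    simp only [mul_sub, mul_add, Finset.mul_sum, mul_assoc]
  -- The derivative of the metric contributes (f'/f) n·J. The contracted Christoffel symbols
  -- contribute the opposite, since n·w = -f⁻¹ n·J.
  have hdG : ∀ c, ∑ a, ∑ b, invMetric M p a b * pd a (fun x => metric M x b c) p
      = (lapse M p)⁻¹ * lapse' M p * nrm p c := by
    intro c
    have e1 : ∀ a b, invMetric M p a b * pd a (fun x => metric M x b c) p
        = (lapse' M p * nrm p a * (if c = 0 then 1 else 0))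
            * (invMetric M p a b * (if b = 0 then 1 else 0))
          + ((lapse M p)⁻¹ ^ 2 * lapse' M p * nrm p a * nrm p c
              + (1 - (lapse M p)⁻¹) / rad p * sphProj p a c) * (invMetric M p a b * nrm p b)
          + (1 - (lapse M p)⁻¹) / rad p * nrm p c * (invMetric M p a b * sphProj p b a) := by
      intro a b; rw [pd_metric hM hp, sphProj_comm p a b]; ring
    simp only [e1, Finset.sum_add_distrib, ← Finset.mul_sum, sum_invMetric_nrm hM hp,
      sum_invMetric_time hM hp, sum_invMetric_sphProj hM hp]
    have hk : lapse' M p = (1 - lapse M p) * (rad p)⁻¹ := rfl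
    simp only [Fin.sum_univ_four, sphProj, nrm_zero]
    generalize (lapse M p)⁻¹ = g at *
    rw [hk]
    fin_cases c <;> simp [nrm_zero] <;> grind
  simp only [div1, hpart, sum_invMetric_metric hM hp, hdG, contracted_christoffel hM hp]
  simp only [hw p hp, sum_metric_mul h]
  simp only [Fin.sum_univ_four, radial, nrm_zero]
  generalize (lapse M p)⁻¹ = g at *
  simp
  linear_combination (lapse' M p * (1 - g) * (nrm p 1 * J p 1 + nrm p 2 * J p 2 + nrm p 3 * J p 3)) * hn

/-- The spatial coordinate curl, as a vector with vanishing time component. -/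
def curl (V : Pt → Fin 4 → ℝ) (p : Pt) : Fin 4 → ℝ :=
  ![0, pd 2 (fun x => V x 3) p - pd 3 (fun x => V x 2) p,
    pd 3 (fun x => V x 1) p - pd 1 (fun x => V x 3) p,
    pd 1 (fun x => V x 2) p - pd 2 (fun x => V x 1) p]

/-- The spatial coordinate divergence. -/
def sdiv (V : Pt → Fin 4 → ℝ) (p : Pt) : ℝ :=
  pd 1 (fun x => V x 1) p + pd 2 (fun x => V x 2) p + pd 3 (fun x => V x 3) p

theorem pd_radial {V : Pt → Fin 4 → ℝ} {p : Pt} (h : rad p ≠ 0)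
    (hV : ∀ a, DifferentiableAt ℝ (fun x => V x a) p) (a : Fin 4) :
    pd a (fun x => radial x (V x)) p
      = radial p (fun b => pd a (fun x => V x b) p)
        + (sphProj p a 1 * V p 1 + sphProj p a 2 * V p 2 + sphProj p a 3 * V p 3) / rad p := by
  have h1 := hV 1; have h2 := hV 2; have h3 := hV 3
  have n1 := differentiableAt_nrm h 1
  have n2 := differentiableAt_nrm h 2
  have n3 := differentiableAt_nrm h 3
  simp only [radial]
  rw [pd_add (by fun_prop) (by fun_prop), pd_add (by fun_prop) (by fun_prop), pd_mul n1 h1,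
    pd_mul n2 h2, pd_mul n3 h3, pd_nrm h, pd_nrm h, pd_nrm h]
  simp only [sphProj]; ring

theorem differentiableAt_radial {V : Pt → Fin 4 → ℝ} {p : Pt} (h : rad p ≠ 0)
    (hV : ∀ a, DifferentiableAt ℝ (fun x => V x a) p) :
    DifferentiableAt ℝ (fun x => radial x (V x)) p := by
  have h1 := hV 1; have h2 := hV 2; have h3 := hV 3
  have n1 := differentiableAt_nrm h 1
  have n2 := differentiableAt_nrm h 2
  have n3 := differentiableAt_nrm h 3
  unfold radial
  fun_prop

theorem pd_stretch {M : ℝ} (hM : 0 < M) {V : Pt → Fin 4 → ℝ} {p : Pt} (hp : p ∈ exterior M)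
    (hV : ∀ a, DifferentiableAt ℝ (fun x => V x a) p) (a b : Fin 4) :
    pd a (fun x => stretch M x (V x) b) p
      = stretch M p (fun b => pd a (fun x => V x b) p) b
        - (lapse M p)⁻¹ ^ 2 * lapse' M p * nrm p a * (V p b - nrm p b * radial p (V p))
        + (1 - (lapse M p)⁻¹) / rad p * (sphProj p a b * radial p (V p)
          + nrm p b * (sphProj p a 1 * V p 1 + sphProj p a 2 * V p 2 + sphProj p a 3 * V p 3)) := by
  have h := (rad_pos hM hp).ne'
  have h1 := hV b
  have hg := differentiableAt_lapse_inv hM hp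
  have hn := differentiableAt_nrm h b
  have hr := differentiableAt_radial h hV
  simp only [stretch]
  rw [pd_add (by fun_prop) (by fun_prop), pd_mul hg h1, pd_mul (by fun_prop) (by fun_prop),
    pd_sub (by fun_prop) (by fun_prop), pd_const, pd_mul hn hr, pd_radial h hV, pd_lapse_inv hM hp,
    pd_nrm h]
  simp only [sphProj]
  ring

theorem sum_christoffel_form {M : ℝ} (hM : 0 < M) {p : Pt} (hp : p ∈ exterior M)
    (e c : Fin 4 → ℝ) (a : Fin 4) :
    ∑ b, ∑ c', invMetric M p b c' * ∑ d, (christoffel M p d b a * form M p e c d c'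
      + christoffel M p d b c' * form M p e c a d)
      = if a = 0 then - 2 * lapse' M p * radial p e else 0 := by
  have hn := nrm_sq (rad_pos hM hp).ne'
  have h1 : ∑ b, ∑ c', invMetric M p b c' * ∑ d, (christoffel M p d b a * form M p e c d c'
      + christoffel M p d b c' * form M p e c a d)
      = ∑ c', ∑ d, (∑ b, invMetric M p c' b * christoffel M p d b a) * form M p e c d c'
        + ∑ d, (∑ b, ∑ c', invMetric M p b c' * christoffel M p d b c') * form M p e c a d := by
    simp only [Finset.sum_mul, Finset.mul_sum, mul_add, Finset.sum_add_distrib]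
    congr 1
    · rw [Finset.sum_comm]
      refine Finset.sum_congr rfl fun c' _ => ?_
      rw [Finset.sum_comm]
      refine Finset.sum_congr rfl fun d _ => Finset.sum_congr rfl fun b _ => ?_
      rw [invMetric_symm M p b c']; ring
    · rw [Finset.sum_comm' (t' := Finset.univ) (s' := fun _ => Finset.univ) (by simp)]
      conv_rhs => rw [Finset.sum_comm]
      rw [Finset.sum_comm]
      refine Finset.sum_congr rfl fun b _ => ?_
      conv_rhs => rw [Finset.sum_comm]
      refine Finset.sum_congr rfl fun c' _ => Finset.sum_congr rfl fun d _ => ?_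
      ring
  rw [h1]
  simp only [contracted_christoffel hM hp, sum_invMetric_christoffel hM hp]
  simp only [Fin.sum_univ_four, sphProj, form, radial]
  generalize (lapse M p)⁻¹ = g at *
  generalize stretch M p c = s at *
  fin_cases a <;> simp [nrm_zero] <;> grind

theorem pd_form {M : ℝ} {w : Pt → Fin 4 → Fin 4 → ℝ} {e c : Pt → Fin 4 → ℝ}
    (hw : ∀ x ∈ exterior M, w x = form M x (e x) (c x)) {p : Pt} (hp : p ∈ exterior M)
    (b a a' : Fin 4) :
    pd b (fun x => w x a a') p =
      (![![0, pd b (fun x => e x 1) p, pd b (fun x => e x 2) p, pd b (fun x => e x 3) p],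
        ![-pd b (fun x => e x 1) p, 0, pd b (fun x => stretch M x (c x) 3) p,
          -pd b (fun x => stretch M x (c x) 2) p],
        ![-pd b (fun x => e x 2) p, -pd b (fun x => stretch M x (c x) 3) p, 0,
          pd b (fun x => stretch M x (c x) 1) p],
        ![-pd b (fun x => e x 3) p, pd b (fun x => stretch M x (c x) 2) p,
          -pd b (fun x => stretch M x (c x) 1) p, 0]] : Fin 4 → Fin 4 → ℝ) a a' := by
  rw [pd_congr (isOpen_exterior M) hp fun x hx => by rw [hw x hx]]
  fin_cases a <;> fin_cases a' <;> simp [form, pd_const, pd_neg]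

/-- Used for F, giving the Gauss and Ampère laws, and again for Z and *Z, giving β. By antisymmetry
the Christoffel terms survive only in the time component. -/
theorem div2_form {M : ℝ} (hM : 0 < M) {w : Pt → Fin 4 → Fin 4 → ℝ} {e c : Pt → Fin 4 → ℝ}
    (hw : ∀ x ∈ exterior M, w x = form M x (e x) (c x)) {p : Pt} (hp : p ∈ exterior M)
    (hc : ∀ a, DifferentiableAt ℝ (fun x => c x a) p) (a : Fin 4) :
    div2 M w p a = if a = 0 then
        - (sdiv e p + (lapse M p - 1) * radial p (fun i => radial p fun j => pd i (fun x => e x j) p))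
          + 2 * lapse' M p * radial p (e p)
      else - (lapse M p)⁻¹ * pd 0 (fun x => e x a) p
        - (curl c p a + ((lapse M p)⁻¹ - 1) * nrm p a * radial p (curl c p)) := by
  have h := (rad_pos hM hp).ne'
  have hn := nrm_sq h
  have hff : lapse M p * (lapse M p)⁻¹ = 1 := mul_inv_cancel₀ (lapse_pos hM hp).ne'
  have hk : lapse' M p = (1 - lapse M p) * (rad p)⁻¹ := rfl
  have h1 : div2 M w p a = ∑ b, ∑ c', invMetric M p b c' * pd b (fun x => w x a c') p
      - ∑ b, ∑ c', invMetric M p b c' * ∑ d, (christoffel M p d b a * form M p (e p) (c p) d c'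
      + christoffel M p d b c' * form M p (e p) (c p) a d) := by
    simp only [div2, nabla2, hw p hp, mul_sub, Finset.sum_sub_distrib]
  rw [h1, sum_christoffel_form hM hp]
  simp only [sum_invMetric_mul hM hp]
  simp only [pd_form hw hp, pd_stretch hM hp hc]
  simp only [Fin.sum_univ_four, sphProj, radial, sdiv, curl, stretch, nrm_zero, div_eq_mul_inv]
  rw [hk]
  generalize (lapse M p)⁻¹ = g at *
  generalize (rad p)⁻¹ = ρ at *
  generalize lapse M p = f at *
  generalize e p = e0 at *
  generalize c p = c0 at *
  generalize nrm p = n at *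
  clear h1 hw hc hp h hM hk
  fin_cases a
  · simp
    ring
  all_goals
    simp
    generalize n 1 = n1 at *
    generalize n 2 = n2 at *
    generalize n 3 = n3 at *
    generalize c0 1 = c1 at *
    generalize c0 2 = c2 at *
    generalize c0 3 = c3 at *
    grind

/-! ### Maxwell's equations in terms of electric and magnetic vectors -/

/-- The spatial cross product. -/
def cross (v w : Fin 4 → ℝ) : Fin 4 → ℝ :=
  ![0, v 2 * w 3 - v 3 * w 2, v 3 * w 1 - v 1 * w 3, v 1 * w 2 - v 2 * w 1]

/-- Smoothness of the components of a vector field on the exterior. -/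
def SmoothField (M : ℝ) (V : Pt → Fin 4 → ℝ) : Prop :=
  ∀ a, ContDiffOn ℝ ∞ (fun x => V x a) (exterior M)

theorem ContDiffOn.differentiableAt_exterior {M : ℝ} {f : Pt → ℝ}
    (hf : ContDiffOn ℝ ∞ f (exterior M)) {p : Pt} (hp : p ∈ exterior M) :
    DifferentiableAt ℝ f p :=
  (hf.contDiffAt ((isOpen_exterior M).mem_nhds hp)).differentiableAt (by simp)

theorem SmoothField.differentiableAt {M : ℝ} {V : Pt → Fin 4 → ℝ} (hV : SmoothField M V)
    {p : Pt} (hp : p ∈ exterior M) (a : Fin 4) : DifferentiableAt ℝ (fun x => V x a) p :=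
  ContDiffOn.differentiableAt_exterior (hV a) hp

/-- The vacuum Maxwell equations for the vectors `E_i = F_{0i}` and `C_i = *F_{0i}`. -/
structure MaxwellPair (M : ℝ) (E C : Pt → Fin 4 → ℝ) : Prop where
  smoothE : SmoothField M E
  smoothC : SmoothField M C
  divE : ∀ p ∈ exterior M, sdiv E p
    + (lapse M p - 1) * radial p (fun i => radial p fun j => pd i (fun x => E x j) p)
      = 2 * lapse' M p * radial p (E p)
  divC : ∀ p ∈ exterior M, sdiv C p
    + (lapse M p - 1) * radial p (fun i => radial p fun j => pd i (fun x => C x j) p)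
      = 2 * lapse' M p * radial p (C p)
  curlC : ∀ p ∈ exterior M, ∀ a, a ≠ 0 →
    stretch M p (fun b => pd 0 (fun x => E x b) p) a = - curl C p a
  curlE : ∀ p ∈ exterior M, ∀ a, a ≠ 0 →
    stretch M p (fun b => pd 0 (fun x => C x b) p) a = curl E p a

/-- Every statement proved for Re β transfers to Im β through this duality. -/
theorem MaxwellPair.dual {M : ℝ} {E C : Pt → Fin 4 → ℝ} (h : MaxwellPair M E C) :
    MaxwellPair M C (fun x a => - E x a) where
  smoothE := h.smoothC
  smoothC := fun a => (h.smoothE a).neg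
  divE := h.divC
  divC := fun p hp => by
    have := h.divE p hp
    simp only [sdiv, radial, pd_neg] at *
    linarith
  curlC := fun p hp a ha => by
    rw [h.curlE p hp a ha]
    fin_cases a <;> simp [curl, pd_neg] <;> ring
  curlE := fun p hp a ha => by
    have := h.curlC p hp a ha
    simp only [pd_neg, stretch_neg, this, neg_neg]

/-- The vector `b` with `F_{ij} = ε_{ijk} b_k`. -/
def magB (F : Pt → Fin 4 → Fin 4 → ℝ) (p : Pt) : Fin 4 → ℝ := ![0, F p 2 3, F p 3 1, F p 1 2]

/-- The vector `C_i = *F_{0i}`. -/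
def magC (M : ℝ) (F : Pt → Fin 4 → Fin 4 → ℝ) (p : Pt) (a : Fin 4) : ℝ :=
  lapse M p * magB F p a + (1 - lapse M p) * (nrm p a * radial p (magB F p))

theorem stretch_magC {M : ℝ} (hM : 0 < M) {p : Pt} (hp : p ∈ exterior M)
    (F : Pt → Fin 4 → Fin 4 → ℝ) (a : Fin 4) : stretch M p (magC M F p) a = magB F p a := by
  have hn := nrm_sq (rad_pos hM hp).ne'
  have hff : lapse M p * (lapse M p)⁻¹ = 1 := mul_inv_cancel₀ (lapse_pos hM hp).ne'
  simp only [stretch, magC, radial]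
  generalize (lapse M p)⁻¹ = g at *
  grind

theorem eq_form {M : ℝ} (hM : 0 < M) {F : Pt → Fin 4 → Fin 4 → ℝ} (hF : IsMaxwellField M F)
    {p : Pt} (hp : p ∈ exterior M) : F p = form M p (F p 0) (magC M F p) := by
  have h := hF.antisymm p hp
  ext a b
  simp only [form, stretch_magC hM hp]
  fin_cases a <;> fin_cases b <;> simp [magB] <;> linarith [h 0 0, h 1 1, h 2 2, h 3 3, h 0 1,
    h 0 2, h 0 3, h 1 2, h 1 3, h 2 3]

theorem christoffel_symm {M : ℝ} (hM : 0 < M) {p : Pt} (hp : p ∈ exterior M) (d a b : Fin 4) :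
    christoffel M p d a b = christoffel M p d b a := by
  rw [christoffel_eq hM hp, christoffel_eq hM hp, sphProj_comm p a b]; ring

/-- The divergence equation yields `divE` and `curlC`; the closure of F, with and without a time
index, yields `curlE` and `divC`. -/
theorem maxwellPair {M : ℝ} (hM : 0 < M) {F : Pt → Fin 4 → Fin 4 → ℝ} (hF : IsMaxwellField M F) :
    MaxwellPair M (fun p => F p 0) (magC M F) := by
  have hsE : SmoothField M (fun p => F p 0) := fun a => hF.smooth 0 a
  have hsB : SmoothField M (magB F) := by
    intro a
    fin_cases a
    · exact contDiffOn_const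
    · exact hF.smooth 2 3
    · exact hF.smooth 3 1
    · exact hF.smooth 1 2
  have hsC : SmoothField M (magC M F) := by
    intro a
    have h1 := hsB 1; have h2 := hsB 2; have h3 := hsB 3; have h4 := hsB a
    have n1 := contDiffOn_nrm hM 1
    have n2 := contDiffOn_nrm hM 2
    have n3 := contDiffOn_nrm hM 3
    have n4 := contDiffOn_nrm hM a
    have hf := contDiffOn_lapse hM
    unfold magC radial
    fun_prop
  have hform : ∀ x ∈ exterior M, F x = form M x (F x 0) (magC M F x) := fun x hx => eq_form hM hF hx
  have hanti : ∀ p ∈ exterior M, ∀ a b c, pd c (fun x => F x a b) p = - pd c (fun x => F x b a) p := by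
    intro p hp a b c
    rw [← pd_neg, pd_congr (isOpen_exterior M) hp fun x hx => hF.antisymm x hx a b]
  have hdiv : ∀ p ∈ exterior M, ∀ b, div2 M F p b = 0 := by
    intro p hp b
    have ha := hF.antisymm p hp
    have hn : ∀ c a, nabla2 M F p c a b = - nabla2 M F p c b a := by
      intro c a
      simp only [nabla2, Fin.sum_univ_four]
      rw [hanti p hp a b c, ha a 0, ha a 1, ha a 2, ha a 3, ha b 0, ha b 1, ha b 2, ha b 3]
      ring
    rw [← neg_eq_zero, ← hF.div_eq_zero p hp b, div2, ← Finset.sum_neg_distrib, Finset.sum_comm]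
    refine Finset.sum_congr rfl fun a _ => ?_
    rw [← Finset.sum_neg_distrib]
    refine Finset.sum_congr rfl fun c _ => ?_
    rw [hn, invMetric_symm]; ring
  -- The symmetric Christoffel symbols cancel against the antisymmetry of F, leaving the coordinate
  -- equation dF = 0.
  have hcl : ∀ p ∈ exterior M, ∀ a b c, pd a (fun x => F x b c) p + pd b (fun x => F x c a) p
      + pd c (fun x => F x a b) p = 0 := by
    intro p hp a b c
    rw [← hF.closed p hp a b c]
    have hΓ := christoffel_symm hM hp
    have ha := hF.antisymm p hp
    simp only [nabla2, Fin.sum_univ_four]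
    rw [hΓ 0 b a, hΓ 1 b a, hΓ 2 b a, hΓ 3 b a, hΓ 0 c a, hΓ 1 c a, hΓ 2 c a, hΓ 3 c a,
      hΓ 0 c b, hΓ 1 c b, hΓ 2 c b, hΓ 3 c b, ha a 0, ha a 1, ha a 2, ha a 3, ha b 0, ha b 1,
      ha b 2, ha b 3, ha c 0, ha c 1, ha c 2, ha c 3]
    ring
  have hdE : ∀ p ∈ exterior M, ∀ a, a ≠ 0 →
      stretch M p (fun b => pd 0 (fun x => magC M F x b) p) a = curl (fun p => F p 0) p a := by
    intro p hp a ha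
    have e1 := pd_stretch hM hp (fun a => hsC.differentiableAt hp a) 0 a
    have e2 := pd_congr (a := 0) (isOpen_exterior M) hp fun x hx => stretch_magC hM hx F a
    rw [e2] at e1
    simp only [nrm_zero, sphProj] at e1
    simp at e1
    rw [← e1]
    have := hcl p hp 0
    have hh := hanti p hp
    fin_cases a
    · exact absurd rfl ha
    · simp [curl, magB]; linarith [this 2 3, hh 3 0 2]
    · simp [curl, magB]; linarith [this 3 1, hh 1 0 3]
    · simp [curl, magB]; linarith [this 1 2, hh 2 0 1]
  refine ⟨hsE, hsC, fun p hp => ?_, fun p hp => ?_, fun p hp a ha => ?_, hdE⟩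
  · have := hdiv p hp 0
    rw [div2_form hM hform hp fun a => hsC.differentiableAt hp a, if_pos rfl] at this
    linarith
  · have hn := nrm_sq (rad_pos hM hp).ne'
    have hff : lapse M p * (lapse M p)⁻¹ = 1 := mul_inv_cancel₀ (lapse_pos hM hp).ne'
    have e1 := pd_stretch hM hp (fun a => hsC.differentiableAt hp a)
    have e2 := fun a b => pd_congr (a := b) (isOpen_exterior M) hp fun x hx => stretch_magC hM hx F a
    have e3 := hcl p hp 1 2 3
    -- Closure on the spatial indices says that the coordinate divergence of b vanishes; it becomes
    -- an equation for C through b = `stretch` C.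
    have e4 : pd 1 (fun x => magB F x 1) p + pd 2 (fun x => magB F x 2) p
      + pd 3 (fun x => magB F x 3) p = 0 := by simp [magB]; linarith
    rw [← e2, ← e2, ← e2, e1, e1, e1] at e4
    have hk : lapse' M p = (1 - lapse M p) * (rad p)⁻¹ := rfl
    simp only [stretch, radial, sphProj, sdiv, div_eq_mul_inv] at *
    rw [hk] at *
    generalize magC M F p = c at *
    generalize (lapse M p)⁻¹ = g at *
    generalize (rad p)⁻¹ = ρ at *
    generalize lapse M p = f at *
    clear e1 e2 e3 hdE hanti hcl hdiv hform
    simp at e4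
    grind
  · have h0 := fun a => hdiv p hp a
    simp only [div2_form hM hform hp fun a => hsC.differentiableAt hp a] at h0
    have h1 := h0 1; have h2 := h0 2; have h3 := h0 3; have h4 := h0 a
    have hn := nrm_sq (rad_pos hM hp).ne'
    have hff : lapse M p * (lapse M p)⁻¹ = 1 := mul_inv_cancel₀ (lapse_pos hM hp).ne'
    simp only [stretch, radial] at *
    simp [ha] at h1 h2 h3 h4
    -- The radial part of Ampère's law is isolated since `stretch` acts as the identity along n; the
    -- remaining components then follow linearly.
    have hr : nrm p 1 * pd 0 (fun x => F x 0 1) p + nrm p 2 * pd 0 (fun x => F x 0 2) p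
        + nrm p 3 * pd 0 (fun x => F x 0 3) p = - (nrm p 1 * curl (magC M F) p 1
          + nrm p 2 * curl (magC M F) p 2 + nrm p 3 * curl (magC M F) p 3) := by
      generalize (lapse M p)⁻¹ = g at *
      linear_combination (- lapse M p) * (nrm p 1 * h1 + nrm p 2 * h2 + nrm p 3 * h3)
        - (lapse M p * (g - 1) * (nrm p 1 * curl (magC M F) p 1
          + nrm p 2 * curl (magC M F) p 2 + nrm p 3 * curl (magC M F) p 3)) * hn
        - (nrm p 1 * pd 0 (fun x => F x 0 1) p + nrm p 2 * pd 0 (fun x => F x 0 2) p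
        + nrm p 3 * pd 0 (fun x => F x 0 3) p + (nrm p 1 * curl (magC M F) p 1
          + nrm p 2 * curl (magC M F) p 2 + nrm p 3 * curl (magC M F) p 3)) * hff
    linear_combination (-1) * h4 + (1 - (lapse M p)⁻¹) * nrm p a * hr

/-! ### The fields `Z` and `β` in terms of the Maxwell pair -/

theorem fieldZ_form {M : ℝ} (hM : 0 < M) {p : Pt} (hp : p ∈ exterior M)
    {F : Pt → Fin 4 → Fin 4 → ℝ} {E C : Fin 4 → ℝ} (hF : F p = form M p E C) :
    fieldZ M F p = form M p (fun a => 2 / 3 * cross p C a) (fun a => - (2 / 3) * cross p E a) := by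
  have h := (rad_pos hM hp).ne'
  have hn := nrm_sq h
  have hff : lapse M p * (lapse M p)⁻¹ = 1 := mul_inv_cancel₀ (lapse_pos hM hp).ne'
  ext a b
  have h1 : fieldZ M F p a b = - (2 / 3) * (∑ c, (∑ d, invMetric M p c d * hodge M F p a d)
        * killingYano p b c - ∑ c, (∑ d, invMetric M p c d * hodge M F p b d) * killingYano p a c) := by
    simp only [fieldZ, mul_sub, Finset.sum_sub_distrib, Finset.sum_mul, Finset.mul_sum]
    congr 1 <;>
    · refine Finset.sum_congr rfl fun c _ => Finset.sum_congr rfl fun d _ => ?_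
      ring
  rw [h1]
  simp only [sum_invMetric_mul hM hp, hodge_form hM hp hF, killingYano, permSymbol_cast]
  simp only [Fin.sum_univ_four, form, radial, stretch, cross]
  rw [coord_eq h (a := 1) (by simp), coord_eq h (a := 2) (by simp), coord_eq h (a := 3) (by simp)]
  generalize (lapse M p)⁻¹ = g at *
  generalize nrm p = n at *
  clear h1
  fin_cases a <;> fin_cases b <;> simp <;> grind

/-- The vector `e_i = Z_{0i}` of a Maxwell pair. -/
def pairE (C : Pt → Fin 4 → ℝ) (p : Pt) (a : Fin 4) : ℝ := 2 / 3 * cross p (C p) a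

/-- The vector `h_i = *Z_{0i}` of a Maxwell pair. -/
def pairH (E : Pt → Fin 4 → ℝ) (p : Pt) (a : Fin 4) : ℝ := - (2 / 3) * cross p (E p) a

/-- The potential `φ = r x · E / 3` with `Re β = r⁻¹ dφ`. -/
def pairφ (E : Pt → Fin 4 → ℝ) (p : Pt) : ℝ :=
  1 / 3 * rad p * (p 1 * E p 1 + p 2 * E p 2 + p 3 * E p 3)

/-- The covector `r⁻¹ dφ`. -/
def pairU (E : Pt → Fin 4 → ℝ) (p : Pt) (a : Fin 4) : ℝ := (rad p)⁻¹ * pd a (pairφ E) p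

theorem radial_cross {p : Pt} (h : rad p ≠ 0) (k : ℝ) (w : Fin 4 → ℝ) :
    radial p (fun a => k * cross p w a) = 0 := by
  simp only [radial, nrm_one, nrm_two, nrm_three, cross]
  simp; field_simp; ring

theorem radial_pairE {p : Pt} (h : rad p ≠ 0) (C : Pt → Fin 4 → ℝ) : radial p (pairE C p) = 0 :=
  radial_cross h _ _

theorem radial_pairH {p : Pt} (h : rad p ≠ 0) (C : Pt → Fin 4 → ℝ) : radial p (pairH C p) = 0 :=
  radial_cross h _ _

theorem smoothField_cross {M : ℝ} {E : Pt → Fin 4 → ℝ} (hE : SmoothField M E) (k : ℝ) :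
    SmoothField M (fun p a => k * cross p (E p) a) := by
  intro a
  have h1 := hE 1; have h2 := hE 2; have h3 := hE 3
  fin_cases a <;> simp [cross] <;> fun_prop

theorem smooth_pairφ {M : ℝ} (hM : 0 < M) {E : Pt → Fin 4 → ℝ} (hE : SmoothField M E) :
    ContDiffOn ℝ ∞ (pairφ E) (exterior M) := by
  have h1 := hE 1; have h2 := hE 2; have h3 := hE 3
  have hr := contDiffOn_rad hM
  unfold pairφ
  fun_prop

theorem smoothField_pairU {M : ℝ} (hM : 0 < M) {E : Pt → Fin 4 → ℝ} (hE : SmoothField M E) :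
    SmoothField M (pairU E) := by
  intro a
  exact ((contDiffOn_rad hM).inv fun x hx => (rad_pos hM hx).ne').mul
    (contDiffOn_pd (isOpen_exterior M) (smooth_pairφ hM hE))

theorem pd_cross {M : ℝ} {E : Pt → Fin 4 → ℝ} (hE : SmoothField M E) (k : ℝ) {p : Pt}
    (hp : p ∈ exterior M) (a b : Fin 4) :
    pd a (fun x => k * cross x (E x) b) p
      = k * (cross p (fun c => pd a (fun x => E x c) p) b
        + cross (fun c => if c = a then 1 else 0) (E p) b) := by
  have h1 := hE.differentiableAt hp 1
  have h2 := hE.differentiableAt hp 2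
  have h3 := hE.differentiableAt hp 3
  fin_cases b
  · simp [cross, pd_const]
  all_goals
    simp only [cross]
    simp
    rw [pd_mul (by fun_prop) (by fun_prop), pd_sub (by fun_prop) (by fun_prop),
      pd_mul (by fun_prop) (by fun_prop), pd_mul (by fun_prop) (by fun_prop)]
    simp only [pd_const, pd_coord]
    split_ifs <;> ring

theorem pd_pairφ {M : ℝ} (hM : 0 < M) {E : Pt → Fin 4 → ℝ} (hE : SmoothField M E) {p : Pt}
    (hp : p ∈ exterior M) (a : Fin 4) :
    pd a (pairφ E) p = 1 / 3 * (nrm p a * (p 1 * E p 1 + p 2 * E p 2 + p 3 * E p 3)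
      + rad p * (p 1 * pd a (fun x => E x 1) p + p 2 * pd a (fun x => E x 2) p
        + p 3 * pd a (fun x => E x 3) p + if a = 0 then 0 else E p a)) := by
  have h := (rad_pos hM hp).ne'
  have h1 := hE.differentiableAt hp 1
  have h2 := hE.differentiableAt hp 2
  have h3 := hE.differentiableAt hp 3
  have hr := differentiableAt_rad h
  have : pairφ E = fun p => 1 / 3 * rad p * (p 1 * E p 1 + p 2 * E p 2 + p 3 * E p 3) := rfl
  rw [this, pd_mul (by fun_prop) (by fun_prop), pd_mul (by fun_prop) (by fun_prop),
    pd_add (by fun_prop) (by fun_prop), pd_add (by fun_prop) (by fun_prop),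
    pd_mul (by fun_prop) (by fun_prop), pd_mul (by fun_prop) (by fun_prop),
    pd_mul (by fun_prop) (by fun_prop), pd_const, pd_rad h, pd_coord, pd_coord, pd_coord]
  fin_cases a <;> simp <;> ring

/-- Since `stretch` fixes n, x·∂_t E = -x·curl C, and this is the divergence of x × C. -/
theorem pairU_zero {M : ℝ} (hM : 0 < M) {E C : Pt → Fin 4 → ℝ} (hEC : MaxwellPair M E C) {p : Pt}
    (hp : p ∈ exterior M) : pairU E p 0 = 1 / 2 * sdiv (pairE C) p := by
  have h := (rad_pos hM hp).ne'
  have hn := nrm_sq h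
  have hcr := fun a ha => hEC.curlC p hp a ha
  have h1 := hcr 1 (by simp); have h2 := hcr 2 (by simp); have h3 := hcr 3 (by simp)
  simp only [pairU, pd_pairφ hM hEC.smoothE hp, sdiv, pairE, pd_cross hEC.smoothC _ hp]
  simp only [stretch, radial, curl, cross] at *
  rw [coord_eq h (a := 1) (by simp), coord_eq h (a := 2) (by simp), coord_eq h (a := 3) (by simp)]
  have hrr : rad p * (rad p)⁻¹ = 1 := mul_inv_cancel₀ h
  simp [nrm_zero] at *
  generalize (lapse M p)⁻¹ = g at *
  generalize (rad p)⁻¹ = ρ at *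
  generalize nrm p = n at *
  grind

theorem pairU_eq {M : ℝ} (hM : 0 < M) {E : Pt → Fin 4 → ℝ} (hE : SmoothField M E) {p : Pt}
    (hp : p ∈ exterior M) {a : Fin 4} (ha : a ≠ 0) :
    pairU E p a = 1 / 3 * (nrm p a * radial p (E p) + E p a
      + rad p * radial p (fun b => pd a (fun x => E x b) p)) := by
  have h := (rad_pos hM hp).ne'
  simp only [pairU, pd_pairφ hM hE hp, radial, if_neg ha]
  rw [coord_eq h (a := 1) (by simp), coord_eq h (a := 2) (by simp), coord_eq h (a := 3) (by simp)]
  field_simp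
  ring

theorem cross_nrm_pairH {M : ℝ} (hM : 0 < M) {E : Pt → Fin 4 → ℝ} {p : Pt}
    (hp : p ∈ exterior M) {a : Fin 4} (ha : a ≠ 0) :
    (rad p)⁻¹ * cross (nrm p) (pairH E p) a
      = - (2 / 3) * (nrm p a * radial p (E p) - E p a) := by
  have h := (rad_pos hM hp).ne'
  have hn := nrm_sq h
  have hrr : rad p * (rad p)⁻¹ = 1 := mul_inv_cancel₀ h
  simp only [pairH, cross, radial]
  rw [coord_eq h (a := 1) (by simp), coord_eq h (a := 2) (by simp), coord_eq h (a := 3) (by simp)]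
  fin_cases a
  · exact absurd rfl ha
  all_goals
    simp
    grind

/-- The curl of x × E contains x div E, which Gauss's law eliminates; the curl of E left in dφ is
exchanged for ∂_t C by Faraday's law. -/
theorem pairU_space {M : ℝ} (hM : 0 < M) {E C : Pt → Fin 4 → ℝ} (hEC : MaxwellPair M E C) {p : Pt}
    (hp : p ∈ exterior M) {a : Fin 4} (ha : a ≠ 0) :
    pairU E p a + (lapse M p - 1) * (nrm p a * radial p (pairU E p)) =
      1 / 2 * ((lapse M p)⁻¹ * pd 0 (fun x => pairE C x a) p + curl (pairH E) p a
        - (rad p)⁻¹ * cross (nrm p) (pairH E p) a) := by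
  have h := (rad_pos hM hp).ne'
  have hn := nrm_sq h
  have hcr := fun a ha => hEC.curlE p hp a ha
  have h1 := hcr 1 (by simp); have h2 := hcr 2 (by simp); have h3 := hcr 3 (by simp)
  have hd : rad p * (sdiv E p + (lapse M p - 1)
      * radial p (fun i => radial p fun j => pd i (fun x => E x j) p))
      = 2 * (1 - lapse M p) * radial p (E p) := by
    rw [hEC.divE p hp, lapse']; field_simp
  rw [cross_nrm_pairH hM hp ha]
  simp only [stretch, radial, curl, sdiv] at h1 h2 h3 hd ⊢
  rw [pairU_eq hM hEC.smoothE hp ha, pairU_eq hM hEC.smoothE hp (a := 1) (by simp),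
    pairU_eq hM hEC.smoothE hp (a := 2) (by simp), pairU_eq hM hEC.smoothE hp (a := 3) (by simp)]
  simp only [pairE, pd_cross hEC.smoothC _ hp, pairH, pd_cross hEC.smoothE _ hp]
  simp only [cross, radial]
  rw [coord_eq h (a := 1) (by simp), coord_eq h (a := 2) (by simp), coord_eq h (a := 3) (by simp)]
  generalize (lapse M p)⁻¹ = g at *
  generalize nrm p = n at *
  fin_cases a
  · exact absurd rfl ha
  · simp at h1 h2 h3 hd ⊢
    linear_combination (n 1 / 3) * hd - (rad p / 3) * (n 2 * h3 - n 3 * h2)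
      + 1 / 3 * (lapse M p - 1) * n 1 * (n 1 * E p 1 + n 2 * E p 2 + n 3 * E p 3) * hn
  · simp at h1 h2 h3 hd ⊢
    linear_combination (n 2 / 3) * hd - (rad p / 3) * (n 3 * h1 - n 1 * h3)
      + 1 / 3 * (lapse M p - 1) * n 2 * (n 1 * E p 1 + n 2 * E p 2 + n 3 * E p 3) * hn
  · simp at h1 h2 h3 hd ⊢
    linear_combination (n 3 / 3) * hd - (rad p / 3) * (n 1 * h2 - n 2 * h1)
      + 1 / 3 * (lapse M p - 1) * n 3 * (n 1 * E p 1 + n 2 * E p 2 + n 3 * E p 3) * hn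

theorem smoothField_pairE {M : ℝ} {C : Pt → Fin 4 → ℝ} (hC : SmoothField M C) :
    SmoothField M (pairE C) := smoothField_cross hC _

theorem smoothField_pairH {M : ℝ} {E : Pt → Fin 4 → ℝ} (hE : SmoothField M E) :
    SmoothField M (pairH E) := smoothField_cross hE _

/-- A vector field is tangential to the spheres. -/
def Tangential (M : ℝ) (V : Pt → Fin 4 → ℝ) : Prop := ∀ p ∈ exterior M, radial p (V p) = 0

theorem tangential_pairE {M : ℝ} (hM : 0 < M) (C : Pt → Fin 4 → ℝ) : Tangential M (pairE C) :=
  fun _ hp => radial_pairE (rad_pos hM hp).ne' C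

theorem tangential_pairH {M : ℝ} (hM : 0 < M) (E : Pt → Fin 4 → ℝ) : Tangential M (pairH E) :=
  fun _ hp => radial_pairH (rad_pos hM hp).ne' E

/-- Differentiating n·V = 0 moves the derivative to n, and ∂n is the projection to the sphere
divided by r. The term -V/r is the second fundamental form of the sphere. -/
theorem Tangential.radial_pd {M : ℝ} (hM : 0 < M) {V : Pt → Fin 4 → ℝ} (hV : Tangential M V)
    (hs : SmoothField M V) {p : Pt} (hp : p ∈ exterior M) (a : Fin 4) :
    radial p (fun b => pd a (fun x => V x b) p) = if a = 0 then 0 else - (V p a / rad p) := by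
  have h := (rad_pos hM hp).ne'
  have h1 := pd_radial h (fun b => hs.differentiableAt hp b) a
  rw [pd_congr (isOpen_exterior M) hp hV, pd_const] at h1
  have h2 := hV p hp
  have h3 : sphProj p a 1 * V p 1 + sphProj p a 2 * V p 2 + sphProj p a 3 * V p 3
      = if a = 0 then 0 else V p a := by
    simp only [radial] at h2
    simp only [sphProj]
    fin_cases a
    · simp [nrm_zero]
    · simp; linear_combination (- nrm p 1) * h2
    · simp; linear_combination (- nrm p 2) * h2
    · simp; linear_combination (- nrm p 3) * h2
  rw [h3] at h1
  split_ifs at * <;> (try rw [zero_div] at h1) <;> linarith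

theorem contractU_form {M : ℝ} (hM : 0 < M) {p : Pt} (hp : p ∈ exterior M)
    {w : Pt → Fin 4 → Fin 4 → ℝ} {e c : Fin 4 → ℝ} (hw : w p = form M p e c)
    (he : radial p e = 0) (hc : radial p c = 0) (a : Fin 4) :
    contractU M w p a = if a = 0 then 0 else (rad p)⁻¹ * cross (nrm p) c a := by
  have h := (rad_pos hM hp).ne'
  have hff : lapse M p * (lapse M p)⁻¹ = 1 := mul_inv_cancel₀ (lapse_pos hM hp).ne'
  have h1 : contractU M w p a = - (rad p)⁻¹ *
      ∑ b, (∑ c', invMetric M p b c' * nrm p c') * form M p e c a b := by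
    simp only [contractU, fieldU, pd_rad h, hw, Finset.sum_mul, Finset.mul_sum]
    refine Finset.sum_congr rfl fun c _ => Finset.sum_congr rfl fun d _ => ?_
    ring
  rw [h1]
  simp only [sum_invMetric_nrm hM hp, Fin.sum_univ_four, form, stretch, hc, cross]
  simp only [radial] at he
  generalize (lapse M p)⁻¹ = g at *
  fin_cases a
  · simp [nrm_zero]
    right; linear_combination (- lapse M p) * he
  · simp [nrm_zero]
    linear_combination (rad p)⁻¹ * (nrm p 2 * c 3 - nrm p 3 * c 2) * hff
  · simp [nrm_zero]
    linear_combination (rad p)⁻¹ * (nrm p 3 * c 1 - nrm p 1 * c 3) * hff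
  · simp [nrm_zero]
    linear_combination (rad p)⁻¹ * (nrm p 1 * c 2 - nrm p 2 * c 1) * hff

theorem radial_pairU {M : ℝ} (hM : 0 < M) {E C : Pt → Fin 4 → ℝ} (hEC : MaxwellPair M E C)
    {p : Pt} (hp : p ∈ exterior M) :
    lapse M p * radial p (pairU E p) = 1 / 2 * radial p (curl (pairH E) p) := by
  have h := (rad_pos hM hp).ne'
  have hn := nrm_sq h
  have h1 := pairU_space hM hEC hp (a := 1) (by simp)
  have h2 := pairU_space hM hEC hp (a := 2) (by simp)
  have h3 := pairU_space hM hEC hp (a := 3) (by simp)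
  have h4 := (tangential_pairE hM C).radial_pd hM (smoothField_pairE hEC.smoothC) hp 0
  have h5 := tangential_pairH hM E p hp
  simp only [radial] at *
  have hc : nrm p 1 * cross (nrm p) (pairH E p) 1 + nrm p 2 * cross (nrm p) (pairH E p) 2
    + nrm p 3 * cross (nrm p) (pairH E p) 3 = 0 := by simp [cross]; ring
  rw [if_pos trivial] at h4
  linear_combination nrm p 1 * h1 + nrm p 2 * h2 + nrm p 3 * h3
    + 1 / 2 * (lapse M p)⁻¹ * h4 - 1 / 2 * (rad p)⁻¹ * hc
    - (lapse M p - 1) * (nrm p 1 * pairU E p 1 + nrm p 2 * pairU E p 2 + nrm p 3 * pairU E p 3) * hn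

theorem contractU_add_div2 {M : ℝ} (hM : 0 < M) {E C : Pt → Fin 4 → ℝ} (hEC : MaxwellPair M E C)
    {Z : Pt → Fin 4 → Fin 4 → ℝ}
    (hZ : ∀ x ∈ exterior M, Z x = form M x (pairE C x) (pairH E x)) {p : Pt} (hp : p ∈ exterior M)
    (a : Fin 4) :
    - (1 / 2) * contractU M Z p a - 1 / 2 * div2 M Z p a = pairU E p a := by
  have h := (rad_pos hM hp).ne'
  have hff : lapse M p * (lapse M p)⁻¹ = 1 := mul_inv_cancel₀ (lapse_pos hM hp).ne'
  have hr := radial_pairU hM hEC hp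
  rw [contractU_form hM hp (hZ p hp) (tangential_pairE hM C p hp) (tangential_pairH hM E p hp),
    div2_form hM hZ hp fun b => (smoothField_pairH hEC.smoothE).differentiableAt hp b]
  by_cases ha : a = 0
  · subst ha
    have h4 := (tangential_pairE hM C).radial_pd hM (smoothField_pairE hEC.smoothC) hp
    have h5 := tangential_pairE hM C p hp
    simp only [if_true, pairU_zero hM hEC hp, h4, h5]
    have h6 : radial p (fun i => if i = 0 then 0 else - (pairE C p i / rad p)) = 0 := by
      simp only [radial] at h5 ⊢
      simp
      linear_combination (- (rad p)⁻¹) * h5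
    rw [h6]; ring
  · simp only [if_neg ha]
    have h1 := pairU_space hM hEC hp ha
    linear_combination (-1) * h1 + nrm p a * (1 - (lapse M p)⁻¹) * hr + (nrm p a * radial p (pairU E p)) * hff

/-- The imaginary part is the real part formed from *Z, which is the field Z of the dual pair (C,
-E). -/
theorem fieldβ_eq {M : ℝ} (hM : 0 < M) {F : Pt → Fin 4 → Fin 4 → ℝ} (hF : IsMaxwellField M F)
    {p : Pt} (hp : p ∈ exterior M) (a : Fin 4) :
    fieldβ M F p a = (pairU (fun p => F p 0) p a : ℂ) + Complex.I * (pairU (magC M F) p a : ℂ) := by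
  have hEC := maxwellPair hM hF
  have hZ : ∀ x ∈ exterior M, fieldZ M F x
      = form M x (pairE (magC M F) x) (pairH (fun p => F p 0) x) := fun x hx =>
    fieldZ_form hM hx (eq_form hM hF hx)
  have hZ' : ∀ x ∈ exterior M, hodge M (fieldZ M F) x
      = form M x (pairE (fun x a => - F x 0 a) x) (pairH (magC M F) x) := fun x hx => by
    rw [hodge_form hM hx (hZ x hx)]
    congr 1
    · ext a
      fin_cases a <;> simp [pairE, pairH, cross] <;> ring
    · ext a
      fin_cases a <;> simp [pairE, pairH, cross]
  rw [← contractU_add_div2 hM hEC hZ hp a, ← contractU_add_div2 hM hEC.dual hZ' hp a, fieldβ]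
  push_cast
  ring

/-! ### The Morawetz current in terms of vectors -/

/-- The spatial Euclidean inner product. -/
def dot (v w : Fin 4 → ℝ) : ℝ := v 1 * w 1 + v 2 * w 2 + v 3 * w 3

theorem squareZ_eq {M : ℝ} {p : Pt} {F : Pt → Fin 4 → Fin 4 → ℝ} {Z : Fin 4 → Fin 4 → ℝ}
    (hZ : fieldZ M F p = Z) (a b : Fin 4) :
    squareZ M F p a b = ∑ c, (∑ d, invMetric M p c d * Z a d) * Z b c := by
  simp only [squareZ, hZ, Finset.sum_mul]

theorem squareZ_zero_zero {M : ℝ} (hM : 0 < M) {p : Pt} (hp : p ∈ exterior M)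
    {F : Pt → Fin 4 → Fin 4 → ℝ} {e h : Fin 4 → ℝ} (hZ : fieldZ M F p = form M p e h)
    (he : radial p e = 0) : squareZ M F p 0 0 = - dot e e := by
  simp only [squareZ_eq hZ, sum_invMetric_mul hM hp]
  simp only [Fin.sum_univ_four, radial, form, dot] at *
  simp
  linear_combination (1 - lapse M p) * (nrm p 1 * e 1 + nrm p 2 * e 2 + nrm p 3 * e 3) * he

theorem normZ_eq {M : ℝ} (hM : 0 < M) {p : Pt} (hp : p ∈ exterior M)
    {F : Pt → Fin 4 → Fin 4 → ℝ} {e h : Fin 4 → ℝ} (hZ : fieldZ M F p = form M p e h)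
    (he : radial p e = 0) (hh : radial p h = 0) :
    normZ M F p = - 2 * (lapse M p)⁻¹ * (dot e e - dot h h) := by
  have hn := nrm_sq (rad_pos hM hp).ne'
  have hff : lapse M p * (lapse M p)⁻¹ = 1 := mul_inv_cancel₀ (lapse_pos hM hp).ne'
  have h1 : normZ M F p = ∑ a, ∑ d, form M p e h a d *
      (![![0, -stretch M p e 1, -stretch M p e 2, -stretch M p e 3],
        ![stretch M p e 1, 0, h 3, -h 2],
        ![stretch M p e 2, -h 3, 0, h 1],
        ![stretch M p e 3, h 2, -h 1, 0]] : Fin 4 → Fin 4 → ℝ) a d := by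
    simp only [normZ, squareZ, hZ, ← raise_form hM hp, Finset.mul_sum]
    refine Finset.sum_congr rfl fun a _ => ?_
    conv_rhs => rw [Finset.sum_comm]
    refine Finset.sum_congr rfl fun b _ => ?_
    conv_rhs => rw [Finset.sum_comm]
    refine Finset.sum_congr rfl fun c _ => Finset.sum_congr rfl fun d _ => ?_
    rw [invMetric_symm M p c d]
    ring
  rw [h1]
  simp only [Fin.sum_univ_four, form, stretch, he, hh, dot]
  simp
  ring

theorem sum_squareZ_nrm {M : ℝ} (hM : 0 < M) {p : Pt} (hp : p ∈ exterior M)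
    {F : Pt → Fin 4 → Fin 4 → ℝ} {e h : Fin 4 → ℝ} (hZ : fieldZ M F p = form M p e h)
    (he : radial p e = 0) (hh : radial p h = 0) (a : Fin 4) :
    ∑ b, squareZ M F p a b * nrm p b = if a = 0 then - (lapse M p)⁻¹ * radial p (cross e h)
      else - (lapse M p)⁻¹ ^ 2 * dot h h * nrm p a := by
  have hn := nrm_sq (rad_pos hM hp).ne'
  simp only [squareZ_eq hZ, sum_invMetric_mul hM hp]
  simp only [Fin.sum_univ_four, form, stretch, hh]
  simp only [radial, dot, cross] at *
  generalize (lapse M p)⁻¹ = g at *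
  fin_cases a <;> simp [nrm_zero]
  · ring
  all_goals
    generalize nrm p 1 = n1 at *
    generalize nrm p 2 = n2 at *
    generalize nrm p 3 = n3 at *
    generalize h 1 = h1 at *
    generalize h 2 = h2 at *
    generalize h 3 = h3 at *
    generalize e 1 = e1 at *
    generalize e 2 = e2 at *
    generalize e 3 = e3 at *
    grind

/-- From β + β̄ = 2u and -iβ + iβ̄ = 2v, the four terms weighted by q collapse to ½q(u^b Z_{ab} +
v^b *Z_{ab}). -/
theorem current_re {M : ℝ} {p : Pt} {F : Pt → Fin 4 → Fin 4 → ℝ} {u v : Fin 4 → ℝ}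
    (hβ : ∀ a, fieldβ M F p a = (u a : ℂ) + Complex.I * (v a : ℂ))
    (A : Pt → Fin 4 → ℝ) (q : Pt → ℝ) (a : Fin 4) :
    current M F A q p a =
      ∑ b, (u a * u b + v a * v b - 1 / 2 * metric M p a b *
        ∑ c, ((∑ d, invMetric M p c d * u d) * u c + (∑ d, invMetric M p c d * v d) * v c)) * A p b
      + 1 / 2 * q p * ∑ b, ((∑ c, invMetric M p b c * u c) * fieldZ M F p a b
        + (∑ c, invMetric M p b c * v c) * hodge M (fieldZ M F) p a b)
      + 1 / 16 * normZ M F p * pd a q p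
      - 1 / 4 * ∑ b, squareZ M F p a b * ∑ d, invMetric M p b d * pd d q p := by
  simp only [current, currentℂ, superH, fieldβUp, hβ]
  have hN : ∑ c, ∑ d, (invMetric M p c d * u c * u d + invMetric M p c d * v c * v d)
      = ∑ c, ((∑ d, invMetric M p c d * u d) * u c + (∑ d, invMetric M p c d * v d) * v c) := by
    simp only [Finset.sum_mul, ← Finset.sum_add_distrib]
    refine Finset.sum_congr rfl fun c _ => Finset.sum_congr rfl fun d _ => ?_
    ring
  simp [Complex.mul_re, Complex.mul_im]
  rw [hN]
  have h1 : ∀ x, 2⁻¹ * (u a * u x + v a * v x + (u x * u a + v x * v a)) = u a * u x + v a * v x :=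
    fun x => by ring
  simp only [h1, Finset.sum_add_distrib (f := fun b => (∑ c, invMetric M p b c * u c)
    * fieldZ M F p a b)]
  simp only [mul_assoc, ← Finset.mul_sum]
  ring

/-- The contravariant Morawetz current with radial profiles `α`, `q`, `q'` as an expression in the
covectors `u = Re β`, `v = Im β` and the vectors `e_i = Z_{0i}`, `h_i = *Z_{0i}`. -/
def currentUp (M : ℝ) (p : Pt) (u v e h : Fin 4 → ℝ) (α q q' : ℝ) (a : Fin 4) : ℝ :=
  if a = 0 then
    (lapse M p)⁻¹ * α * (u 0 * radial p u + v 0 * radial p v)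
      - 1 / 2 * q * (lapse M p)⁻¹ * (dot u e + dot v h)
      - 1 / 4 * q' * (lapse M p)⁻¹ * radial p (cross e h)
  else
    - (u a + (lapse M p - 1) * (nrm p a * radial p u)) * α * radial p u
      - (v a + (lapse M p - 1) * (nrm p a * radial p v)) * α * radial p v
      - 1 / 2 * ((lapse M p)⁻¹ * u 0 ^ 2 - dot u u - (lapse M p - 1) * radial p u ^ 2
        + (lapse M p)⁻¹ * v 0 ^ 2 - dot v v - (lapse M p - 1) * radial p v ^ 2) * α * nrm p a
      + 1 / 2 * q * ((lapse M p)⁻¹ * (u 0 * e a + v 0 * h a) + cross u h a - cross v e a)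
      + 1 / 8 * q' * (dot e e + dot h h) * nrm p a

-- Exhibits the current as a lowered explicit vector, the form in which `div1_metric` computes its
-- divergence.
set_option maxRecDepth 4000 in
theorem current_eq {M : ℝ} (hM : 0 < M) {p : Pt} (hp : p ∈ exterior M)
    {F : Pt → Fin 4 → Fin 4 → ℝ} {u v e h : Fin 4 → ℝ}
    (hβ : ∀ a, fieldβ M F p a = (u a : ℂ) + Complex.I * (v a : ℂ))
    (hZ : fieldZ M F p = form M p e h) (he : radial p e = 0) (hh : radial p h = 0)
    {A : Pt → Fin 4 → ℝ} {q : Pt → ℝ} {α q' : ℝ} (hA : ∀ a, A p a = α * nrm p a)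
    (hq : ∀ a, pd a q p = q' * nrm p a) (a : Fin 4) :
    current M F A q p a = ∑ b, metric M p a b * currentUp M p u v e h α (q p) q' b := by
  have hr := (rad_pos hM hp).ne'
  have hn := nrm_sq hr
  have hff : lapse M p * (lapse M p)⁻¹ = 1 := mul_inv_cancel₀ (lapse_pos hM hp).ne'
  have h1 := sum_squareZ_nrm hM hp hZ he hh a
  have h2 : ∑ b, squareZ M F p a b * ∑ d, invMetric M p b d * pd d q p
      = - lapse M p * q' * ∑ b, squareZ M F p a b * nrm p b := by
    have : ∀ b, ∑ d, invMetric M p b d * pd d q p = q' * ∑ d, invMetric M p b d * nrm p d := by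
      intro b; rw [Finset.mul_sum]
      exact Finset.sum_congr rfl fun d _ => by rw [hq]; ring
    simp only [this, sum_invMetric_nrm hM hp, Finset.mul_sum]
    exact Finset.sum_congr rfl fun d _ => by ring
  rw [current_re hβ, h2, h1, normZ_eq hM hp hZ he hh, hq, sum_metric_mul hr]
  have h3 : ∀ w : ℝ, ∑ b, (u a * u b + v a * v b - 1 / 2 * metric M p a b * w) * A p b
      = α * (u a * radial p u + v a * radial p v)
        - 1 / 2 * w * α * ∑ b, metric M p a b * nrm p b := by
    intro w
    simp only [hA, Fin.sum_univ_four, radial, nrm_zero]; ring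
  rw [h3, sum_metric_mul hr, hodge_form hM hp hZ, hZ]
  simp only [sum_invMetric_mul hM hp]
  have hnn : radial p (nrm p) = 1 := by rw [radial, ← hn]; ring
  rw [hnn]
  simp only [Fin.sum_univ_four, form, stretch_neg]
  simp only [stretch, he, hh, nrm_zero]
  clear h1 h2 h3 hq hA hβ hZ hnn
  simp only [currentUp, radial, dot, cross] at *
  generalize (lapse M p)⁻¹ = g at *
  generalize q p = q at *
  generalize lapse M p = f at *
  generalize dUr : nrm p 1 * u 1 + nrm p 2 * u 2 + nrm p 3 * u 3 = ur
  generalize dVr : nrm p 1 * v 1 + nrm p 2 * v 2 + nrm p 3 * v 3 = vr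
  fin_cases a
  · simp [nrm_zero]
    linear_combination (- α * (u 0 * ur + v 0 * vr) + 1 / 2 * q * ((u 1 * e 1 + u 2 * e 2 + u 3 * e 3) + (v 1 * h 1 + v 2 * h 2 + v 3 * h 3))) * hff
      + 1 / 2 * q * (1 - f) * (ur * he + vr * hh)
  · simp
    subst dUr dVr
    linear_combination (- nrm p 1 * α * ((nrm p 1 * u 1 + nrm p 2 * u 2 + nrm p 3 * u 3) ^ 2 + (nrm p 1 * v 1 + nrm p 2 * v 2 + nrm p 3 * v 3) ^ 2)
        - 1 / 2 * q * ((nrm p 1 * u 1 + nrm p 2 * u 2 + nrm p 3 * u 3) * (nrm p 2 * h 3 - nrm p 3 * h 2) - (nrm p 1 * v 1 + nrm p 2 * v 2 + nrm p 3 * v 3) * (nrm p 2 * e 3 - nrm p 3 * e 2))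
        - 1 / 4 * q' * nrm p 1 * g * (h 1 * h 1 + h 2 * h 2 + h 3 * h 3)) * hff
      + (1 - g) * ((nrm p 1 * α * ((nrm p 1 * u 1 + nrm p 2 * u 2 + nrm p 3 * u 3) ^ 2 + (nrm p 1 * v 1 + nrm p 2 * v 2 + nrm p 3 * v 3) ^ 2) * (f - 1))
        + 1 / 2 * (g * u 0 ^ 2 - (u 1 * u 1 + u 2 * u 2 + u 3 * u 3) - (f - 1) * (nrm p 1 * u 1 + nrm p 2 * u 2 + nrm p 3 * u 3) ^ 2 + g * v 0 ^ 2 - (v 1 * v 1 + v 2 * v 2 + v 3 * v 3) - (f - 1) * (nrm p 1 * v 1 + nrm p 2 * v 2 + nrm p 3 * v 3) ^ 2) * α * nrm p 1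
        - 1 / 2 * q * ((u 2 * h 3 - u 3 * h 2) - (v 2 * e 3 - v 3 * e 2))
        - 1 / 8 * q' * nrm p 1 * ((e 1 * e 1 + e 2 * e 2 + e 3 * e 3) + (h 1 * h 1 + h 2 * h 2 + h 3 * h 3))) * hn
      - (1 - g) * (1 / 2 * q * nrm p 1 * g * (u 0 * he + v 0 * hh)
        + 1 / 2 * q * ((nrm p 2 * u 3 - nrm p 3 * u 2) * hh - (nrm p 2 * v 3 - nrm p 3 * v 2) * he))
  · simp
    subst dUr dVr
    linear_combination (- nrm p 2 * α * ((nrm p 1 * u 1 + nrm p 2 * u 2 + nrm p 3 * u 3) ^ 2 + (nrm p 1 * v 1 + nrm p 2 * v 2 + nrm p 3 * v 3) ^ 2)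
        - 1 / 2 * q * ((nrm p 1 * u 1 + nrm p 2 * u 2 + nrm p 3 * u 3) * (nrm p 3 * h 1 - nrm p 1 * h 3) - (nrm p 1 * v 1 + nrm p 2 * v 2 + nrm p 3 * v 3) * (nrm p 3 * e 1 - nrm p 1 * e 3))
        - 1 / 4 * q' * nrm p 2 * g * (h 1 * h 1 + h 2 * h 2 + h 3 * h 3)) * hff
      + (1 - g) * ((nrm p 2 * α * ((nrm p 1 * u 1 + nrm p 2 * u 2 + nrm p 3 * u 3) ^ 2 + (nrm p 1 * v 1 + nrm p 2 * v 2 + nrm p 3 * v 3) ^ 2) * (f - 1))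
        + 1 / 2 * (g * u 0 ^ 2 - (u 1 * u 1 + u 2 * u 2 + u 3 * u 3) - (f - 1) * (nrm p 1 * u 1 + nrm p 2 * u 2 + nrm p 3 * u 3) ^ 2 + g * v 0 ^ 2 - (v 1 * v 1 + v 2 * v 2 + v 3 * v 3) - (f - 1) * (nrm p 1 * v 1 + nrm p 2 * v 2 + nrm p 3 * v 3) ^ 2) * α * nrm p 2
        - 1 / 2 * q * ((u 3 * h 1 - u 1 * h 3) - (v 3 * e 1 - v 1 * e 3))
        - 1 / 8 * q' * nrm p 2 * ((e 1 * e 1 + e 2 * e 2 + e 3 * e 3) + (h 1 * h 1 + h 2 * h 2 + h 3 * h 3))) * hn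
      - (1 - g) * (1 / 2 * q * nrm p 2 * g * (u 0 * he + v 0 * hh)
        + 1 / 2 * q * ((nrm p 3 * u 1 - nrm p 1 * u 3) * hh - (nrm p 3 * v 1 - nrm p 1 * v 3) * he))
  · simp
    subst dUr dVr
    linear_combination (- nrm p 3 * α * ((nrm p 1 * u 1 + nrm p 2 * u 2 + nrm p 3 * u 3) ^ 2 + (nrm p 1 * v 1 + nrm p 2 * v 2 + nrm p 3 * v 3) ^ 2)
        - 1 / 2 * q * ((nrm p 1 * u 1 + nrm p 2 * u 2 + nrm p 3 * u 3) * (nrm p 1 * h 2 - nrm p 2 * h 1) - (nrm p 1 * v 1 + nrm p 2 * v 2 + nrm p 3 * v 3) * (nrm p 1 * e 2 - nrm p 2 * e 1))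
        - 1 / 4 * q' * nrm p 3 * g * (h 1 * h 1 + h 2 * h 2 + h 3 * h 3)) * hff
      + (1 - g) * ((nrm p 3 * α * ((nrm p 1 * u 1 + nrm p 2 * u 2 + nrm p 3 * u 3) ^ 2 + (nrm p 1 * v 1 + nrm p 2 * v 2 + nrm p 3 * v 3) ^ 2) * (f - 1))
        + 1 / 2 * (g * u 0 ^ 2 - (u 1 * u 1 + u 2 * u 2 + u 3 * u 3) - (f - 1) * (nrm p 1 * u 1 + nrm p 2 * u 2 + nrm p 3 * u 3) ^ 2 + g * v 0 ^ 2 - (v 1 * v 1 + v 2 * v 2 + v 3 * v 3) - (f - 1) * (nrm p 1 * v 1 + nrm p 2 * v 2 + nrm p 3 * v 3) ^ 2) * α * nrm p 3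
        - 1 / 2 * q * ((u 1 * h 2 - u 2 * h 1) - (v 1 * e 2 - v 2 * e 1))
        - 1 / 8 * q' * nrm p 3 * ((e 1 * e 1 + e 2 * e 2 + e 3 * e 3) + (h 1 * h 1 + h 2 * h 2 + h 3 * h 3))) * hn
      - (1 - g) * (1 / 2 * q * nrm p 3 * g * (u 0 * he + v 0 * hh)
        + 1 / 2 * q * ((nrm p 1 * u 2 - nrm p 2 * u 1) * hh - (nrm p 1 * v 2 - nrm p 2 * v 1) * he))

/-! ### The divergence of the Morawetz current -/

/-- The first order system satisfied by `u = Re β`, `e_i = Z_{0i}`, `h_i = *Z_{0i}`. -/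
structure WaveSystem (M : ℝ) (u e h : Pt → Fin 4 → ℝ) : Prop where
  smoothu : SmoothField M u
  smoothe : SmoothField M e
  smoothh : SmoothField M h
  tange : Tangential M e
  tangh : Tangential M h
  closed : ∀ p ∈ exterior M, ∀ a b, pd a (fun x => u x b) p - pd b (fun x => u x a) p
    = (nrm p b * u p a - nrm p a * u p b) / rad p
  time : ∀ p ∈ exterior M, u p 0 = 1 / 2 * sdiv e p
  space : ∀ p ∈ exterior M, ∀ a, a ≠ 0 →
    u p a + (lapse M p - 1) * (nrm p a * radial p (u p)) =
      1 / 2 * ((lapse M p)⁻¹ * pd 0 (fun x => e x a) p + curl h p a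
        - (rad p)⁻¹ * cross (nrm p) (h p) a)
  rad_eq : ∀ p ∈ exterior M, lapse M p * radial p (u p) = 1 / 2 * radial p (curl h p)

/-- Closedness is the symmetry of second derivatives of φ, the right side coming from the weight r⁻¹
in u = r⁻¹ dφ. -/
theorem waveSystem {M : ℝ} (hM : 0 < M) {E C : Pt → Fin 4 → ℝ} (hEC : MaxwellPair M E C) :
    WaveSystem M (pairU E) (pairE C) (pairH E) where
  smoothu := smoothField_pairU hM hEC.smoothE
  smoothe := smoothField_pairE hEC.smoothC
  smoothh := smoothField_pairH hEC.smoothE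
  tange := tangential_pairE hM C
  tangh := tangential_pairH hM E
  closed := fun p hp a b => by
    have h := (rad_pos hM hp).ne'
    have hφ := smooth_pairφ hM hEC.smoothE
    have hd : ∀ b, DifferentiableAt ℝ (pd b (pairφ E)) p := fun b =>
      ContDiffOn.differentiableAt_exterior (contDiffOn_pd (isOpen_exterior M) hφ) hp
    have hi : DifferentiableAt ℝ (fun x => (rad x)⁻¹) p := (differentiableAt_rad h).inv h
    simp only [pairU]
    rw [pd_mul hi (hd b), pd_mul hi (hd a), pd_inv (differentiableAt_rad h) h,
      pd_inv (differentiableAt_rad h) h, pd_rad h, pd_rad h, pd_comm (isOpen_exterior M) hφ hp]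
    field_simp
    ring
  time := fun p hp => pairU_zero hM hEC hp
  space := fun p hp a ha => pairU_space hM hEC hp ha
  rad_eq := fun p hp => radial_pairU hM hEC hp

/-- The spatial part of `-u^a`. -/
def raised (M : ℝ) (u : Pt → Fin 4 → ℝ) (p : Pt) (a : Fin 4) : ℝ :=
  u p a + (lapse M p - 1) * (nrm p a * radial p (u p))

/-- Take the divergence of `space`: the curl drops out, and the divergence of ∂_t e is 2∂_t u_0 by
`time`. -/
theorem WaveSystem.wave {M : ℝ} (hM : 0 < M) {u e h : Pt → Fin 4 → ℝ} (hS : WaveSystem M u e h)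
    {p : Pt} (hp : p ∈ exterior M) :
    sdiv (raised M u) p
      = (lapse M p)⁻¹ * pd 0 (fun x => u x 0) p + lapse M p / rad p * radial p (u p) := by
  have hr := (rad_pos hM hp).ne'
  have hn := nrm_sq hr
  have hO := isOpen_exterior M
  have hg := differentiableAt_lapse_inv hM hp
  have hi : DifferentiableAt ℝ (fun x => (rad x)⁻¹) p := (differentiableAt_rad hr).inv hr
  have hnd := differentiableAt_nrm hr
  have de : ∀ a b, DifferentiableAt ℝ (fun x => pd a (fun x => e x b) x) p := fun a b =>
    ContDiffOn.differentiableAt_exterior (contDiffOn_pd hO (hS.smoothe b)) hp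
  have dh : ∀ a b, DifferentiableAt ℝ (fun x => pd a (fun x => h x b) x) p := fun a b =>
    ContDiffOn.differentiableAt_exterior (contDiffOn_pd hO (hS.smoothh b)) hp
  have hh := hS.smoothh.differentiableAt hp
  have e0 : pd 0 (fun x => u x 0) p = 1 / 2 * (pd 1 (pd 0 (fun x => e x 1)) p
      + pd 2 (pd 0 (fun x => e x 2)) p + pd 3 (pd 0 (fun x => e x 3)) p) := by
    rw [pd_congr hO hp hS.time]
    simp only [sdiv]
    have d1 := de 1 1; have d2 := de 2 2; have d3 := de 3 3
    rw [pd_mul (by fun_prop) (by fun_prop), pd_add (by fun_prop) (by fun_prop),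
      pd_add (by fun_prop) (by fun_prop), pd_const, pd_comm hO (hS.smoothe 1) hp,
      pd_comm hO (hS.smoothe 2) hp, pd_comm hO (hS.smoothe 3) hp]
    ring
  have key : ∀ a b c, a ≠ 0 → b ≠ 0 → c ≠ 0 →
      (∀ x, curl h x a = pd b (fun x => h x c) x - pd c (fun x => h x b) x) →
      (∀ x, cross (nrm x) (h x) a = nrm x b * h x c - nrm x c * h x b) →
      pd a (fun x => raised M u x a) p = 1 / 2 * (
        - (lapse M p)⁻¹ ^ 2 * lapse' M p * nrm p a * pd 0 (fun x => e x a) p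
        + (lapse M p)⁻¹ * pd a (pd 0 (fun x => e x a)) p
        + (pd a (pd b (fun x => h x c)) p - pd a (pd c (fun x => h x b)) p)
        + nrm p a / rad p ^ 2 * (nrm p b * h p c - nrm p c * h p b)
        - (rad p)⁻¹ * (sphProj p a b / rad p * h p c + nrm p b * pd a (fun x => h x c) p
          - sphProj p a c / rad p * h p b - nrm p c * pd a (fun x => h x b) p)) := by
    intro a b c ha hb hc h1 h2
    have nb := hnd b; have nc := hnd c; have hb1 := hh b; have hc1 := hh c
    have d1 := de 0 a; have d2 := dh b c; have d3 := dh c b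
    rw [pd_congr (f := fun x => raised M u x a) hO hp (fun x hx => hS.space x hx a ha)]
    simp only [h1, h2]
    rw [pd_mul (by fun_prop) (by fun_prop), pd_sub (by fun_prop) (by fun_prop),
      pd_add (by fun_prop) (by fun_prop), pd_sub (by fun_prop) (by fun_prop), pd_mul hg d1,
      pd_mul hi (by fun_prop), pd_sub (by fun_prop) (by fun_prop), pd_mul nb hc1, pd_mul nc hb1,
      pd_const, pd_inv (differentiableAt_rad hr) hr, pd_rad hr, pd_nrm hr, pd_nrm hr,
      pd_lapse_inv hM hp]
    simp only [sphProj]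
    ring
  have hT := hS.tange.radial_pd hM hS.smoothe hp 0
  have hR := hS.rad_eq p hp
  rw [if_pos rfl] at hT
  rw [sdiv, key 1 2 3 (by simp) (by simp) (by simp) (fun _ => rfl) (fun _ => rfl),
    key 2 3 1 (by simp) (by simp) (by simp) (fun _ => rfl) (fun _ => rfl),
    key 3 1 2 (by simp) (by simp) (by simp) (fun _ => rfl) (fun _ => rfl), e0,
    pd_comm hO (hS.smoothh 3) hp (a := 1) (b := 2), pd_comm hO (hS.smoothh 2) hp (a := 1) (b := 3),
    pd_comm hO (hS.smoothh 1) hp (a := 2) (b := 3)]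
  have hT' : nrm p 1 * pd 0 (fun x => e x 1) p + nrm p 2 * pd 0 (fun x => e x 2) p
    + nrm p 3 * pd 0 (fun x => e x 3) p = 0 := hT
  have hR' : lapse M p * radial p (u p)
      = 1 / 2 * (nrm p 1 * (pd 2 (fun x => h x 3) p - pd 3 (fun x => h x 2) p)
        + nrm p 2 * (pd 3 (fun x => h x 1) p - pd 1 (fun x => h x 3) p)
        + nrm p 3 * (pd 1 (fun x => h x 2) p - pd 2 (fun x => h x 1) p)) := hR
  simp only [sphProj]
  simp
  -- The derivative of f⁻¹ meets n·∂_t e = 0, and the divergence of r⁻¹ n × h is a multiple of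
  -- n·curl h, known from `rad_eq`.
  linear_combination (- 1 / 2 * (lapse M p)⁻¹ ^ 2 * lapse' M p) * hT' - (rad p)⁻¹ * hR'

theorem WaveSystem.pd_radial_zero {M : ℝ} (hM : 0 < M) {u e h : Pt → Fin 4 → ℝ}
    (hS : WaveSystem M u e h) {p : Pt} (hp : p ∈ exterior M) :
    pd 0 (fun x => radial x (u x)) p
      = radial p (fun b => pd b (fun x => u x 0) p) + u p 0 / rad p := by
  have hr := (rad_pos hM hp).ne'
  have hn := nrm_sq hr
  rw [pd_radial hr (hS.smoothu.differentiableAt hp)]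
  have hc := hS.closed p hp
  have c1 := hc 0 1; have c2 := hc 0 2; have c3 := hc 0 3
  simp only [radial, sphProj, nrm_zero] at *
  simp
  linear_combination nrm p 1 * c1 + nrm p 2 * c2 + nrm p 3 * c3 + u p 0 / rad p * hn

theorem WaveSystem.pd_radial_space {M : ℝ} (hM : 0 < M) {u e h : Pt → Fin 4 → ℝ}
    (hS : WaveSystem M u e h) {p : Pt} (hp : p ∈ exterior M) {a : Fin 4} (ha : a ≠ 0) :
    pd a (fun x => radial x (u x)) p
      = radial p (fun b => pd b (fun x => u x a) p)
        + 2 * (u p a - nrm p a * radial p (u p)) / rad p := by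
  have hr := (rad_pos hM hp).ne'
  have hn := nrm_sq hr
  rw [pd_radial hr (hS.smoothu.differentiableAt hp)]
  have hc := hS.closed p hp
  have c1 := hc a 1; have c2 := hc a 2; have c3 := hc a 3
  simp only [radial, sphProj] at *
  fin_cases a
  · exact absurd rfl ha
  · simp at c1 c2 c3 ⊢
    linear_combination nrm p 2 * c2 + nrm p 3 * c3 + u p 1 / rad p * hn
  · simp at c1 c2 c3 ⊢
    linear_combination nrm p 1 * c1 + nrm p 3 * c3 + u p 2 / rad p * hn
  · simp at c1 c2 c3 ⊢
    linear_combination nrm p 1 * c1 + nrm p 2 * c2 + u p 3 / rad p * hn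

/-! ### Divergences of the three pieces of the current. -/

/-- The squared length `u^a u_a`. -/
def sqLen (M : ℝ) (p : Pt) (u : Fin 4 → ℝ) : ℝ :=
  (lapse M p)⁻¹ * u 0 ^ 2 - dot u u - (lapse M p - 1) * radial p u ^ 2

/-- The current `u^a u_b A^b - ½ u^b u_b A^a` for `A = α(r) ∂_r`. -/
def waveFlux (M : ℝ) (α : ℝ → ℝ) (u : Pt → Fin 4 → ℝ) (p : Pt) (a : Fin 4) : ℝ :=
  if a = 0 then (lapse M p)⁻¹ * (α (rad p) * (u p 0 * radial p (u p)))
  else - (raised M u p a * (α (rad p) * radial p (u p)))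
    - 1 / 2 * (sqLen M p (u p) * (α (rad p) * nrm p a))

theorem differentiableAt_comp_rad {φ : ℝ → ℝ} {φ' : ℝ} {p : Pt} (h : rad p ≠ 0)
    (hφ : HasDerivAt φ φ' (rad p)) : DifferentiableAt ℝ (fun x => φ (rad x)) p :=
  hφ.differentiableAt.comp p (differentiableAt_rad h)

theorem differentiableAt_raised {M : ℝ} {u : Pt → Fin 4 → ℝ}
    (hu : SmoothField M u) {p : Pt} (hp : p ∈ exterior M) (h : rad p ≠ 0) (a : Fin 4) :
    DifferentiableAt ℝ (fun x => raised M u x a) p := by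
  have h1 := hu.differentiableAt hp a
  have h2 := differentiableAt_radial h (hu.differentiableAt hp)
  have h3 := differentiableAt_nrm h a
  have h4 := differentiableAt_lapse (M := M) h
  unfold raised
  fun_prop

theorem differentiableAt_sqLen {M : ℝ} (hM : 0 < M) {u : Pt → Fin 4 → ℝ}
    (hu : SmoothField M u) {p : Pt} (hp : p ∈ exterior M) :
    DifferentiableAt ℝ (fun x => sqLen M x (u x)) p := by
  have h := (rad_pos hM hp).ne'
  have hu := hu.differentiableAt hp
  have h0 := hu 0; have h1 := hu 1; have h2 := hu 2; have h3 := hu 3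
  have hr := differentiableAt_radial h hu
  have h4 := differentiableAt_lapse (M := M) h
  have h5 := differentiableAt_lapse_inv hM hp
  unfold sqLen dot
  fun_prop

theorem pd_sqLen {M : ℝ} (hM : 0 < M) {u : Pt → Fin 4 → ℝ}
    (hu : SmoothField M u) {p : Pt} (hp : p ∈ exterior M) (a : Fin 4) :
    pd a (fun x => sqLen M x (u x)) p =
      - (lapse M p)⁻¹ ^ 2 * lapse' M p * nrm p a * u p 0 ^ 2
      + 2 * (lapse M p)⁻¹ * u p 0 * pd a (fun x => u x 0) p
      - 2 * dot (u p) (fun b => pd a (fun x => u x b) p)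
      - lapse' M p * nrm p a * radial p (u p) ^ 2
      - 2 * (lapse M p - 1) * radial p (u p) * pd a (fun x => radial x (u x)) p := by
  have h := (rad_pos hM hp).ne'
  have hu := hu.differentiableAt hp
  have h0 := hu 0; have h1 := hu 1; have h2 := hu 2; have h3 := hu 3
  have hr := differentiableAt_radial h hu
  have h4 := differentiableAt_lapse (M := M) h
  have h5 := differentiableAt_lapse_inv hM hp
  simp only [sqLen, dot, sq (u _ 0), sq (radial _ _)]
  rw [pd_sub (by fun_prop) (by fun_prop), pd_sub (by fun_prop) (by fun_prop),
    pd_mul h5 (by fun_prop), pd_mul h0 h0, pd_add (by fun_prop) (by fun_prop),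
    pd_add (by fun_prop) (by fun_prop), pd_mul h1 h1, pd_mul h2 h2, pd_mul h3 h3,
    pd_mul (by fun_prop) (by fun_prop), pd_mul hr hr, pd_sub (by fun_prop) (by fun_prop), pd_const,
    pd_lapse h, pd_lapse_inv hM hp, lapse']
  ring

/-- For the gradient of a wave, α/r would also appear in the time and radial coefficients. The r⁻¹
corrections in `closed` and `wave` remove it there. -/
theorem WaveSystem.div_waveFlux {M : ℝ} (hM : 0 < M) {u e h : Pt → Fin 4 → ℝ}
    (hS : WaveSystem M u e h) {α : ℝ → ℝ} {α' : ℝ} {p : Pt} (hp : p ∈ exterior M)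
    (hα : HasDerivAt α α' (rad p)) :
    ∑ a, pd a (fun x => waveFlux M α u x a) p =
      1 / 2 * (α (rad p) * lapse' M p * (lapse M p)⁻¹ - α')
        * ((lapse M p)⁻¹ * u p 0 ^ 2 + lapse M p * radial p (u p) ^ 2)
      + (1 / 2 * α' - α (rad p) / rad p) * (dot (u p) (u p) - radial p (u p) ^ 2) := by
  have hr := (rad_pos hM hp).ne'
  have hn := nrm_sq hr
  have hff : lapse M p * (lapse M p)⁻¹ = 1 := mul_inv_cancel₀ (lapse_pos hM hp).ne'
  have hu := hS.smoothu.differentiableAt hp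
  have h0 := hu 0
  have dr := differentiableAt_radial hr hu
  have dα := differentiableAt_comp_rad hr hα
  have dg := differentiableAt_lapse_inv hM hp
  have dN := differentiableAt_sqLen hM hS.smoothu hp
  have e0 : pd 0 (fun x => waveFlux M α u x 0) p = (lapse M p)⁻¹ * α (rad p) *
      (pd 0 (fun x => u x 0) p * radial p (u p) + u p 0 * pd 0 (fun x => radial x (u x)) p) := by
    simp only [waveFlux, if_true]
    rw [pd_mul dg (dα.fun_mul (h0.fun_mul dr)), pd_mul dα (h0.fun_mul dr), pd_mul h0 dr,
      pd_lapse_inv hM hp,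
      pd_comp_rad hr hα, nrm_zero]
    ring
  have e1 : ∀ a, a ≠ 0 → pd a (fun x => waveFlux M α u x a) p =
      - (pd a (fun x => raised M u x a) p * (α (rad p) * radial p (u p)))
      - raised M u p a * (α' * nrm p a * radial p (u p)
          + α (rad p) * pd a (fun x => radial x (u x)) p)
      - 1 / 2 * (pd a (fun x => sqLen M x (u x)) p * (α (rad p) * nrm p a)
        + sqLen M p (u p) * (α' * nrm p a ^ 2 + α (rad p) * ((1 - nrm p a ^ 2) / rad p))) := by
    intro a ha
    have dn := differentiableAt_nrm hr a
    have dx := differentiableAt_raised hS.smoothu hp hr a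
    simp only [waveFlux, if_neg ha]
    have d1 := dα.fun_mul dr
    have d2 := dα.fun_mul dn
    rw [pd_sub (dx.fun_mul d1).fun_neg ((dN.fun_mul d2).const_mul _), pd_neg, pd_mul dx d1,
      pd_mul dα dr, pd_mul (by fun_prop) (dN.fun_mul d2), pd_mul dN d2, pd_mul dα dn, pd_const,
      pd_comp_rad hr hα, pd_nrm hr]
    simp [ha]
    ring
  have hw := hS.wave hM hp
  rw [sdiv] at hw
  have r0 := hS.pd_radial_zero hM hp
  have r1 := hS.pd_radial_space hM hp (a := 1) (by simp)
  have r2 := hS.pd_radial_space hM hp (a := 2) (by simp)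
  have r3 := hS.pd_radial_space hM hp (a := 3) (by simp)
  rw [Fin.sum_univ_four, e0, e1 1 (by simp), e1 2 (by simp), e1 3 (by simp),
    pd_sqLen hM hS.smoothu hp, pd_sqLen hM hS.smoothu hp, pd_sqLen hM hS.smoothu hp, r0, r1, r2, r3]
  simp only [raised, sqLen] at *
  generalize (lapse M p)⁻¹ = g at *
  simp only [radial, dot, div_eq_mul_inv] at *
  generalize (rad p)⁻¹ = ρ at *
  generalize lapse M p = f at *
  generalize lapse' M p = k at *
  generalize α (rad p) = α at *
  linear_combination (- α * (nrm p 1 * u p 1 + nrm p 2 * u p 2 + nrm p 3 * u p 3)) * hw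
    + (- (f - 1) * α' * (nrm p 1 * u p 1 + nrm p 2 * u p 2 + nrm p 3 * u p 3) ^ 2
      + 1 / 2 * α * k * (g ^ 2 * u p 0 ^ 2
        + (nrm p 1 * u p 1 + nrm p 2 * u p 2 + nrm p 3 * u p 3) ^ 2)
      - 1 / 2 * (g * u p 0 ^ 2 - (u p 1 * u p 1 + u p 2 * u p 2 + u p 3 * u p 3)
        - (f - 1) * (nrm p 1 * u p 1 + nrm p 2 * u p 2 + nrm p 3 * u p 3) ^ 2)
        * (α' - α * ρ)) * hn
    - 1 / 2 * α * k * (nrm p 1 * u p 1 + nrm p 2 * u p 2 + nrm p 3 * u p 3) ^ 2 * hff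

/-- The current `½ q u_b Z^{ab}` for a radial function `q`. -/
def mixFlux (M : ℝ) (q : ℝ → ℝ) (u e h : Pt → Fin 4 → ℝ) (p : Pt) (a : Fin 4) : ℝ :=
  if a = 0 then - (1 / 2 * ((lapse M p)⁻¹ * (q (rad p) * dot (u p) (e p))))
  else 1 / 2 * (q (rad p) * ((lapse M p)⁻¹ * (u p 0 * e p a) + cross (u p) (h p) a))

/-- By `time` and `space` the divergence of Z is -2u up to terms in Z/r, so integrating by parts
against u produces q u^a u_a. The r⁻¹ terms cancel against the failure of u to be closed. -/
theorem WaveSystem.div_mixFlux {M : ℝ} (hM : 0 < M) {u e h : Pt → Fin 4 → ℝ}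
    (hS : WaveSystem M u e h) {q : ℝ → ℝ} {q' : ℝ} {p : Pt} (hp : p ∈ exterior M)
    (hq : HasDerivAt q q' (rad p)) :
    ∑ a, pd a (fun x => mixFlux M q u e h x a) p =
      q (rad p) * sqLen M p (u p) + 1 / 2 * q' * radial p (cross (u p) (h p)) := by
  have hr := (rad_pos hM hp).ne'
  have hu := hS.smoothu.differentiableAt hp
  have he := hS.smoothe.differentiableAt hp
  have hh := hS.smoothh.differentiableAt hp
  have u0 := hu 0; have u1 := hu 1; have u2 := hu 2; have u3 := hu 3
  have e1 := he 1; have e2 := he 2; have e3 := he 3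
  have dq := differentiableAt_comp_rad hr hq
  have dg := differentiableAt_lapse_inv hM hp
  have f0 : pd 0 (fun x => mixFlux M q u e h x 0) p = - (1 / 2 * ((lapse M p)⁻¹ * (q (rad p) *
      (dot (fun b => pd 0 (fun x => u x b) p) (e p)
        + dot (u p) (fun b => pd 0 (fun x => e x b) p))))) := by
    have dd : DifferentiableAt ℝ (fun x => dot (u x) (e x)) p := by unfold dot; fun_prop
    simp only [mixFlux, if_true]
    rw [pd_neg, pd_mul (by fun_prop) (dg.fun_mul (dq.fun_mul dd)), pd_mul dg (dq.fun_mul dd),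
      pd_mul dq dd, pd_lapse_inv hM hp, pd_comp_rad hr hq, nrm_zero, pd_const]
    simp only [dot]
    rw [pd_add (by fun_prop) (by fun_prop), pd_add (by fun_prop) (by fun_prop), pd_mul u1 e1,
      pd_mul u2 e2, pd_mul u3 e3]
    ring
  have key : ∀ a b c, a ≠ 0 →
      (∀ x, cross (u x) (h x) a = u x b * h x c - u x c * h x b) →
      pd a (fun x => mixFlux M q u e h x a) p = 1 / 2 * (
        q' * nrm p a * ((lapse M p)⁻¹ * (u p 0 * e p a) + (u p b * h p c - u p c * h p b))
        + q (rad p) * (- (lapse M p)⁻¹ ^ 2 * lapse' M p * nrm p a * (u p 0 * e p a)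
          + (lapse M p)⁻¹ * (pd a (fun x => u x 0) p * e p a + u p 0 * pd a (fun x => e x a) p)
          + (pd a (fun x => u x b) p * h p c + u p b * pd a (fun x => h x c) p
            - pd a (fun x => u x c) p * h p b - u p c * pd a (fun x => h x b) p))) := by
    intro a b c ha h2
    have ub := hu b; have uc := hu c; have hb := hh b; have hc := hh c; have ea := he a
    have d1 : DifferentiableAt ℝ (fun x => u x b * h x c - u x c * h x b) p := by fun_prop
    have d2 := dg.fun_mul (u0.fun_mul ea)
    simp only [mixFlux, if_neg ha, h2]
    rw [pd_mul (by fun_prop) (dq.fun_mul (d2.fun_add d1)), pd_mul dq (d2.fun_add d1),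
      pd_add d2 d1, pd_mul dg (u0.fun_mul ea), pd_mul u0 ea, pd_sub (by fun_prop) (by fun_prop),
      pd_mul ub hc, pd_mul uc hb, pd_const, pd_lapse_inv hM hp, pd_comp_rad hr hq]
    ring
  rw [Fin.sum_univ_four, f0, key 1 2 3 (by simp) (fun _ => rfl), key 2 3 1 (by simp) (fun _ => rfl),
    key 3 1 2 (by simp) (fun _ => rfl)]
  have s1 := hS.space p hp 1 (by simp)
  have s2 := hS.space p hp 2 (by simp)
  have s3 := hS.space p hp 3 (by simp)
  have ht := hS.time p hp
  have hE := hS.tange p hp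
  have hc := hS.closed p hp
  have c1 := hc 0 1; have c2 := hc 0 2; have c3 := hc 0 3
  have k1 := hc 2 3; have k2 := hc 3 1; have k3 := hc 1 2
  clear key f0
  simp only [sqLen, dot, radial, sdiv, curl, cross, div_eq_mul_inv, nrm_zero] at *
  simp at s1 s2 s3 ⊢
  linear_combination (1 / 2 * (q' * (lapse M p)⁻¹ * u p 0
      - q (rad p) * (lapse M p)⁻¹ ^ 2 * lapse' M p * u p 0
      - (lapse M p)⁻¹ * q (rad p) * (rad p)⁻¹ * u p 0)) * hE
    - 1 / 2 * (lapse M p)⁻¹ * q (rad p) * (e p 1 * c1 + e p 2 * c2 + e p 3 * c3)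
    - q (rad p) * (lapse M p)⁻¹ * u p 0 * ht
    + 1 / 2 * q (rad p) * (h p 1 * k1 + h p 2 * k2 + h p 3 * k3)
    + q (rad p) * (u p 1 * s1 + u p 2 * s2 + u p 3 * s3)

/-- Rewrites the q' error of `div_mixFlux` through derivatives of Z, in exactly the combination that
`div_fieldFlux` produces with the opposite sign. -/
theorem WaveSystem.radial_cross_eq {M : ℝ} (hM : 0 < M) {u e h : Pt → Fin 4 → ℝ}
    (hS : WaveSystem M u e h) {p : Pt} (hp : p ∈ exterior M) :
    radial p (cross (u p) (h p)) = 1 / 2 * ((lapse M p)⁻¹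
        * radial p (cross (fun b => pd 0 (fun x => e x b) p) (h p))
      - radial p (fun a => dot (h p) fun b => pd a (fun x => h x b) p)) := by
  have hr := (rad_pos hM hp).ne'
  have hn := nrm_sq hr
  have s1 := hS.space p hp 1 (by simp)
  have s2 := hS.space p hp 2 (by simp)
  have s3 := hS.space p hp 3 (by simp)
  have hH := hS.tangh p hp
  have t1 := hS.tangh.radial_pd hM hS.smoothh hp 1
  have t2 := hS.tangh.radial_pd hM hS.smoothh hp 2
  have t3 := hS.tangh.radial_pd hM hS.smoothh hp 3
  simp only [dot, radial, curl, cross, div_eq_mul_inv] at *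
  simp at s1 s2 s3 t1 t2 t3 ⊢
  generalize (lapse M p)⁻¹ = g at *
  generalize (rad p)⁻¹ = ρ at *
  generalize hn1 : nrm p 1 = n1 at *
  generalize hn2 : nrm p 2 = n2 at *
  generalize hn3 : nrm p 3 = n3 at *
  linear_combination (n3 * h p 2 - n2 * h p 3) * s1 + (n1 * h p 3 - n3 * h p 1) * s2
    + (n2 * h p 1 - n1 * h p 2) * s3 + 1 / 2 * (h p 1 * t1 + h p 2 * t2 + h p 3 * t3)
    + 1 / 2 * ρ * (h p 1 ^ 2 + h p 2 ^ 2 + h p 3 ^ 2) * hn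
    - 1 / 2 * ρ * (n1 * h p 1 + n2 * h p 2 + n3 * h p 3) * hH

/-- The current `½ W^a_b ∇^b q` for a radial function `q` with `q' = q₁`. -/
def fieldFlux (M : ℝ) (q₁ : ℝ → ℝ) (e h : Pt → Fin 4 → ℝ) (p : Pt) (a : Fin 4) : ℝ :=
  if a = 0 then - (1 / 4 * ((lapse M p)⁻¹ * (q₁ (rad p) * radial p (cross (e p) (h p)))))
  else 1 / 8 * ((dot (e p) (e p) + dot (h p) (h p)) * (q₁ (rad p) * nrm p a))

theorem div_fieldFlux {M : ℝ} (hM : 0 < M) {e h : Pt → Fin 4 → ℝ} (hse : SmoothField M e)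
    (hsh : SmoothField M h) {q₁ : ℝ → ℝ} {q₂ : ℝ} {p : Pt} (hp : p ∈ exterior M)
    (hq : HasDerivAt q₁ q₂ (rad p)) :
    ∑ a, pd a (fun x => fieldFlux M q₁ e h x a) p =
      - (1 / 4 * q₁ (rad p) * ((lapse M p)⁻¹
          * (radial p (cross (fun b => pd 0 (fun x => e x b) p) (h p))
            + radial p (cross (e p) (fun b => pd 0 (fun x => h x b) p)))))
      + 1 / 8 * (q₂ + 2 * q₁ (rad p) / rad p) * (dot (e p) (e p) + dot (h p) (h p))
      + 1 / 4 * q₁ (rad p) * (radial p (fun a => dot (e p) fun b => pd a (fun x => e x b) p)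
        + radial p (fun a => dot (h p) fun b => pd a (fun x => h x b) p)) := by
  have hr := (rad_pos hM hp).ne'
  have hn := nrm_sq hr
  have he := hse.differentiableAt hp
  have hh := hsh.differentiableAt hp
  have e1 := he 1; have e2 := he 2; have e3 := he 3
  have h1 := hh 1; have h2 := hh 2; have h3 := hh 3
  have dq := differentiableAt_comp_rad hr hq
  have dg := differentiableAt_lapse_inv hM hp
  have n1 := differentiableAt_nrm hr 1
  have n2 := differentiableAt_nrm hr 2
  have n3 := differentiableAt_nrm hr 3
  have f0 : pd 0 (fun x => fieldFlux M q₁ e h x 0) p = - (1 / 4 * q₁ (rad p) * ((lapse M p)⁻¹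
          * (radial p (cross (fun b => pd 0 (fun x => e x b) p) (h p))
            + radial p (cross (e p) (fun b => pd 0 (fun x => h x b) p))))) := by
    have hc : ∀ x, radial x (cross (e x) (h x)) = nrm x 1 * (e x 2 * h x 3 - e x 3 * h x 2)
      + nrm x 2 * (e x 3 * h x 1 - e x 1 * h x 3) + nrm x 3 * (e x 1 * h x 2 - e x 2 * h x 1) :=
      fun x => rfl
    have dd : DifferentiableAt ℝ (fun x => radial x (cross (e x) (h x))) p := by
      simp only [hc]; fun_prop
    simp only [fieldFlux, if_true]
    rw [pd_neg, pd_mul (by fun_prop) (dg.fun_mul (dq.fun_mul dd)), pd_mul dg (dq.fun_mul dd),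
      pd_mul dq dd, pd_lapse_inv hM hp, pd_comp_rad hr hq, nrm_zero, pd_const]
    simp only [hc]
    rw [pd_add (by fun_prop) (by fun_prop), pd_add (by fun_prop) (by fun_prop),
      pd_mul n1 (by fun_prop), pd_mul n2 (by fun_prop), pd_mul n3 (by fun_prop),
      pd_sub (by fun_prop) (by fun_prop), pd_sub (by fun_prop) (by fun_prop),
      pd_sub (by fun_prop) (by fun_prop), pd_mul e2 h3, pd_mul e3 h2, pd_mul e3 h1, pd_mul e1 h3,
      pd_mul e1 h2, pd_mul e2 h1, pd_nrm hr, pd_nrm hr, pd_nrm hr]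
    simp [radial, cross, nrm_zero]
    ring
  have key : ∀ a, a ≠ 0 → pd a (fun x => fieldFlux M q₁ e h x a) p = 1 / 8 * (
      2 * (dot (e p) (fun b => pd a (fun x => e x b) p) + dot (h p) (fun b => pd a (fun x => h x b) p))
        * (q₁ (rad p) * nrm p a)
      + (dot (e p) (e p) + dot (h p) (h p))
        * (q₂ * nrm p a ^ 2 + q₁ (rad p) * ((1 - nrm p a ^ 2) / rad p))) := by
    intro a ha
    have na := differentiableAt_nrm hr a
    have dd : DifferentiableAt ℝ (fun x => dot (e x) (e x) + dot (h x) (h x)) p := by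
      unfold dot; fun_prop
    simp only [fieldFlux, if_neg ha]
    rw [pd_mul (by fun_prop) (dd.fun_mul (dq.fun_mul na)), pd_mul dd (dq.fun_mul na),
      pd_mul dq na, pd_comp_rad hr hq, pd_const, pd_nrm hr]
    simp only [dot]
    rw [pd_add (by fun_prop) (by fun_prop), pd_add (by fun_prop) (by fun_prop),
      pd_add (by fun_prop) (by fun_prop), pd_add (by fun_prop) (by fun_prop),
      pd_add (by fun_prop) (by fun_prop), pd_mul e1 e1, pd_mul e2 e2, pd_mul e3 e3, pd_mul h1 h1,
      pd_mul h2 h2, pd_mul h3 h3]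
    simp [ha]
    ring
  rw [Fin.sum_univ_four, f0, key 1 (by simp), key 2 (by simp), key 3 (by simp)]
  simp only [radial]
  linear_combination (1 / 8 * (dot (e p) (e p) + dot (h p) (h p)) * (q₂ - q₁ (rad p) / rad p)) * hn

/-- The two first order systems carried by a Maxwell field: `β = u + i v`, `e_i = Z_{0i}`,
`h_i = *Z_{0i}`. -/
structure BetaSystem (M : ℝ) (F : Pt → Fin 4 → Fin 4 → ℝ) (u v e h : Pt → Fin 4 → ℝ) : Prop where
  re : WaveSystem M u e h
  im : WaveSystem M v h (fun x a => - e x a)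
  fieldβ_eq : ∀ p ∈ exterior M, ∀ a, fieldβ M F p a = (u p a : ℂ) + Complex.I * (v p a : ℂ)
  fieldZ_eq : ∀ p ∈ exterior M, fieldZ M F p = form M p (e p) (h p)

/-- Passing to the dual pair sends (e, h) to (h, -e), whence the second system. -/
theorem exists_betaSystem {M : ℝ} (hM : 0 < M) {F : Pt → Fin 4 → Fin 4 → ℝ}
    (hF : IsMaxwellField M F) : ∃ u v e h, BetaSystem M F u v e h := by
  have hEC := maxwellPair hM hF
  refine ⟨pairU (fun p => F p 0), pairU (magC M F), pairE (magC M F), pairH (fun p => F p 0),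
    waveSystem hM hEC, ?_, fun p hp a => Schwarzschild.fieldβ_eq hM hF hp a,
    fun p hp => fieldZ_form hM hp (eq_form hM hF hp)⟩
  have h1 : pairE (fun x a => - (fun p => F p 0) x a) = pairH (fun p => F p 0) := by
    ext x a
    fin_cases a <;> simp [pairE, pairH, cross] <;> ring
  have h2 : pairH (magC M F) = fun x a => - pairE (magC M F) x a := by
    ext x a
    simp [pairE, pairH]
  have := waveSystem hM hEC.dual
  rwa [h1, h2] at this

theorem differentiableAt_waveFlux {M : ℝ} (hM : 0 < M) {α : ℝ → ℝ} {α' : ℝ} {u : Pt → Fin 4 → ℝ}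
    (hu : SmoothField M u) {p : Pt} (hp : p ∈ exterior M) (hα : HasDerivAt α α' (rad p))
    (a : Fin 4) : DifferentiableAt ℝ (fun x => waveFlux M α u x a) p := by
  have hr := (rad_pos hM hp).ne'
  have h1 := differentiableAt_raised hu hp hr a
  have h2 := differentiableAt_radial hr (hu.differentiableAt hp)
  have h3 := differentiableAt_nrm hr a
  have h4 := differentiableAt_lapse_inv hM hp
  have h5 := differentiableAt_sqLen hM hu hp
  have h6 := differentiableAt_comp_rad hr hα
  have h7 := hu.differentiableAt hp 0
  obtain ⟨g, hg⟩ : ∃ g : Pt → ℝ, ∀ x, (lapse M x)⁻¹ = g x := ⟨_, fun _ => rfl⟩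
  obtain ⟨Q, hQ⟩ : ∃ Q : Pt → ℝ, ∀ x, α (rad x) = Q x := ⟨_, fun _ => rfl⟩
  simp only [hg, hQ] at h4 h6
  simp only [waveFlux, hg, hQ]
  split_ifs <;> fun_prop

theorem differentiableAt_mixFlux {M : ℝ} (hM : 0 < M) {q : ℝ → ℝ} {q' : ℝ}
    {u e h : Pt → Fin 4 → ℝ} (hu : SmoothField M u) (he : SmoothField M e) (hh : SmoothField M h)
    {p : Pt} (hp : p ∈ exterior M) (hq : HasDerivAt q q' (rad p))
    (a : Fin 4) : DifferentiableAt ℝ (fun x => mixFlux M q u e h x a) p := by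
  have hr := (rad_pos hM hp).ne'
  have h4 := differentiableAt_lapse_inv hM hp
  have h6 := differentiableAt_comp_rad hr hq
  have u0 := hu.differentiableAt hp 0; have u1 := hu.differentiableAt hp 1
  have u2 := hu.differentiableAt hp 2; have u3 := hu.differentiableAt hp 3
  have e1 := he.differentiableAt hp 1
  have e2 := he.differentiableAt hp 2; have e3 := he.differentiableAt hp 3
  have h1 := hh.differentiableAt hp 1
  have h2 := hh.differentiableAt hp 2; have h3 := hh.differentiableAt hp 3
  obtain ⟨g, hg⟩ : ∃ g : Pt → ℝ, ∀ x, (lapse M x)⁻¹ = g x := ⟨_, fun _ => rfl⟩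
  obtain ⟨Q, hQ⟩ : ∃ Q : Pt → ℝ, ∀ x, q (rad x) = Q x := ⟨_, fun _ => rfl⟩
  simp only [hg, hQ] at h4 h6
  fin_cases a <;> simp [mixFlux, dot, cross, hg, hQ] <;> fun_prop

theorem differentiableAt_fieldFlux {M : ℝ} (hM : 0 < M) {q : ℝ → ℝ} {q' : ℝ}
    {e h : Pt → Fin 4 → ℝ} (he : SmoothField M e) (hh : SmoothField M h)
    {p : Pt} (hp : p ∈ exterior M) (hq : HasDerivAt q q' (rad p))
    (a : Fin 4) : DifferentiableAt ℝ (fun x => fieldFlux M q e h x a) p := by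
  have hr := (rad_pos hM hp).ne'
  have h4 := differentiableAt_lapse_inv hM hp
  have h6 := differentiableAt_comp_rad hr hq
  have n1 := differentiableAt_nrm hr 1
  have n2 := differentiableAt_nrm hr 2
  have n3 := differentiableAt_nrm hr 3
  have e1 := he.differentiableAt hp 1
  have e2 := he.differentiableAt hp 2; have e3 := he.differentiableAt hp 3
  have h1 := hh.differentiableAt hp 1
  have h2 := hh.differentiableAt hp 2; have h3 := hh.differentiableAt hp 3
  obtain ⟨g, hg⟩ : ∃ g : Pt → ℝ, ∀ x, (lapse M x)⁻¹ = g x := ⟨_, fun _ => rfl⟩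
  obtain ⟨Q, hQ⟩ : ∃ Q : Pt → ℝ, ∀ x, q (rad x) = Q x := ⟨_, fun _ => rfl⟩
  simp only [hg, hQ] at h4 h6
  fin_cases a <;> simp [fieldFlux, dot, cross, radial, hg, hQ] <;> fun_prop

theorem currentUp_eq {M : ℝ} (u v e h : Pt → Fin 4 → ℝ) (α q q₁ : ℝ → ℝ) (p : Pt) (a : Fin 4) :
    currentUp M p (u p) (v p) (e p) (h p) (α (rad p)) (q (rad p)) (q₁ (rad p)) a
      = waveFlux M α u p a + waveFlux M α v p a + mixFlux M q u e h p a
        + mixFlux M q v h (fun x a => - e x a) p a + fieldFlux M q₁ e h p a := by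
  fin_cases a <;>
    simp [currentUp, waveFlux, mixFlux, fieldFlux, cross, sqLen, raised] <;> ring

/-- The divergence of the current of a radial multiplier `A = α(r) ∂_r`, `q = q(r)`. -/
theorem BetaSystem.div_current {M : ℝ} (hM : 0 < M) {F : Pt → Fin 4 → Fin 4 → ℝ}
    {u v e h : Pt → Fin 4 → ℝ} (hS : BetaSystem M F u v e h) {α α' q q₁ q₂ : ℝ → ℝ}
    (hα : ∀ r, r ≠ 0 → HasDerivAt α (α' r) r) (hq : ∀ r, r ≠ 0 → HasDerivAt q (q₁ r) r)
    (hq₁ : ∀ r, r ≠ 0 → HasDerivAt q₁ (q₂ r) r) {A : Pt → Fin 4 → ℝ}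
    (hA : ∀ p a, A p a = α (rad p) * nrm p a) {p : Pt} (hp : p ∈ exterior M) :
    div1 M (current M F A fun x => q (rad x)) p =
      1 / 2 * (α (rad p) * lapse' M p * (lapse M p)⁻¹ - α' (rad p))
        * ((lapse M p)⁻¹ * (u p 0 ^ 2 + v p 0 ^ 2)
          + lapse M p * (radial p (u p) ^ 2 + radial p (v p) ^ 2))
      + (1 / 2 * α' (rad p) - α (rad p) / rad p)
        * (dot (u p) (u p) - radial p (u p) ^ 2 + dot (v p) (v p) - radial p (v p) ^ 2)
      + q (rad p) * (sqLen M p (u p) + sqLen M p (v p))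
      + 1 / 8 * (q₂ (rad p) + 2 * q₁ (rad p) / rad p)
        * (dot (e p) (e p) + dot (h p) (h p)) := by
  have hr := (rad_pos hM hp).ne'
  have d1 := fun a => differentiableAt_waveFlux hM hS.re.smoothu hp (hα _ hr) a
  have d2 := fun a => differentiableAt_waveFlux hM hS.im.smoothu hp (hα _ hr) a
  have d3 := fun a => differentiableAt_mixFlux hM hS.re.smoothu hS.re.smoothe hS.re.smoothh hp
    (hq _ hr) a
  have d4 := fun a => differentiableAt_mixFlux hM hS.im.smoothu hS.im.smoothe hS.im.smoothh hp
    (hq _ hr) a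
  have d5 := fun a => differentiableAt_fieldFlux hM hS.re.smoothe hS.re.smoothh hp (hq₁ _ hr) a
  rw [div1_metric hM (J := fun x a => waveFlux M α u x a + waveFlux M α v x a
    + mixFlux M q u e h x a + mixFlux M q v h (fun x a => - e x a) x a + fieldFlux M q₁ e h x a)]
  · have hs : ∀ a, pd a (fun x => waveFlux M α u x a + waveFlux M α v x a
        + mixFlux M q u e h x a + mixFlux M q v h (fun x a => - e x a) x a
        + fieldFlux M q₁ e h x a) p = pd a (fun x => waveFlux M α u x a) p
          + pd a (fun x => waveFlux M α v x a) p + pd a (fun x => mixFlux M q u e h x a) p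
          + pd a (fun x => mixFlux M q v h (fun x a => - e x a) x a) p
          + pd a (fun x => fieldFlux M q₁ e h x a) p := by
      intro a
      rw [pd_add ((((d1 a).fun_add (d2 a)).fun_add (d3 a)).fun_add (d4 a)) (d5 a),
        pd_add (((d1 a).fun_add (d2 a)).fun_add (d3 a)) (d4 a),
        pd_add ((d1 a).fun_add (d2 a)) (d3 a), pd_add (d1 a) (d2 a)]
    simp only [hs, Finset.sum_add_distrib]
    -- The field flux cancels the q' terms of both mixed fluxes: the h-derivatives come from the
    -- real system, the e-derivatives from the imaginary one.
    rw [hS.re.div_waveFlux hM hp (hα _ hr), hS.im.div_waveFlux hM hp (hα _ hr),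
      hS.re.div_mixFlux hM hp (hq _ hr), hS.im.div_mixFlux hM hp (hq _ hr),
      div_fieldFlux hM hS.re.smoothe hS.re.smoothh hp (hq₁ _ hr), hS.re.radial_cross_eq hM hp,
      hS.im.radial_cross_eq hM hp]
    simp only [pd_neg]
    simp only [radial, cross, dot]
    simp
    ring
  · exact hp
  · intro x hx a
    have hrx := (rad_pos hM hx).ne'
    rw [current_eq hM hx (hS.fieldβ_eq x hx) (hS.fieldZ_eq x hx) (hS.re.tange x hx)
      (hS.re.tangh x hx) (hA x) (fun a => pd_comp_rad hrx (hq _ hrx) a) a]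
    simp only [currentUp_eq]
  · intro a
    have h1 := d1 a; have h2 := d2 a; have h3 := d3 a; have h4 := d4 a; have h5 := d5 a
    fun_prop

theorem hasDerivAt_inv_pow (n : ℕ) {r : ℝ} (h : r ≠ 0) :
    HasDerivAt (fun x : ℝ => x⁻¹ ^ n) (-(n * r⁻¹ ^ (n + 1))) r := by
  have := (hasDerivAt_inv h).pow n
  refine this.congr_deriv ?_
  cases n with
  | zero => simp
  | succ n =>
    rw [Nat.add_sub_cancel, ← inv_pow]
    ring

theorem lapse_eq {M : ℝ} {p : Pt} (h : rad p ≠ 0) : lapse M p = (rad p - 2 * M) / rad p := by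
  unfold lapse
  field_simp

/-- The divergence of the Morawetz current. -/
theorem BetaSystem.div_morawetzP {M : ℝ} (hM : 0 < M) {F : Pt → Fin 4 → Fin 4 → ℝ}
    {u v e h : Pt → Fin 4 → ℝ} (hS : BetaSystem M F u v e h) {p : Pt} (hp : p ∈ exterior M) :
    - div1 M (morawetzP M F) p =
      3 * M * (rad p - 2 * M) * (rad p - 3 * M) ^ 2 / (4 * rad p ^ 5)
        * ((lapse M p)⁻¹ * (u p 0 ^ 2 + v p 0 ^ 2))
      + (3 * M * (rad p - 2 * M) / (4 * rad p ^ 3)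
          + 9 * M ^ 2 * (rad p - 2 * M) * (2 * rad p - 3 * M) / (4 * rad p ^ 5))
        * (lapse M p * (radial p (u p) ^ 2 + radial p (v p) ^ 2))
      + (rad p - 3 * M) ^ 2 * (2 * rad p ^ 2 - 3 * M * rad p + 6 * M ^ 2) / (4 * rad p ^ 5)
        * (dot (u p) (u p) - radial p (u p) ^ 2 + (dot (v p) (v p) - radial p (v p) ^ 2))
      - 27 / 8 * M ^ 2 * (rad p - 2 * M) * (rad p - 5 * M) / rad p ^ 7
        * (dot (e p) (e p) + dot (h p) (h p)) := by
  have hr := (rad_pos hM hp).ne'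
  have hf := (lapse_pos hM hp).ne'
  -- Division by zero makes the coefficient of A vanish at r = 0, where the polynomial in r⁻¹ equals
  -- 1/2; the correction restores agreement and does not affect derivatives at r ≠ 0.
  have hA : ∀ p a, morawetzA M p a
      = (1 / 2 * (1 - 5 * M * (rad p)⁻¹ ^ 1 + 6 * M ^ 2 * (rad p)⁻¹ ^ 2)
          - if rad p = 0 then 1 / 2 else 0) * nrm p a := by
    intro p a
    by_cases h : rad p = 0
    · simp [morawetzA, nrm, h]
    · simp only [morawetzA, nrm, if_neg h]
      rw [sub_zero]
      split_ifs
      · simp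
      · field_simp
        ring
  have hQ : morawetzq M = fun p => 9 / 4 * M ^ 2 * (2 * (rad p)⁻¹ ^ 3 - 7 * M * (rad p)⁻¹ ^ 4
      + 6 * M ^ 2 * (rad p)⁻¹ ^ 5) := by
    ext p
    by_cases h : rad p = 0
    · simp [morawetzq, h]
    · simp only [morawetzq]
      field_simp
      ring
  have key := hS.div_current hM
    (α := fun r => 1 / 2 * (1 - 5 * M * r⁻¹ ^ 1 + 6 * M ^ 2 * r⁻¹ ^ 2) - if r = 0 then 1 / 2 else 0)
    (α' := fun r => 1 / 2 * (5 * M * r⁻¹ ^ 2 - 12 * M ^ 2 * r⁻¹ ^ 3))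
    (q := fun r => 9 / 4 * M ^ 2 * (2 * r⁻¹ ^ 3 - 7 * M * r⁻¹ ^ 4 + 6 * M ^ 2 * r⁻¹ ^ 5))
    (q₁ := fun r => 9 / 4 * M ^ 2 * (-6 * r⁻¹ ^ 4 + 28 * M * r⁻¹ ^ 5 - 30 * M ^ 2 * r⁻¹ ^ 6))
    (q₂ := fun r => 9 / 4 * M ^ 2 * (24 * r⁻¹ ^ 5 - 140 * M * r⁻¹ ^ 6 + 180 * M ^ 2 * r⁻¹ ^ 7))
    (fun r h => ?_) (fun r h => ?_) (fun r h => ?_) hA hp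
  · rw [morawetzP, hQ, key]
    simp only [sqLen, lapse', lapse_eq hr, if_neg hr]
    rw [lapse_eq hr] at hf
    have hf' : rad p - 2 * M ≠ 0 := fun h => hf (by simp [h])
    field_simp
    ring
  · have h1 : HasDerivAt (fun r => 1 / 2 * (1 - 5 * M * r⁻¹ ^ 1 + 6 * M ^ 2 * r⁻¹ ^ 2))
        (1 / 2 * (5 * M * r⁻¹ ^ 2 - 12 * M ^ 2 * r⁻¹ ^ 3)) r :=
      (((((hasDerivAt_inv_pow 1 h).const_mul (5 * M)).const_sub 1).add
        ((hasDerivAt_inv_pow 2 h).const_mul (6 * M ^ 2))).const_mul (1 / 2)).congr_deriv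
          (by push_cast; ring)
    refine h1.congr_of_eventuallyEq ?_
    filter_upwards [isOpen_ne.mem_nhds h] with x hx
    simp [show x ≠ 0 from hx]
  · exact (((((hasDerivAt_inv_pow 3 h).const_mul 2).sub
        ((hasDerivAt_inv_pow 4 h).const_mul (7 * M))).add
        ((hasDerivAt_inv_pow 5 h).const_mul (6 * M ^ 2))).const_mul (9 / 4 * M ^ 2)).congr_deriv
          (by push_cast; ring)
  · exact (((((hasDerivAt_inv_pow 4 h).const_mul (-6)).add
        ((hasDerivAt_inv_pow 5 h).const_mul (28 * M))).sub
        ((hasDerivAt_inv_pow 6 h).const_mul (30 * M ^ 2))).const_mul (9 / 4 * M ^ 2)).congr_deriv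
          (by push_cast; ring)

/-! ### The bulk term -/

theorem BetaSystem.norm_βAlong_sq {M : ℝ} {F : Pt → Fin 4 → Fin 4 → ℝ}
    {u v e h : Pt → Fin 4 → ℝ} (hS : BetaSystem M F u v e h) {p : Pt} (hp : p ∈ exterior M)
    (ν : Fin 4 → ℝ) :
    ‖βAlong M F p ν‖ ^ 2 = (∑ a, u p a * ν a) ^ 2 + (∑ a, v p a * ν a) ^ 2 := by
  have : βAlong M F p ν = ((∑ a, u p a * ν a : ℝ) : ℂ) + ((∑ a, v p a * ν a : ℝ) : ℂ) * Complex.I := by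
    simp only [βAlong, hS.fieldβ_eq p hp]
    push_cast
    rw [Finset.sum_mul, ← Finset.sum_add_distrib]
    exact Finset.sum_congr rfl fun a _ => by ring
  rw [this, ← Complex.normSq_eq_norm_sq, Complex.normSq_add_mul_I]

theorem radial_sq_le {p : Pt} (h : rad p ≠ 0) (u : Fin 4 → ℝ) : radial p u ^ 2 ≤ dot u u := by
  have hn := nrm_sq h
  simp only [radial, dot]
  nlinarith [sq_nonneg (nrm p 1 * u 2 - nrm p 2 * u 1), sq_nonneg (nrm p 2 * u 3 - nrm p 3 * u 2),
    sq_nonneg (nrm p 3 * u 1 - nrm p 1 * u 3)]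

/-- Off the axis the two frame vectors and n are orthonormal and equality holds. On the axis
division by zero makes the frame vectors vanish, hence only an inequality. -/
theorem sq_frame_le {p : Pt} (h : rad p ≠ 0) (u : Fin 4 → ℝ) :
    (∑ a, u a * frameX p a) ^ 2 + (∑ a, u a * frameY p a) ^ 2 ≤ dot u u - radial p u ^ 2 := by
  by_cases ha : axisDist p = 0
  · have := radial_sq_le h u
    simp [Fin.sum_univ_four, frameX, frameY, ha]
    linarith
  · have hn := nrm_sq h
    have h1 : (p 1 / axisDist p) ^ 2 + (p 2 / axisDist p) ^ 2 = 1 := by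
      have : axisDist p ^ 2 = p 1 ^ 2 + p 2 ^ 2 := Real.sq_sqrt (by positivity)
      field_simp
      exact this.symm
    have n1 : nrm p 1 = axisDist p / rad p * (p 1 / axisDist p) := by
      rw [nrm_one]; field_simp
    have n2 : nrm p 2 = axisDist p / rad p * (p 2 / axisDist p) := by
      rw [nrm_two]; field_simp
    rw [n1, n2, nrm_three] at hn
    simp only [Fin.sum_univ_four, frameX, frameY, radial, dot, n1, n2, nrm_three]
    simp
    generalize p 1 / axisDist p = c at *
    generalize p 2 / axisDist p = s at *
    generalize axisDist p / rad p = σ at *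
    generalize p 3 / rad p = κ at *
    have h2 : σ ^ 2 + κ ^ 2 = 1 := by linear_combination hn - σ ^ 2 * h1
    apply le_of_eq
    linear_combination (u 1 ^ 2 + u 2 ^ 2) * h1 + ((u 1 * c + u 2 * s) ^ 2 + u 3 ^ 2) * h2

theorem BetaSystem.normΘ_eq {M : ℝ} (hM : 0 < M) {F : Pt → Fin 4 → Fin 4 → ℝ}
    {u v e h : Pt → Fin 4 → ℝ} (hS : BetaSystem M F u v e h) {p : Pt} (hp : p ∈ exterior M) :
    normΘ M F p = 1 / 4 * (dot (e p) (e p) + dot (h p) (h p)) := by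
  have hr := (rad_pos hM hp).ne'
  have hf := lapse_pos hM hp
  have hff : lapse M p * (lapse M p)⁻¹ = 1 := mul_inv_cancel₀ hf.ne'
  have hs : (Real.sqrt (lapse M p))⁻¹ * (Real.sqrt (lapse M p))⁻¹ = (lapse M p)⁻¹ := by
    rw [← mul_inv, Real.mul_self_sqrt hf.le]
  have h1 := squareZ_zero_zero hM hp (hS.fieldZ_eq p hp) (hS.re.tange p hp)
  have h2 := normZ_eq hM hp (hS.fieldZ_eq p hp) (hS.re.tange p hp) (hS.re.tangh p hp)
  have h3 : ∑ a, ∑ b, superW M F p a b * frameT M p a * frameT M p b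
      = superW M F p 0 0 * (lapse M p)⁻¹ := by
    rw [← hs]
    simp [Fin.sum_univ_four, frameT, lapse]
    ring
  rw [normΘ, h3, superW, h1, h2, metric_apply hr, nrm_zero, ← lapse_eq hr]
  simp
  linear_combination (1 / 2 * dot (e p) (e p) - 1 / 4 * (dot (e p) (e p) - dot (h p) (h p))
    * (lapse M p * (lapse M p)⁻¹ + 1)) * hff

theorem BetaSystem.morawetzBulk_le {M : ℝ} (hM : 0 < M) {F : Pt → Fin 4 → Fin 4 → ℝ}
    {u v e h : Pt → Fin 4 → ℝ} (hS : BetaSystem M F u v e h) {p : Pt} (hp : p ∈ exterior M) :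
    morawetzBulk M F p ≤ 1 / 8 * ((rad p - 3 * M) ^ 2 / rad p ^ 3
          * (dot (u p) (u p) - radial p (u p) ^ 2 + (dot (v p) (v p) - radial p (v p) ^ 2))
        + M * (rad p - 2 * M) / rad p ^ 3
          * (lapse M p * (radial p (u p) ^ 2 + radial p (v p) ^ 2))
        + M * (rad p - 3 * M) ^ 2 * (rad p - 2 * M) / rad p ^ 5
          * ((lapse M p)⁻¹ * (u p 0 ^ 2 + v p 0 ^ 2)))
      + M / (400 * rad p ^ 4) * (dot (e p) (e p) + dot (h p) (h p)) := by
  have hr := rad_pos hM hp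
  have hf := lapse_pos hM hp
  have hZ : ‖βAlong M F p (frameZ M p)‖ ^ 2
      = lapse M p * (radial p (u p) ^ 2 + radial p (v p) ^ 2) := by
    have hs : Real.sqrt (lapse M p) ^ 2 = lapse M p := Real.sq_sqrt hf.le
    rw [hS.norm_βAlong_sq hp]
    nth_rw 1 [← hs]
    simp [Fin.sum_univ_four, frameZ, lapse, radial, nrm]
    ring
  have hT : ‖βAlong M F p (frameT M p)‖ ^ 2 = (lapse M p)⁻¹ * (u p 0 ^ 2 + v p 0 ^ 2) := by
    have hs : (Real.sqrt (lapse M p))⁻¹ ^ 2 = (lapse M p)⁻¹ := by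
      rw [inv_pow, Real.sq_sqrt hf.le]
    rw [hS.norm_βAlong_sq hp, ← hs]
    simp [Fin.sum_univ_four, frameT, lapse]
    ring
  have hXY : ‖βAlong M F p (frameX p)‖ ^ 2 + ‖βAlong M F p (frameY p)‖ ^ 2
      ≤ dot (u p) (u p) - radial p (u p) ^ 2 + (dot (v p) (v p) - radial p (v p) ^ 2) := by
    rw [hS.norm_βAlong_sq hp, hS.norm_βAlong_sq hp]
    linarith [sq_frame_le hr.ne' (u p), sq_frame_le hr.ne' (v p)]
  have hc : 0 ≤ (rad p - 3 * M) ^ 2 / rad p ^ 3 := by positivity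
  rw [morawetzBulk, normβDeg, hZ, hT, hS.normΘ_eq hM hp]
  have h1 := mul_le_mul_of_nonneg_left hXY hc
  have h2 : M / (100 * rad p ^ 4) * (1 / 4 * (dot (e p) (e p) + dot (h p) (h p)))
      = M / (400 * rad p ^ 4) * (dot (e p) (e p) + dot (h p) (h p)) := by
    field_simp
    ring
  rw [h2]
  linarith

theorem BetaSystem.morawetzBulk_nonneg {M : ℝ} (hM : 0 < M) {F : Pt → Fin 4 → Fin 4 → ℝ}
    {u v e h : Pt → Fin 4 → ℝ} (hS : BetaSystem M F u v e h) {p : Pt} (hp : p ∈ exterior M) :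
    0 ≤ morawetzBulk M F p := by
  have hr := rad_pos hM hp
  have hr2 : 0 < rad p - 2 * M := sub_pos.2 hp
  rw [morawetzBulk, normβDeg, hS.normΘ_eq hM hp]
  unfold dot
  simp only [← sq]
  positivity

/-! ### The Hodge estimate on the spheres -/

/-- The derivative along the generator `x^j ∂_k - x^k ∂_j` of rotations. -/
def rot (j k : Fin 4) (f : Pt → ℝ) (p : Pt) : ℝ := p j * pd k f p - p k * pd j f p

theorem rot_add {j k : Fin 4} {f g : Pt → ℝ} {p : Pt} (hf : DifferentiableAt ℝ f p)
    (hg : DifferentiableAt ℝ g p) :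
    rot j k (fun x => f x + g x) p = rot j k f p + rot j k g p := by
  simp only [rot, pd_add hf hg]
  ring

theorem rot_sub {j k : Fin 4} {f g : Pt → ℝ} {p : Pt} (hf : DifferentiableAt ℝ f p)
    (hg : DifferentiableAt ℝ g p) :
    rot j k (fun x => f x - g x) p = rot j k f p - rot j k g p := by
  simp only [rot, pd_sub hf hg]
  ring

theorem rot_mul {j k : Fin 4} {f g : Pt → ℝ} {p : Pt} (hf : DifferentiableAt ℝ f p)
    (hg : DifferentiableAt ℝ g p) :
    rot j k (fun x => f x * g x) p = rot j k f p * g p + f p * rot j k g p := by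
  simp only [rot, pd_mul hf hg]
  ring

theorem rot_const {j k : Fin 4} {c : ℝ} {p : Pt} : rot j k (fun _ => c) p = 0 := by
  simp only [rot, pd_const]
  ring

theorem rot_comp_rad {j k : Fin 4} (hj : j ≠ 0) (hk : k ≠ 0) {φ : ℝ → ℝ} {φ' : ℝ} {p : Pt}
    (h : rad p ≠ 0) (hφ : HasDerivAt φ φ' (rad p)) : rot j k (fun x => φ (rad x)) p = 0 := by
  simp only [rot, pd_comp_rad h hφ, coord_eq h hj, coord_eq h hk]
  ring

theorem contDiffOn_rot {j k : Fin 4} {f : Pt → ℝ} {s : Set Pt} (hs : IsOpen s)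
    (hf : ContDiffOn ℝ ∞ f s) : ContDiffOn ℝ ∞ (rot j k f) s := by
  have h1 := contDiffOn_pd (a := j) hs hf
  have h2 := contDiffOn_pd (a := k) hs hf
  unfold rot
  fun_prop

/-- The commutation relation of the rotation algebra. -/
theorem rot_comm {M : ℝ} {i j k : Fin 4} (hij : i ≠ j) (hjk : j ≠ k) (hki : k ≠ i) {f : Pt → ℝ}
    (hf : ContDiffOn ℝ ∞ f (exterior M)) {p : Pt} (hp : p ∈ exterior M) :
    rot j k (rot k i f) p - rot k i (rot j k f) p = - rot i j f p := by
  have hs := isOpen_exterior M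
  have d : ∀ a, DifferentiableAt ℝ (pd a f) p := fun a =>
    ContDiffOn.differentiableAt_exterior (contDiffOn_pd hs hf) hp
  have di := d i; have dj := d j; have dk := d k
  have key : ∀ a b c, pd c (rot a b f) p = (if a = c then 1 else 0) * pd b f p
      + p a * pd c (pd b f) p - (if b = c then 1 else 0) * pd a f p - p b * pd c (pd a f) p := by
    intro a b c
    have da := d a; have db := d b
    unfold rot
    rw [pd_sub (by fun_prop) (by fun_prop), pd_mul (by fun_prop) db, pd_mul (by fun_prop) da,
      pd_coord, pd_coord]
    ring
  rw [rot, rot, key, key, key, key, rot, pd_comm hs hf hp (a := k) (b := i),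
    pd_comm hs hf hp (a := j) (b := i), pd_comm hs hf hp (a := k) (b := j)]
  simp [hij, hjk, hki, hij.symm, hjk.symm, hki.symm]
  ring

/-- The boundary term in the Hodge identity on the spheres. -/
def rotFlux (e : Pt → Fin 4 → ℝ) (i j k : Fin 4) (p : Pt) : ℝ :=
  e p i * rot k i (fun x => e x j) p - e p k * rot i j (fun x => e x i) p + 1 / 2 * (e p j * e p k)

theorem contDiffOn_rotFlux {M : ℝ} {e : Pt → Fin 4 → ℝ} (he : SmoothField M e) (i j k : Fin 4) :
    ContDiffOn ℝ ∞ (rotFlux e i j k) (exterior M) := by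
  have h1 := he i; have h2 := he j; have h3 := he k
  have h4 := contDiffOn_rot (j := k) (k := i) (isOpen_exterior M) h2
  have h5 := contDiffOn_rot (j := i) (k := j) (isOpen_exterior M) h1
  unfold rotFlux
  fun_prop

theorem rot_rotFlux {M : ℝ} {e : Pt → Fin 4 → ℝ} (he : SmoothField M e) {p : Pt}
    (hp : p ∈ exterior M) (i j k : Fin 4) :
    rot j k (rotFlux e i j k) p =
      rot j k (fun x => e x i) p * rot k i (fun x => e x j) p
      + e p i * rot j k (rot k i fun x => e x j) p
      - rot j k (fun x => e x k) p * rot i j (fun x => e x i) p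
      - e p k * rot j k (rot i j fun x => e x i) p
      + 1 / 2 * (rot j k (fun x => e x j) p * e p k + e p j * rot j k (fun x => e x k) p) := by
  have hs := isOpen_exterior M
  have h1 := he.differentiableAt hp i
  have h2 := he.differentiableAt hp j
  have h3 := he.differentiableAt hp k
  have h4 := ContDiffOn.differentiableAt_exterior (contDiffOn_rot (j := k) (k := i) hs (he j)) hp
  have h5 := ContDiffOn.differentiableAt_exterior (contDiffOn_rot (j := i) (k := j) hs (he i)) hp
  unfold rotFlux
  rw [rot_add (by fun_prop) (by fun_prop), rot_sub (by fun_prop) (by fun_prop), rot_mul h1 h4,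
    rot_mul h3 h5, rot_mul (by fun_prop) (by fun_prop), rot_mul h2 h3, rot_const]
  ring

/-- The sum of the rotational derivatives of the boundary terms. -/
def rotDiv (g : Fin 4 → Fin 4 → Fin 4 → Pt → ℝ) (p : Pt) : ℝ :=
  rot 2 3 (g 1 2 3) p + rot 3 1 (g 2 3 1) p + rot 1 2 (g 3 1 2) p

/-- Second derivatives occur only in commutators and reduce to first order by `rot_comm`. The
product ½ e_j e_k in the flux symmetrizes what remains. -/
theorem rotDiv_rotFlux {M : ℝ} {e : Pt → Fin 4 → ℝ} (he : SmoothField M e) {p : Pt}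
    (hp : p ∈ exterior M) : rotDiv (rotFlux e) p =
      rot 2 3 (fun x => e x 1) p * rot 3 1 (fun x => e x 2) p
      - rot 3 1 (fun x => e x 1) p * rot 2 3 (fun x => e x 2) p
      + rot 3 1 (fun x => e x 2) p * rot 1 2 (fun x => e x 3) p
      - rot 1 2 (fun x => e x 2) p * rot 3 1 (fun x => e x 3) p
      + rot 1 2 (fun x => e x 3) p * rot 2 3 (fun x => e x 1) p
      - rot 2 3 (fun x => e x 3) p * rot 1 2 (fun x => e x 1) p
      + 1 / 2 * (e p 1 * (rot 3 1 (fun x => e x 3) p - rot 1 2 (fun x => e x 2) p)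
        + e p 2 * (rot 1 2 (fun x => e x 1) p - rot 2 3 (fun x => e x 3) p)
        + e p 3 * (rot 2 3 (fun x => e x 2) p - rot 3 1 (fun x => e x 1) p)) := by
  have c2 := rot_comm (i := 2) (j := 3) (k := 1) (by simp) (by simp) (by simp) (he 3) hp
  have c3 := rot_comm (i := 3) (j := 1) (k := 2) (by simp) (by simp) (by simp) (he 1) hp
  have c4 := rot_comm (i := 1) (j := 2) (k := 3) (by simp) (by simp) (by simp) (he 2) hp
  simp only [rotDiv, rot_rotFlux he hp]
  linear_combination e p 1 * c4 + e p 2 * c2 + e p 3 * c3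

/-- For a matrix `D` and a unit vector `n` with `n · D n = 0`, the cofactor form of `D` at `n` is
bounded by the squares of the trace and of the component along `n` of the antisymmetric part. -/
theorem cofactor_le {n₁ n₂ n₃ a b c d e f g h i : ℝ} (hn : n₁ ^ 2 + n₂ ^ 2 + n₃ ^ 2 = 1)
    (hk : n₁ * (a * n₁ + b * n₂ + c * n₃) + n₂ * (d * n₁ + e * n₂ + f * n₃)
      + n₃ * (g * n₁ + h * n₂ + i * n₃) = 0) :
    4 * (n₁ * n₁ * (e * i - f * h) + n₁ * n₂ * (f * g - d * i) + n₁ * n₃ * (d * h - e * g)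
        + n₂ * n₁ * (c * h - b * i) + n₂ * n₂ * (a * i - c * g) + n₂ * n₃ * (b * g - a * h)
        + n₃ * n₁ * (b * f - c * e) + n₃ * n₂ * (c * d - a * f) + n₃ * n₃ * (a * e - b * d))
      ≤ (a + e + i) ^ 2
        + (n₁ * (f - h) + n₂ * (g - c) + n₃ * (b - d)) ^ 2 := by
  -- x, y, z are the off-diagonal entries of the symmetric part S of D, and v = S n, so that n·v =
  -- 0.
  obtain ⟨x, hx⟩ : ∃ x, x = (f + h) / 2 := ⟨_, rfl⟩
  obtain ⟨y, hy⟩ : ∃ y, y = (g + c) / 2 := ⟨_, rfl⟩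
  obtain ⟨z, hz⟩ : ∃ z, z = (b + d) / 2 := ⟨_, rfl⟩
  obtain ⟨v₁, h1⟩ : ∃ v, v = a * n₁ + z * n₂ + y * n₃ := ⟨_, rfl⟩
  obtain ⟨v₂, h2⟩ : ∃ v, v = z * n₁ + e * n₂ + x * n₃ := ⟨_, rfl⟩
  obtain ⟨v₃, h3⟩ : ∃ v, v = y * n₁ + x * n₂ + i * n₃ := ⟨_, rfl⟩
  have hk' : n₁ * v₁ + n₂ * v₂ + n₃ * v₃ = 0 := by
    rw [h1, h2, h3, hx, hy, hz]
    linear_combination hk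
  -- With P = 1 - n nᵀ, the numbers squared are, up to sign, the entries of 2PSP - (tr D)P, twice
  -- the trace-free part of the tangential block. In dimension two this is the identity tr² + (b -
  -- c)² - 4 det = (a - d)² + (b + c)².
  have q₁ := sq_nonneg (2 * (a - 2 * n₁ * v₁) - (a + e + i) * (1 - n₁ * n₁))
  have q₂ := sq_nonneg (2 * (e - 2 * n₂ * v₂) - (a + e + i) * (1 - n₂ * n₂))
  have q₃ := sq_nonneg (2 * (i - 2 * n₃ * v₃) - (a + e + i) * (1 - n₃ * n₃))
  have q₄ := sq_nonneg (2 * (x - n₂ * v₃ - n₃ * v₂) + (a + e + i) * (n₂ * n₃))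
  have q₅ := sq_nonneg (2 * (y - n₃ * v₁ - n₁ * v₃) + (a + e + i) * (n₃ * n₁))
  have q₆ := sq_nonneg (2 * (z - n₁ * v₂ - n₂ * v₁) + (a + e + i) * (n₁ * n₂))
  have hS : (a + e + i) ^ 2 + (n₁ * (f - h) + n₂ * (g - c) + n₃ * (b - d)) ^ 2
      - 4 * (n₁ * n₁ * (e * i - f * h) + n₁ * n₂ * (f * g - d * i) + n₁ * n₃ * (d * h - e * g)
        + n₂ * n₁ * (c * h - b * i) + n₂ * n₂ * (a * i - c * g) + n₂ * n₃ * (b * g - a * h)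
        + n₃ * n₁ * (b * f - c * e) + n₃ * n₂ * (c * d - a * f) + n₃ * n₃ * (a * e - b * d))
      = (a + e + i) ^ 2 - 4 * (v₁ ^ 2 + v₂ ^ 2 + v₃ ^ 2)
        + 4 * (a + e + i) * (n₁ * v₁ + n₂ * v₂ + n₃ * v₃)
        - 2 * ((a + e + i) ^ 2 - (a ^ 2 + e ^ 2 + i ^ 2 + 2 * (x ^ 2 + y ^ 2 + z ^ 2)))
          * (n₁ ^ 2 + n₂ ^ 2 + n₃ ^ 2) := by
    rw [h1, h2, h3, hx, hy, hz]
    ring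
  have hQ : (a + e + i) ^ 2 - 4 * (v₁ ^ 2 + v₂ ^ 2 + v₃ ^ 2)
        + 4 * (a + e + i) * (n₁ * v₁ + n₂ * v₂ + n₃ * v₃)
        - 2 * ((a + e + i) ^ 2 - (a ^ 2 + e ^ 2 + i ^ 2 + 2 * (x ^ 2 + y ^ 2 + z ^ 2)))
          * (n₁ ^ 2 + n₂ ^ 2 + n₃ ^ 2)
      = 1 / 2 * ((2 * (a - 2 * n₁ * v₁) - (a + e + i) * (1 - n₁ * n₁)) ^ 2
        + (2 * (e - 2 * n₂ * v₂) - (a + e + i) * (1 - n₂ * n₂)) ^ 2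
        + (2 * (i - 2 * n₃ * v₃) - (a + e + i) * (1 - n₃ * n₃)) ^ 2)
        + (2 * (x - n₂ * v₃ - n₃ * v₂) + (a + e + i) * (n₂ * n₃)) ^ 2
        + (2 * (y - n₃ * v₁ - n₁ * v₃) + (a + e + i) * (n₃ * n₁)) ^ 2
        + (2 * (z - n₁ * v₂ - n₂ * v₁) + (a + e + i) * (n₁ * n₂)) ^ 2 := by
    linear_combination (2 * (a ^ 2 + e ^ 2 + i ^ 2 + 2 * (x ^ 2 + y ^ 2 + z ^ 2))
        - 2 * (a + e + i) ^ 2 - 4 * (v₁ ^ 2 + v₂ ^ 2 + v₃ ^ 2)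
        - 1 / 2 * (a + e + i) ^ 2 * (n₁ ^ 2 + n₂ ^ 2 + n₃ ^ 2 - 1)) * hn
      + (-4 * (n₁ * v₁ + n₂ * v₂ + n₃ * v₃) - 2 * (a + e + i)
        + 4 * (n₁ ^ 2 + n₂ ^ 2 + n₃ ^ 2) * (a + e + i)) * hk'
      + (2 * (a + e + i) * n₁ - 8 * v₁) * h1 + (2 * (a + e + i) * n₂ - 8 * v₂) * h2
      + (2 * (a + e + i) * n₃ - 8 * v₃) * h3

  linarith

/-- The Hodge estimate: for a tangential field,
`2 |e|² / r² + (total derivative) ≤ (div e)² + (n · curl e)²`. -/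
theorem Tangential.hodge_le {M : ℝ} (hM : 0 < M) {e : Pt → Fin 4 → ℝ} (ht : Tangential M e)
    (he : SmoothField M e) {p : Pt} (hp : p ∈ exterior M) :
    4 / rad p ^ 2 * rotDiv (rotFlux e) p + 2 / rad p ^ 2 * dot (e p) (e p)
      ≤ sdiv e p ^ 2 + radial p (curl e p) ^ 2 := by
  have hr := (rad_pos hM hp).ne'
  have hn := nrm_sq hr
  have t0 := ht p hp
  have t1 := ht.radial_pd hM he hp 1
  have t2 := ht.radial_pd hM he hp 2
  have t3 := ht.radial_pd hM he hp 3
  rw [rotDiv_rotFlux he hp]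
  simp only [rot, coord_eq hr (show (1 : Fin 4) ≠ 0 by simp),
    coord_eq hr (show (2 : Fin 4) ≠ 0 by simp), coord_eq hr (show (3 : Fin 4) ≠ 0 by simp)]
  simp only [radial, curl, dot, sdiv, div_eq_mul_inv] at *
  simp at t1 t2 t3
  generalize nrm p 1 = n₁ at *
  generalize nrm p 2 = n₂ at *
  generalize nrm p 3 = n₃ at *
  generalize e p 1 = e₁ at *
  generalize e p 2 = e₂ at *
  generalize e p 3 = e₃ at *
  generalize pd 1 (fun x => e x 1) p = a at *
  generalize pd 1 (fun x => e x 2) p = b at *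
  generalize pd 1 (fun x => e x 3) p = c at *
  generalize pd 2 (fun x => e x 1) p = d at *
  generalize pd 2 (fun x => e x 2) p = e' at *
  generalize pd 2 (fun x => e x 3) p = f at *
  generalize pd 3 (fun x => e x 1) p = g at *
  generalize pd 3 (fun x => e x 2) p = h at *
  generalize pd 3 (fun x => e x 3) p = i at *
  -- D is the gradient of e, and n·Dn = 0 follows from `radial_pd` and tangentiality.
  have key := cofactor_le (a := a) (b := b) (c := c) (d := d) (e := e') (f := f) (g := g) (h := h)
    (i := i) hn (by linear_combination n₁ * t1 + n₂ * t2 + n₃ * t3 - (rad p)⁻¹ * t0)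
  have hrr : rad p * (rad p)⁻¹ = 1 := mul_inv_cancel₀ hr
  simp only [← inv_pow]
  generalize rad p = r at *
  generalize r⁻¹ = ρ at *
  -- The left side equals four times the cofactor form exactly: the rotations are r n × ∂, so their
  -- minors give r² times that form, while the first order terms sum to -½|e|² and cancel the
  -- explicit |e|² term.
  refine le_trans (le_of_eq ?_) key
  linear_combination (4 * (r * ρ + 1) * (n₁ * n₁ * (e' * i - f * h) + n₁ * n₂ * (f * g - d * i)
      + n₁ * n₃ * (d * h - e' * g) + n₂ * n₁ * (c * h - b * i) + n₂ * n₂ * (a * i - c * g)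
      + n₂ * n₃ * (b * g - a * h) + n₃ * n₁ * (b * f - c * e') + n₃ * n₂ * (c * d - a * f)
      + n₃ * n₃ * (a * e' - b * d)) - 2 * ρ ^ 2 * (e₁ ^ 2 + e₂ ^ 2 + e₃ ^ 2)) * hrr
    + 2 * ρ ^ 2 * r * (e₁ * t1 + e₂ * t2 + e₃ * t3 - (a + e' + i) * t0)

/-! ### Absorbing the zeroth order term: the pointwise inequality. -/

theorem zeroth_order_coeff_le {M r : ℝ} (hM : 0 < M) (hr : 2 * M < r) :
    27 / 8 * M ^ 2 * (r - 2 * M) * (r - 5 * M) / r ^ 7 + M / (400 * r ^ 4)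
      ≤ 5 / 16 * M * (r - 3 * M) ^ 2 / r ^ 6 := by
  have h0 : 0 < r := by linarith
  -- The cleared difference of the two sides has a double root at r = 15M/2, so the constant 1/400
  -- cannot be increased in this inequality. The linear factor is positive because r > 2M.
  have h : 0 ≤ (124 * r - 240 * M) * (r - 15 / 2 * M) ^ 2 :=
    mul_nonneg (by linarith) (sq_nonneg _)
  have : 5 / 16 * M * (r - 3 * M) ^ 2 / r ^ 6
      - (27 / 8 * M ^ 2 * (r - 2 * M) * (r - 5 * M) / r ^ 7 + M / (400 * r ^ 4))
      = M / (400 * r ^ 7) * ((124 * r - 240 * M) * (r - 15 / 2 * M) ^ 2) := by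
    field_simp
    ring
  have h2 : 0 ≤ M / (400 * r ^ 7) * ((124 * r - 240 * M) * (r - 15 / 2 * M) ^ 2) :=
    mul_nonneg (by positivity) h
  linarith

/-- The coefficient of the rotational derivatives in the pointwise Morawetz inequality. -/
def rotCoeff (M r : ℝ) : ℝ := 5 / 8 * M * (r - 3 * M) ^ 2 / r ^ 6

theorem contDiffOn_rotCoeff {M : ℝ} (hM : 0 < M) :
    ContDiffOn ℝ ∞ (fun x => rotCoeff M (rad x)) (exterior M) := by
  have h := contDiffOn_rad hM
  unfold rotCoeff
  exact ContDiffOn.div (by fun_prop) (h.pow 6) fun x hx => pow_ne_zero _ (ne_of_gt (rad_pos hM hx))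

/-- The weighted boundary terms of a pair of tangential fields. -/
def weightedFlux (M : ℝ) (e h : Pt → Fin 4 → ℝ) (i j k : Fin 4) (p : Pt) : ℝ :=
  rotCoeff M (rad p) * (rotFlux e i j k p + rotFlux h i j k p)

theorem contDiffOn_weightedFlux {M : ℝ} (hM : 0 < M) {e h : Pt → Fin 4 → ℝ} (he : SmoothField M e)
    (hh : SmoothField M h) (i j k : Fin 4) :
    ContDiffOn ℝ ∞ (weightedFlux M e h i j k) (exterior M) :=
  (contDiffOn_rotCoeff hM).mul ((contDiffOn_rotFlux he i j k).add (contDiffOn_rotFlux hh i j k))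

/-- A radial weight is constant along rotations, so multiplying the Hodge estimate by it keeps the
boundary term a total derivative. -/
theorem rotDiv_weightedFlux {M : ℝ} (hM : 0 < M) {e h : Pt → Fin 4 → ℝ} (he : SmoothField M e)
    (hh : SmoothField M h) {p : Pt} (hp : p ∈ exterior M) :
    rotDiv (weightedFlux M e h) p
      = rotCoeff M (rad p) * (rotDiv (rotFlux e) p + rotDiv (rotFlux h) p) := by
  have hr := (rad_pos hM hp).ne'
  have key : ∀ i j k : Fin 4, j ≠ 0 → k ≠ 0 → rot j k (weightedFlux M e h i j k) p
      = rotCoeff M (rad p) * (rot j k (rotFlux e i j k) p + rot j k (rotFlux h i j k) p) := by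
    intro i j k hj hk
    have de := ContDiffOn.differentiableAt_exterior (contDiffOn_rotFlux he i j k) hp
    have dh := ContDiffOn.differentiableAt_exterior (contDiffOn_rotFlux hh i j k) hp
    have dA := ContDiffOn.differentiableAt_exterior (contDiffOn_rotCoeff hM) hp
    have hA : DifferentiableAt ℝ (rotCoeff M) (rad p) := by
      unfold rotCoeff
      exact DifferentiableAt.div (by fun_prop) (by fun_prop) (pow_ne_zero _ hr)
    have h0 := rot_comp_rad hj hk hr hA.hasDerivAt
    unfold weightedFlux
    rw [rot_mul dA (de.fun_add dh), h0, rot_add de dh]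
    ring
  simp only [rotDiv]
  rw [key 1 2 3 (by simp) (by simp), key 2 3 1 (by simp) (by simp), key 3 1 2 (by simp) (by simp)]
  ring

/-- The pointwise Morawetz inequality. -/
theorem BetaSystem.morawetzBulk_add_rotDiv_le {M : ℝ} (hM : 0 < M) {F : Pt → Fin 4 → Fin 4 → ℝ}
    {u v e h : Pt → Fin 4 → ℝ} (hS : BetaSystem M F u v e h) {p : Pt} (hp : p ∈ exterior M) :
    morawetzBulk M F p + rotDiv (weightedFlux M e h) p ≤ - div1 M (morawetzP M F) p := by
  have hr := rad_pos hM hp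
  have hr2 : 0 < rad p - 2 * M := sub_pos.2 hp
  have hf := lapse_pos hM hp
  have hff : lapse M p * (lapse M p)⁻¹ = 1 := mul_inv_cancel₀ hf.ne'
  have hfi : (lapse M p)⁻¹ = rad p / (rad p - 2 * M) := by rw [lapse_eq hr.ne', inv_div]
  have hE := hS.re.tange.hodge_le hM hS.re.smoothe hp
  have hH := hS.re.tangh.hodge_le hM hS.re.smoothh hp
  have hB := hS.morawetzBulk_le hM hp
  rw [rotDiv_weightedFlux hM hS.re.smoothe hS.re.smoothh hp, hS.div_morawetzP hM hp]
  have hT : (lapse M p)⁻¹ * (u p 0 ^ 2 + v p 0 ^ 2)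
      = rad p / (4 * (rad p - 2 * M)) * (sdiv e p ^ 2 + sdiv h p ^ 2) := by
    rw [hS.re.time p hp, hS.im.time p hp, hfi]
    field_simp
    ring
  have hZ : lapse M p * (radial p (u p) ^ 2 + radial p (v p) ^ 2)
      = rad p / (4 * (rad p - 2 * M)) * (radial p (curl e p) ^ 2 + radial p (curl h p) ^ 2) := by
    have h1 := hS.re.rad_eq p hp
    have h2 := hS.im.rad_eq p hp
    have h3 : radial p (curl (fun x a => - e x a) p) = - radial p (curl e p) := by
      simp [radial, curl, pd_neg]
      ring
    have h4 : rad p / (4 * (rad p - 2 * M)) = 1 / 4 * (lapse M p)⁻¹ := by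
      rw [hfi]
      field_simp
    rw [h3] at h2
    rw [h4]
    linear_combination (lapse M p)⁻¹ * ((lapse M p * radial p (u p) + 1 / 2 * radial p (curl h p))
        * h1 + (lapse M p * radial p (v p) - 1 / 2 * radial p (curl e p)) * h2)
      - lapse M p * (radial p (u p) ^ 2 + radial p (v p) ^ 2) * hff
  have hSn : 0 ≤ dot (u p) (u p) - radial p (u p) ^ 2
      + (dot (v p) (v p) - radial p (v p) ^ 2) := by
    linarith [radial_sq_le hr.ne' (u p), radial_sq_le hr.ne' (v p)]
  have hN : 0 ≤ dot (e p) (e p) + dot (h p) (h p) := by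
    simp only [dot]
    nlinarith [sq_nonneg (e p 1), sq_nonneg (e p 2), sq_nonneg (e p 3), sq_nonneg (h p 1),
      sq_nonneg (h p 2), sq_nonneg (h p 3)]
  rw [hT, hZ] at hB ⊢
  have hD : 0 ≤ sdiv e p ^ 2 + sdiv h p ^ 2 := by positivity
  have hC : 0 ≤ radial p (curl e p) ^ 2 + radial p (curl h p) ^ 2 := by positivity
  have hc := mul_le_mul_of_nonneg_right (zeroth_order_coeff_le hM hp) hN
  generalize dot (u p) (u p) - radial p (u p) ^ 2 + (dot (v p) (v p) - radial p (v p) ^ 2) = S at *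
  generalize radial p (curl e p) = c₁ at *
  generalize radial p (curl h p) = c₂ at *
  generalize sdiv e p = d₁ at *
  generalize sdiv h p = d₂ at *
  generalize dot (e p) (e p) = l₁ at *
  generalize dot (h p) (h p) = l₂ at *
  generalize rotDiv (rotFlux e) p = k₁ at *
  generalize rotDiv (rotFlux h) p = k₂ at *
  generalize morawetzBulk M F p = B at *
  have hr' : 2 * M < rad p := hp
  have hκ : (rad p - 2 * M) * (rad p / (4 * (rad p - 2 * M))) = rad p / 4 := by
    field_simp
  generalize rad p / (4 * (rad p - 2 * M)) = κ at *
  generalize rad p = r at *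
  -- The bulk uses 1/8 of the available 3/4 of the time component; the remaining 5/8, times the
  -- factor 1/4 from u_0 = ½ div e, is the weight 5/32.
  have e1 : 3 * M * (r - 2 * M) * (r - 3 * M) ^ 2 / (4 * r ^ 5)
        * (κ * (d₁ ^ 2 + d₂ ^ 2))
      - 1 / 8 * (M * (r - 3 * M) ^ 2 * (r - 2 * M) / r ^ 5
        * (κ * (d₁ ^ 2 + d₂ ^ 2)))
      = 5 / 32 * M * (r - 3 * M) ^ 2 / r ^ 4 * (d₁ ^ 2 + d₂ ^ 2) := by
    linear_combination (norm := (field_simp; ring))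
      (5 / 8 * M * (r - 3 * M) ^ 2 / r ^ 5 * (d₁ ^ 2 + d₂ ^ 2)) * hκ
  -- The radial component leaves the larger weight 5/32 · M/r² plus the contribution of q. It is
  -- lowered to match the time weight, using r² - (r-3M)² = 3M(2r-3M) > 0.
  have e2 : 5 / 32 * M * (r - 3 * M) ^ 2 / r ^ 4 * (c₁ ^ 2 + c₂ ^ 2) ≤
      (3 * M * (r - 2 * M) / (4 * r ^ 3)
        + 9 * M ^ 2 * (r - 2 * M) * (2 * r - 3 * M) / (4 * r ^ 5))
        * (κ * (c₁ ^ 2 + c₂ ^ 2))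
      - 1 / 8 * (M * (r - 2 * M) / r ^ 3 * (κ * (c₁ ^ 2 + c₂ ^ 2))) := by
    have : (3 * M * (r - 2 * M) / (4 * r ^ 3)
        + 9 * M ^ 2 * (r - 2 * M) * (2 * r - 3 * M) / (4 * r ^ 5))
        * (κ * (c₁ ^ 2 + c₂ ^ 2))
      - 1 / 8 * (M * (r - 2 * M) / r ^ 3 * (κ * (c₁ ^ 2 + c₂ ^ 2)))
      - 5 / 32 * M * (r - 3 * M) ^ 2 / r ^ 4 * (c₁ ^ 2 + c₂ ^ 2)
      = (15 / 32 * M ^ 2 * (2 * r - 3 * M) / r ^ 4 + 9 / 16 * M ^ 2 * (2 * r - 3 * M) / r ^ 4)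
        * (c₁ ^ 2 + c₂ ^ 2) := by
      linear_combination (norm := (field_simp; ring))
        ((5 / 8 * M / r ^ 3 + 9 * M ^ 2 * (2 * r - 3 * M) / (4 * r ^ 5)) * (c₁ ^ 2 + c₂ ^ 2)) * hκ
    have h3 : 0 ≤ 2 * r - 3 * M := by linarith
    have : 0 ≤ (15 / 32 * M ^ 2 * (2 * r - 3 * M) / r ^ 4
        + 9 / 16 * M ^ 2 * (2 * r - 3 * M) / r ^ 4) * (c₁ ^ 2 + c₂ ^ 2) := by positivity
    linarith
  have e3 : 0 ≤ (r - 3 * M) ^ 2 * (2 * r ^ 2 - 3 * M * r + 6 * M ^ 2) / (4 * r ^ 5) * S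
      - 1 / 8 * ((r - 3 * M) ^ 2 / r ^ 3 * S) := by
    have : (r - 3 * M) ^ 2 * (2 * r ^ 2 - 3 * M * r + 6 * M ^ 2) / (4 * r ^ 5) * S
        - 1 / 8 * ((r - 3 * M) ^ 2 / r ^ 3 * S)
        = (r - 3 * M) ^ 2 * (3 * (r - M) ^ 2 + 9 * M ^ 2) / (8 * r ^ 5) * S := by
      field_simp
      ring
    rw [this]
    positivity
  -- The sum of the Hodge estimates for e and h, multiplied by the common leftover weight.
  have e4 : rotCoeff M r * (k₁ + k₂) + 5 / 16 * M * (r - 3 * M) ^ 2 / r ^ 6 * (l₁ + l₂)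
      ≤ 5 / 32 * M * (r - 3 * M) ^ 2 / r ^ 4 * (d₁ ^ 2 + d₂ ^ 2)
        + 5 / 32 * M * (r - 3 * M) ^ 2 / r ^ 4 * (c₁ ^ 2 + c₂ ^ 2) := by
    have h5 := mul_le_mul_of_nonneg_left (add_le_add hE hH)
      (show 0 ≤ 5 / 32 * M * (r - 3 * M) ^ 2 / r ^ 4 by positivity)
    have h6 : 5 / 32 * M * (r - 3 * M) ^ 2 / r ^ 4
        * (4 / r ^ 2 * k₁ + 2 / r ^ 2 * l₁ + (4 / r ^ 2 * k₂ + 2 / r ^ 2 * l₂))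
        = rotCoeff M r * (k₁ + k₂) + 5 / 16 * M * (r - 3 * M) ^ 2 / r ^ 6 * (l₁ + l₂) := by
      unfold rotCoeff
      field_simp
      ring
    linarith
  linarith

/-! ### Rotations -/

/-- The rotation by the angle `θ` in the `(x^j, x^k)` plane. -/
def rotate (j k : Fin 4) (θ : ℝ) (x : Pt) : Pt := fun a =>
  if a = j then Real.cos θ * x j - Real.sin θ * x k
  else if a = k then Real.sin θ * x j + Real.cos θ * x k else x a

/-- The matrix of `rotate`. -/
def rotateMatrix (j k : Fin 4) (θ : ℝ) : Matrix (Fin 4) (Fin 4) ℝ := Matrix.of fun a b =>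
  rotate j k θ (Pi.single b 1) a

theorem toLin'_rotateMatrix {j k : Fin 4} (hj : j ≠ 0) (hk : k ≠ 0) (hjk : j ≠ k) (θ : ℝ) :
    ⇑(Matrix.toLin' (rotateMatrix j k θ)) = rotate j k θ := by
  ext x a
  rw [Matrix.toLin'_apply, Matrix.mulVec, dotProduct]
  fin_cases j <;> fin_cases k <;> simp at hj hk hjk <;> fin_cases a <;>
    simp [rotateMatrix, rotate, Fin.sum_univ_four] <;> ring

theorem det_rotateMatrix {j k : Fin 4} (hj : j ≠ 0) (hk : k ≠ 0) (hjk : j ≠ k) (θ : ℝ) :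
    (rotateMatrix j k θ).det = 1 := by
  have h := Real.sin_sq_add_cos_sq θ
  fin_cases j <;> fin_cases k <;> simp at hj hk hjk <;>
    simp [rotateMatrix, rotate, Matrix.det_succ_row_zero, Fin.sum_univ_succ, Fin.succAbove] <;>
    linear_combination h

theorem continuous_rotate (j k : Fin 4) (θ : ℝ) : Continuous (rotate j k θ) := by
  unfold rotate
  refine continuous_pi fun a => ?_
  split_ifs <;> fun_prop

theorem measurePreserving_rotate {j k : Fin 4} (hj : j ≠ 0) (hk : k ≠ 0) (hjk : j ≠ k) (θ : ℝ) :
    MeasurePreserving (rotate j k θ) := by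
  refine ⟨(continuous_rotate j k θ).measurable, ?_⟩
  have hd := det_rotateMatrix hj hk hjk θ
  have := Real.map_matrix_volume_pi_eq_smul_volume_pi (M := rotateMatrix j k θ) (by simp [hd])
  rw [toLin'_rotateMatrix hj hk hjk, hd] at this
  simpa using this

theorem rotate_neg_rotate {j k : Fin 4} (hjk : j ≠ k) (θ : ℝ) (x : Pt) :
    rotate j k (-θ) (rotate j k θ x) = x := by
  have h := Real.sin_sq_add_cos_sq θ
  ext a
  simp only [rotate, if_true, if_neg hjk.symm, Real.cos_neg, Real.sin_neg]
  split_ifs with h1 h2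
  · subst h1
    linear_combination x a * h
  · subst h2
    linear_combination x a * h
  · rfl

theorem measurableEmbedding_rotate {j k : Fin 4} (hjk : j ≠ k) (θ : ℝ) :
    MeasurableEmbedding (rotate j k θ) :=
  (continuous_rotate j k θ).measurableEmbedding
    (Function.LeftInverse.injective (rotate_neg_rotate hjk θ))

theorem rotate_time {j k : Fin 4} (hj : j ≠ 0) (hk : k ≠ 0) (θ : ℝ) (x : Pt) :
    rotate j k θ x 0 = x 0 := by
  simp [rotate, hj.symm, hk.symm]

theorem rad_rotate {j k : Fin 4} (hj : j ≠ 0) (hk : k ≠ 0) (hjk : j ≠ k) (θ : ℝ) (x : Pt) :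
    rad (rotate j k θ x) = rad x := by
  have h := Real.sin_sq_add_cos_sq θ
  unfold rad
  congr 1
  fin_cases j <;> fin_cases k <;> simp at hj hk hjk <;> simp [rotate] <;>
    [linear_combination (x 1 ^ 2 + x 2 ^ 2) * h; linear_combination (x 1 ^ 2 + x 3 ^ 2) * h;
     linear_combination (x 1 ^ 2 + x 2 ^ 2) * h; linear_combination (x 2 ^ 2 + x 3 ^ 2) * h;
     linear_combination (x 1 ^ 2 + x 3 ^ 2) * h; linear_combination (x 2 ^ 2 + x 3 ^ 2) * h]

theorem rotate_zero {j k : Fin 4} (x : Pt) : rotate j k 0 x = x := by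
  ext a
  simp only [rotate, Real.cos_zero, Real.sin_zero]
  split_ifs with h1 h2
  · simp [h1]
  · simp [h2]
  · rfl

theorem hasDerivAt_rotate {j k : Fin 4} (hjk : j ≠ k) {G : Pt → ℝ} {θ : ℝ} {x : Pt}
    (hG : DifferentiableAt ℝ G (rotate j k θ x)) :
    HasDerivAt (fun t => G (rotate j k t x)) (rot j k G (rotate j k θ x)) θ := by
  have h1 : HasDerivAt (fun t => rotate j k t x) (rotate j k θ x j • Pi.single k (1 : ℝ)
      - rotate j k θ x k • Pi.single j (1 : ℝ)) θ := by
    rw [hasDerivAt_pi]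
    intro a
    have hc := Real.hasDerivAt_cos θ
    have hs := Real.hasDerivAt_sin θ
    by_cases haj : a = j
    · subst haj
      simp only [rotate, if_true, if_neg hjk.symm]
      refine ((hc.mul_const (x a)).sub (hs.mul_const (x k))).congr_deriv ?_
      simp [hjk]
      ring
    · by_cases hak : a = k
      · subst hak
        simp only [rotate, if_true, if_neg haj]
        refine ((hs.mul_const (x j)).add (hc.mul_const (x a))).congr_deriv ?_
        simp [hjk.symm]
        ring
      · simp only [rotate, if_neg haj, if_neg hak]
        refine (hasDerivAt_const θ (x a)).congr_deriv ?_
        simp [haj, hak, hjk.symm]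
  refine (hG.hasFDerivAt.comp_hasDerivAt θ h1).congr_deriv ?_
  simp [rot, pd]

/-! ### Compact symmetric exhaustion and integrals of rotational derivatives. -/

/-- The compact region `|t| ≤ n`, `2M + 1/(n+1) ≤ r ≤ n`. -/
def cutoff (M : ℝ) (n : ℕ) : Set Pt :=
  {x | |x 0| ≤ n ∧ 2 * M + 1 / ((n : ℝ) + 1) ≤ rad x ∧ rad x ≤ n}

theorem cutoff_subset_exterior (M : ℝ) (n : ℕ) : cutoff M n ⊆ exterior M := fun x hx => by
  have : 0 < 1 / ((n : ℝ) + 1) := by positivity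
  have := hx.2.1
  simp only [exterior, Set.mem_ofPred_eq]
  linarith

theorem isClosed_cutoff (M : ℝ) (n : ℕ) : IsClosed (cutoff M n) := by
  have h : cutoff M n = {x : Pt | |x 0| ≤ n}
      ∩ ({x : Pt | 2 * M + 1 / ((n : ℝ) + 1) ≤ rad x} ∩ {x : Pt | rad x ≤ n}) := by
    ext x
    rfl
  rw [h]
  exact (isClosed_le (by fun_prop) continuous_const).inter
    ((isClosed_le continuous_const continuous_rad).inter
      (isClosed_le continuous_rad continuous_const))

theorem isCompact_cutoff (M : ℝ) (n : ℕ) : IsCompact (cutoff M n) := by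
  refine Metric.isCompact_of_isClosed_isBounded (isClosed_cutoff M n) ?_
  refine (Metric.isBounded_closedBall (x := (0 : Pt)) (r := n)).subset fun x hx => ?_
  rw [mem_closedBall_zero_iff, pi_norm_le_iff_of_nonneg (by positivity)]
  have h := rad_sq x
  have hs : ∀ a : Fin 4, x a ^ 2 ≤ rad x ^ 2 → ‖x a‖ ≤ n := fun a ha =>
    (abs_le_of_sq_le_sq ha (rad_nonneg x)).trans hx.2.2
  intro a
  fin_cases a
  · exact hx.1
  · exact hs 1 (by rw [h]; nlinarith [sq_nonneg (x 2), sq_nonneg (x 3)])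
  · exact hs 2 (by rw [h]; nlinarith [sq_nonneg (x 1), sq_nonneg (x 3)])
  · exact hs 3 (by rw [h]; nlinarith [sq_nonneg (x 1), sq_nonneg (x 2)])

theorem sphericallySymmetric_cutoff (M : ℝ) (n : ℕ) : SphericallySymmetric (cutoff M n) := by
  intro p q h0 hr hp
  simpa only [cutoff, Set.mem_ofPred_eq, ← h0, ← hr] using hp

theorem monotone_cutoff (M : ℝ) : Monotone (cutoff M) := by
  intro m n hmn x hx
  have h : (m : ℝ) ≤ n := by exact_mod_cast hmn
  have h1 : 1 / ((n : ℝ) + 1) ≤ 1 / ((m : ℝ) + 1) := by gcongr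
  exact ⟨hx.1.trans h, by linarith [hx.2.1], hx.2.2.trans h⟩

theorem exterior_subset_iUnion_cutoff (M : ℝ) : exterior M ⊆ ⋃ n, cutoff M n := by
  intro x hx
  have hx' : 0 < rad x - 2 * M := sub_pos.2 hx
  obtain ⟨n, hn⟩ := exists_nat_ge (max |x 0| (max (rad x) (1 / (rad x - 2 * M))))
  simp only [max_le_iff] at hn
  refine Set.mem_iUnion.2 ⟨n, hn.1, ?_, hn.2.1⟩
  have : 1 / ((n : ℝ) + 1) ≤ rad x - 2 * M := by
    rw [div_le_iff₀ (by positivity)]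
    have := (div_le_iff₀ hx').1 hn.2.2
    nlinarith
  linarith

/-- The integral of G composed with the rotation by θ does not depend on θ, and its derivative at θ
= 0 is the integral in question. No regularity of the boundary of B is needed. -/
theorem integral_rot_eq_zero {M : ℝ} {j k : Fin 4} (hj : j ≠ 0) (hk : k ≠ 0) (hjk : j ≠ k)
    {G : Pt → ℝ} (hG : ContDiffOn ℝ ∞ G (exterior M)) {n : ℕ} {B : Set Pt}
    (hB : MeasurableSet B) (hBn : B ⊆ cutoff M n) (hs : SphericallySymmetric B) :
    ∫ x in B, rot j k G x = 0 := by
  have hK := isCompact_cutoff M n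
  have hKe := cutoff_subset_exterior M n
  have hR : ∀ θ x, x ∈ cutoff M n → rotate j k θ x ∈ cutoff M n := fun θ x hx =>
    sphericallySymmetric_cutoff M n x _ (rotate_time hj hk θ x).symm
      (rad_rotate hj hk hjk θ x).symm hx
  have hRc : ContinuousOn (rot j k G) (exterior M) :=
    (contDiffOn_rot (isOpen_exterior M) hG).continuousOn
  obtain ⟨C, hC⟩ := hK.exists_bound_of_continuousOn (hRc.mono hKe)
  have hfin : volume B ≠ ⊤ := ((measure_mono hBn).trans_lt hK.measure_lt_top).ne
  have hconst : ∀ θ, ∫ x in B, G (rotate j k θ x) = ∫ x in B, G x := by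
    intro θ
    have hpre : rotate j k θ ⁻¹' B = B := by
      ext x
      exact ⟨hs _ _ (rotate_time hj hk θ x) (rad_rotate hj hk hjk θ x),
        hs _ _ (rotate_time hj hk θ x).symm (rad_rotate hj hk hjk θ x).symm⟩
    have := (measurePreserving_rotate hj hk hjk θ).setIntegral_preimage_emb
      (measurableEmbedding_rotate hjk θ) G B
    rwa [hpre] at this
  have hmeas : ∀ θ, AEStronglyMeasurable (fun x => G (rotate j k θ x)) (volume.restrict B) := by
    intro θ
    refine ContinuousOn.aestronglyMeasurable ?_ hB
    exact hG.continuousOn.comp (continuous_rotate j k θ).continuousOn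
      fun x hx => hKe (hR θ x (hBn hx))
  -- Rotations preserve the compact cutoff, so one bound C dominates the derivative for all θ.
  have key := hasDerivAt_integral_of_dominated_loc_of_deriv_le (μ := volume.restrict B)
    (F := fun θ x => G (rotate j k θ x)) (F' := fun θ x => rot j k G (rotate j k θ x))
    (x₀ := (0 : ℝ)) (bound := fun _ => C) (s := Set.univ) Filter.univ_mem
    (Filter.Eventually.of_forall hmeas) ?_ ?_ ?_ ?_ ?_
  · have h2 := key.2
    simp only [hconst, rotate_zero] at h2
    exact (h2.unique (hasDerivAt_const 0 _))
  · simp only [rotate_zero]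
    exact ((hG.continuousOn.mono hKe).integrableOn_compact hK).mono_set hBn
  · simp only [rotate_zero]
    exact (hRc.mono (hBn.trans hKe)).aestronglyMeasurable hB
  · filter_upwards [ae_restrict_mem hB] with x hx θ _ using hC _ (hR θ x (hBn hx))
  · exact integrableOn_const hfin
  · filter_upwards [ae_restrict_mem hB] with x hx θ _
    exact hasDerivAt_rotate hjk
      (ContDiffOn.differentiableAt_exterior hG (hKe (hR θ x (hBn hx))))

/-! ### Integration -/

/-- `ENNReal.ofReal` takes positive parts; with the positive part of d on the left no subtraction of
infinite quantities can occur. This is the form that passes to the limit. -/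
theorem lintegral_add_le_of_integral_le {X : Type*} [MeasurableSpace X] {μ : Measure X}
    {b d : X → ℝ} (hb : Integrable b μ) (hd : Integrable d μ) (hb0 : 0 ≤ᵐ[μ] b)
    (h : ∫ x, b x ∂μ ≤ ∫ x, - d x ∂μ) :
    (∫⁻ x, ENNReal.ofReal (b x) ∂μ) + (∫⁻ x, ENNReal.ofReal (d x) ∂μ)
      ≤ ∫⁻ x, ENNReal.ofReal (- d x) ∂μ := by
  have hP := hd.lintegral_lt_top
  have hN := hd.neg.lintegral_lt_top
  simp only [Pi.neg_apply] at hN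
  rw [integral_neg, integral_eq_lintegral_pos_part_sub_lintegral_neg_part hd] at h
  rw [← ofReal_integral_eq_lintegral_ofReal hb hb0, ← ENNReal.ofReal_toReal hP.ne,
    ← ENNReal.ofReal_toReal hN.ne,
    ← ENNReal.ofReal_add (integral_nonneg_of_ae hb0) ENNReal.toReal_nonneg]
  exact ENNReal.ofReal_le_ofReal (by linarith)

theorem integral_le_of_lintegral_add_le {X : Type*} [MeasurableSpace X] {μ : Measure X}
    {b d : X → ℝ} (hb : AEStronglyMeasurable b μ) (hd : Integrable d μ) (hb0 : 0 ≤ᵐ[μ] b)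
    (h : (∫⁻ x, ENNReal.ofReal (b x) ∂μ) + (∫⁻ x, ENNReal.ofReal (d x) ∂μ)
      ≤ ∫⁻ x, ENNReal.ofReal (- d x) ∂μ) :
    Integrable b μ ∧ ∫ x, b x ∂μ ≤ ∫ x, - d x ∂μ := by
  have hP := hd.lintegral_lt_top
  have hN := hd.neg.lintegral_lt_top
  simp only [Pi.neg_apply] at hN
  have hbi : Integrable b μ :=
    ⟨hb, (hasFiniteIntegral_iff_ofReal hb0).2 ((le_self_add.trans h).trans_lt hN)⟩
  refine ⟨hbi, ?_⟩
  rw [integral_neg, integral_eq_lintegral_pos_part_sub_lintegral_neg_part hd]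
  rw [← ofReal_integral_eq_lintegral_ofReal hbi hb0, ← ENNReal.ofReal_toReal hP.ne,
    ← ENNReal.ofReal_toReal hN.ne,
    ← ENNReal.ofReal_add (integral_nonneg_of_ae hb0) ENNReal.toReal_nonneg,
    ENNReal.ofReal_le_ofReal_iff ENNReal.toReal_nonneg] at h
  linarith

theorem vol_restrict {M : ℝ} (hM : 0 < M) {Ω : Set Pt} (hΩ : MeasurableSet Ω)
    (hext : Ω ⊆ exterior M) : (vol M).restrict Ω = volume.restrict Ω := by
  rw [vol, restrict_withDensity hΩ]
  have : (fun p => ENNReal.ofReal (Real.sqrt |(metric M p).det|)) =ᵐ[volume.restrict Ω] 1 := by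
    filter_upwards [ae_restrict_mem hΩ] with p hp
    simp [sqrt_det_metric hM (hext hp)]
  rw [withDensity_congr_ae this, withDensity_one]

theorem integral_rotDiv_eq_zero {M : ℝ} {g : Fin 4 → Fin 4 → Fin 4 → Pt → ℝ}
    (hg : ∀ i j k, ContDiffOn ℝ ∞ (g i j k) (exterior M)) {n : ℕ} {B : Set Pt}
    (hB : MeasurableSet B) (hBn : B ⊆ cutoff M n) (hs : SphericallySymmetric B) :
    IntegrableOn (rotDiv g) B ∧ ∫ x in B, rotDiv g x = 0 := by
  have hi : ∀ i j k, IntegrableOn (rot j k (g i j k)) B := fun i j k =>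
    (((contDiffOn_rot (isOpen_exterior M) (hg i j k)).continuousOn.mono
      (cutoff_subset_exterior M n)).integrableOn_compact (isCompact_cutoff M n)).mono_set hBn
  refine ⟨((hi 1 2 3).add (hi 2 3 1)).add (hi 3 1 2), ?_⟩
  have h1 := integral_add ((hi 1 2 3).add (hi 2 3 1)) (hi 3 1 2)
  have h2 := integral_add (hi 1 2 3) (hi 2 3 1)
  simp only [Pi.add_apply] at h1
  unfold rotDiv
  rw [h1, h2, integral_rot_eq_zero (by simp) (by simp) (by simp) (hg 1 2 3) hB hBn hs,
    integral_rot_eq_zero (by simp) (by simp) (by simp) (hg 2 3 1) hB hBn hs,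
    integral_rot_eq_zero (by simp) (by simp) (by simp) (hg 3 1 2) hB hBn hs]
  simp

theorem continuousOn_radial {M : ℝ} (hM : 0 < M) {u : Pt → Fin 4 → ℝ} (hu : SmoothField M u) :
    ContinuousOn (fun p => radial p (u p)) (exterior M) := fun _ hp =>
  (differentiableAt_radial (rad_pos hM hp).ne'
    (hu.differentiableAt hp)).continuousAt.continuousWithinAt

/-- Read off from the explicit formula of `div_morawetzP`; it makes the divergence integrable on
compact subsets of the exterior. -/
theorem BetaSystem.continuousOn_div1 {M : ℝ} (hM : 0 < M) {F : Pt → Fin 4 → Fin 4 → ℝ}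
    {u v e h : Pt → Fin 4 → ℝ} (hS : BetaSystem M F u v e h) :
    ContinuousOn (div1 M (morawetzP M F)) (exterior M) := by
  have h0 : ∀ p ∈ exterior M, rad p ≠ 0 := fun p hp => (rad_pos hM hp).ne'
  have hl : ∀ p ∈ exterior M, lapse M p ≠ 0 := fun p hp => (lapse_pos hM hp).ne'
  have c1 := continuous_rad.continuousOn (s := exterior M)
  have c2 := (contDiffOn_lapse hM).continuousOn
  have c3 := continuousOn_radial hM hS.re.smoothu
  have c4 := continuousOn_radial hM hS.im.smoothu
  have u0 := (hS.re.smoothu 0).continuousOn; have u1 := (hS.re.smoothu 1).continuousOn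
  have u2 := (hS.re.smoothu 2).continuousOn; have u3 := (hS.re.smoothu 3).continuousOn
  have v0 := (hS.im.smoothu 0).continuousOn; have v1 := (hS.im.smoothu 1).continuousOn
  have v2 := (hS.im.smoothu 2).continuousOn; have v3 := (hS.im.smoothu 3).continuousOn
  have e1 := (hS.re.smoothe 1).continuousOn; have e2 := (hS.re.smoothe 2).continuousOn
  have e3 := (hS.re.smoothe 3).continuousOn; have h1 := (hS.re.smoothh 1).continuousOn
  have h2 := (hS.re.smoothh 2).continuousOn; have h3 := (hS.re.smoothh 3).continuousOn
  rw [← continuousOn_neg_iff]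
  refine ContinuousOn.congr ?_ fun p hp => hS.div_morawetzP hM hp
  simp only [div_eq_mul_inv, mul_inv, dot, ← inv_pow]
  have c5 : ContinuousOn (fun p => (rad p)⁻¹) (exterior M) := c1.inv₀ h0
  have c6 : ContinuousOn (fun p => (lapse M p)⁻¹) (exterior M) := c2.inv₀ hl
  obtain ⟨ρ, hρ⟩ : ∃ ρ : Pt → ℝ, ∀ p, (rad p)⁻¹ = ρ p := ⟨_, fun _ => rfl⟩
  obtain ⟨g, hg⟩ : ∃ g : Pt → ℝ, ∀ p, (lapse M p)⁻¹ = g p := ⟨_, fun _ => rfl⟩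
  obtain ⟨a, ha⟩ : ∃ a : Pt → ℝ, ∀ p, radial p (u p) = a p := ⟨_, fun _ => rfl⟩
  obtain ⟨b, hb⟩ : ∃ b : Pt → ℝ, ∀ p, radial p (v p) = b p := ⟨_, fun _ => rfl⟩
  simp only [hρ, hg, ha, hb] at *
  fun_prop

theorem measurable_rad : Measurable rad := continuous_rad.measurable

theorem measurable_axisDist : Measurable axisDist := by
  unfold axisDist
  fun_prop

/-- The frame is singular on the axis, so the argument combines continuity of the fields with mere
measurability of the frame. -/
theorem BetaSystem.aemeasurable_morawetzBulk {M : ℝ} (hM : 0 < M) {F : Pt → Fin 4 → Fin 4 → ℝ}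
    {u v e h : Pt → Fin 4 → ℝ} (hS : BetaSystem M F u v e h) {Ω : Set Pt} (hΩ : MeasurableSet Ω)
    (hext : Ω ⊆ exterior M) : AEMeasurable (morawetzBulk M F) (volume.restrict Ω) := by
  have hm : ∀ {w : Pt → Fin 4 → ℝ}, SmoothField M w → ∀ a,
      AEMeasurable (fun p => w p a) (volume.restrict Ω) := fun hw a =>
    ((hw a).continuousOn.mono hext).aemeasurable hΩ
  have hβ : ∀ a, AEMeasurable (fun p => fieldβ M F p a) (volume.restrict Ω) := by
    intro a
    have h1 := hm hS.re.smoothu a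
    have h2 := hm hS.im.smoothu a
    have h3 : AEMeasurable (fun p => (u p a : ℂ) + Complex.I * (v p a : ℂ))
      (volume.restrict Ω) := by fun_prop
    refine h3.congr ?_
    filter_upwards [ae_restrict_mem hΩ] with p hp using (hS.fieldβ_eq p (hext hp) a).symm
  have hΘ : AEMeasurable (normΘ M F) (volume.restrict Ω) := by
    have e1 := hm hS.re.smoothe 1; have e2 := hm hS.re.smoothe 2; have e3 := hm hS.re.smoothe 3
    have h1 := hm hS.re.smoothh 1; have h2 := hm hS.re.smoothh 2; have h3 := hm hS.re.smoothh 3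
    have h4 : AEMeasurable (fun p => 1 / 4 * (dot (e p) (e p) + dot (h p) (h p)))
      (volume.restrict Ω) := by
      unfold dot
      fun_prop
    refine h4.congr ?_
    filter_upwards [ae_restrict_mem hΩ] with p hp using (hS.normΘ_eq hM (hext hp)).symm
  have hr := measurable_rad
  have ha := measurable_axisDist
  have hν : ∀ ν : Pt → Fin 4 → ℝ, (∀ a, Measurable fun p => ν p a) →
      AEMeasurable (fun p => ‖βAlong M F p (ν p)‖) (volume.restrict Ω) := by
    intro ν h
    unfold βAlong
    refine AEMeasurable.norm ?_
    refine Finset.aemeasurable_fun_sum _ fun a _ => ?_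
    have h1 := hβ a
    have h2 := h a
    fun_prop
  have hX := hν frameX fun a => by fin_cases a <;> simp [frameX] <;> fun_prop
  have hY := hν frameY fun a => by fin_cases a <;> simp [frameY] <;> fun_prop
  have hZ := hν (frameZ M) fun a => by fin_cases a <;> simp [frameZ] <;> fun_prop
  have hT := hν (frameT M) fun a => by fin_cases a <;> simp [frameT]; fun_prop
  unfold morawetzBulk normβDeg
  fun_prop

theorem BetaSystem.lintegral_cutoff {M : ℝ} (hM : 0 < M) {F : Pt → Fin 4 → Fin 4 → ℝ}
    {u v e h : Pt → Fin 4 → ℝ} (hS : BetaSystem M F u v e h) {n : ℕ} {B : Set Pt}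
    (hB : MeasurableSet B) (hBn : B ⊆ cutoff M n) (hs : SphericallySymmetric B) :
    (∫⁻ p in B, ENNReal.ofReal (morawetzBulk M F p))
        + (∫⁻ p in B, ENNReal.ofReal (div1 M (morawetzP M F) p))
      ≤ ∫⁻ p in B, ENNReal.ofReal (- div1 M (morawetzP M F) p) := by
  have hext := hBn.trans (cutoff_subset_exterior M n)
  have hd : IntegrableOn (div1 M (morawetzP M F)) B :=
    (((hS.continuousOn_div1 hM).mono (cutoff_subset_exterior M n)).integrableOn_compact
      (isCompact_cutoff M n)).mono_set hBn
  obtain ⟨hk, hk0⟩ := integral_rotDiv_eq_zero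
    (fun i j k => contDiffOn_weightedFlux hM hS.re.smoothe hS.re.smoothh i j k) hB hBn hs
  have h0 : 0 ≤ᵐ[volume.restrict B] morawetzBulk M F := by
    filter_upwards [ae_restrict_mem hB] with p hp using hS.morawetzBulk_nonneg hM (hext hp)
  have hle : ∀ᵐ p ∂volume.restrict B, morawetzBulk M F p
      ≤ - div1 M (morawetzP M F) p - rotDiv (weightedFlux M e h) p := by
    filter_upwards [ae_restrict_mem hB] with p hp
    linarith [hS.morawetzBulk_add_rotDiv_le hM (hext hp)]
  -- Integrability comes for free: the bulk term lies between 0 and an integrable function.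
  have hb : IntegrableOn (morawetzBulk M F) B := by
    refine Integrable.mono' (hd.neg.sub hk)
      (hS.aemeasurable_morawetzBulk hM hB hext).aestronglyMeasurable ?_
    filter_upwards [h0, hle] with p h1 h2
    rw [Real.norm_of_nonneg h1]
    exact h2
  refine lintegral_add_le_of_integral_le hb hd h0 ?_
  calc ∫ p in B, morawetzBulk M F p
      ≤ ∫ p in B, (- div1 M (morawetzP M F) p - rotDiv (weightedFlux M e h) p) :=
        integral_mono_ae hb (hd.neg.sub hk) hle
    _ = ∫ p in B, - div1 M (morawetzP M F) p := by
        have h1 := integral_sub hd.neg hk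
        rw [hk0, sub_zero] at h1
        exact h1

/-- All three integrands are nonnegative, so each integral is the supremum over the increasing
symmetric regions Ω ∩ `cutoff M n`, which exhaust Ω. -/
theorem BetaSystem.lintegral_le {M : ℝ} (hM : 0 < M) {F : Pt → Fin 4 → Fin 4 → ℝ}
    {u v e h : Pt → Fin 4 → ℝ} (hS : BetaSystem M F u v e h) {Ω : Set Pt} (hΩ : MeasurableSet Ω)
    (hext : Ω ⊆ exterior M) (hsym : SphericallySymmetric Ω) :
    (∫⁻ p in Ω, ENNReal.ofReal (morawetzBulk M F p))
        + (∫⁻ p in Ω, ENNReal.ofReal (div1 M (morawetzP M F) p))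
      ≤ ∫⁻ p in Ω, ENNReal.ofReal (- div1 M (morawetzP M F) p) := by
  have hmono : Monotone fun n => Ω ∩ cutoff M n := fun m n hmn =>
    Set.inter_subset_inter_right _ (monotone_cutoff M hmn)
  have hU : Ω = ⋃ n, Ω ∩ cutoff M n := by
    rw [← Set.inter_iUnion, Set.inter_eq_left.2 (hext.trans (exterior_subset_iUnion_cutoff M))]
  have hsup : ∀ f : Pt → ENNReal, ∫⁻ p in Ω, f p = ⨆ n, ∫⁻ p in Ω ∩ cutoff M n, f p := by
    intro f
    conv_lhs => rw [hU]
    exact setLIntegral_iUnion_of_directed f hmono.directed_le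
  rw [hsup, hsup, ENNReal.iSup_add_iSup_of_monotone (fun m n hmn => lintegral_mono_set (hmono hmn))
    (fun m n hmn => lintegral_mono_set (hmono hmn))]
  refine iSup_le fun n => (hS.lintegral_cutoff hM
    (hΩ.inter (isClosed_cutoff M n).measurableSet) Set.inter_subset_right ?_).trans
      (lintegral_mono_set Set.inter_subset_left)
  exact fun p q h0 hr hp => ⟨hsym p q h0 hr hp.1, sphericallySymmetric_cutoff M n p q h0 hr hp.2⟩

end Schwarzschild

end

theorem mainTheorem2 (M : ℝ) (hM : 0 < M)
    (F : Schwarzschild.Pt → Fin 4 → Fin 4 → ℝ) (hF : Schwarzschild.IsMaxwellField M F)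
    (Ω : Set Schwarzschild.Pt) (hΩ : MeasurableSet Ω)
    (hext : Ω ⊆ Schwarzschild.exterior M) (hsym : Schwarzschild.SphericallySymmetric Ω) :
    ((∫⁻ p in Ω, ENNReal.ofReal (Schwarzschild.morawetzBulk M F p) ∂(Schwarzschild.vol M))
        + (∫⁻ p in Ω, ENNReal.ofReal (Schwarzschild.div1 M (Schwarzschild.morawetzP M F) p)
            ∂(Schwarzschild.vol M))
      ≤ ∫⁻ p in Ω, ENNReal.ofReal (-Schwarzschild.div1 M (Schwarzschild.morawetzP M F) p)
            ∂(Schwarzschild.vol M))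
    ∧ (IntegrableOn (fun p => Schwarzschild.div1 M (Schwarzschild.morawetzP M F) p) Ω
          (Schwarzschild.vol M) →
        IntegrableOn (fun p => Schwarzschild.morawetzBulk M F p) Ω (Schwarzschild.vol M) ∧
        ∫ p in Ω, Schwarzschild.morawetzBulk M F p ∂(Schwarzschild.vol M)
          ≤ ∫ p in Ω, -Schwarzschild.div1 M (Schwarzschild.morawetzP M F) p
              ∂(Schwarzschild.vol M)) := by
  obtain ⟨u, v, e, h, hS⟩ := Schwarzschild.exists_betaSystem hM hF
  have hvol := Schwarzschild.vol_restrict hM hΩ hext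
  have key := hS.lintegral_le hM hΩ hext hsym
  simp only [IntegrableOn, hvol]
  -- When the divergence is integrable both its positive and negative parts have finite integral, so
  -- the extended inequality forces the bulk term to be integrable and can be rearranged in ℝ.
  refine ⟨key, fun hd => Schwarzschild.integral_le_of_lintegral_add_le
    (hS.aemeasurable_morawetzBulk hM hΩ hext).aestronglyMeasurable hd ?_ key⟩
  filter_upwards [ae_restrict_mem hΩ] with p hp using hS.morawetzBulk_nonneg hM (hext hp)
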